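/- An instance of Fair Correlation Clustering on forests consists of a forest $G=(V,E)$ with $|V|=n\ge 1$ and a coloring $c:V\to\{1,\dots,k\}$ for some $k\ge 1$. Let $V_i=c^{-1}(i)$. A set $\emptyset\ne S\subseteq V$ is fair if $\frac{|S\cap V_i|}{|S|}=\frac{|V_i|}{|V|}$ for every color $i$, and a partition $\mathcal P$ of $V$ (a clustering) is fair if all its sets are fair. The cost of $\mathcal P$ is the number of pairs $\{u,v\}\subseteq V$, $u\ne v$, that are not edges but lie in a common set of $\mathcal P$, plus the number of edges whose endpoints lie in different sets of $\mathcal P$. A fair clustering is $(1+\varepsilon)$-approximate if its cost is at most $(1+\varepsilon)$ times the minimum cost of a fair clustering of the instance. **Theorem.** Fair Correlation Clustering on forests admits a polynomial-time approximation scheme with running time $\mathrm O\bigl(n^{\mathsf{poly}(1/\varepsilon)}\bigr)$. That is, there are a single algorithm and a polynomial $p$ with non-negative integer coefficients such that, given any instance as above (with any number $k$ of colors) and any rational $\varepsilon>0$, the algorithm outputs a $(1+\varepsilon)$-approximate fair clustering in at most $C_\varepsilon\cdot n^{p(1/\varepsilon)}$ steps, where the constant $C_\varepsilon$ depends only on $\varepsilon$.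 Here an algorithm is a program of a random access machine over the natural numbers with unit-cost assignment, addition, truncated subtraction, indirect memory access and zero tests (no multiplication); the input is given by $n$, $k$, the numerator and denominator of $\varepsilon$, the list of vertex colors and the adjacency matrix of $G$, and the output is a list of cluster labels of the vertices. -/

import Mathlib

/-! ### Fair Correlation Clustering -/

namespace FairCC

/-- A subset `S` of the finite coloured set `V` is fair if every colour has the same proportion
in `S` as in the whole of `V`. -/
def FairSet {V : Type*} [Fintype V] [DecidableEq V] {k : ℕ} (c : V → Fin k) (S : Finset V) :
    Prop :=
  ∀ i : Fin k,
    ((S ∩ Finset.univ.filter (fun v => c v = i)).card : ℚ) / (S.card : ℚ) =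
      ((Finset.univ.filter (fun v => c v = i)).card : ℚ) / (Fintype.card V : ℚ)

/-- A partition (clustering) is fair if all its sets are fair. -/
def FairPartition {V : Type*} [Fintype V] [DecidableEq V] {k : ℕ} (c : V → Fin k)
    (P : Finpartition (Finset.univ : Finset V)) : Prop :=
  ∀ S ∈ P.parts, FairSet c S

/-- Intra-cluster cost: the number of non-adjacent pairs `{u, v}`, `u ≠ v` (the edges of the
complement graph), whose two elements lie in the same cluster. -/
noncomputable def intraCost {V : Type*} [Fintype V] [DecidableEq V] (G : SimpleGraph V)
    (P : Finpartition (Finset.univ : Finset V)) : ℕ :=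
  Set.ncard {e : Sym2 V | e ∈ Gᶜ.edgeSet ∧ ∃ S ∈ P.parts, ∀ v ∈ e, v ∈ S}

/-- Inter-cluster cost: the number of edges whose endpoints lie in different clusters. -/
noncomputable def interCost {V : Type*} [Fintype V] [DecidableEq V] (G : SimpleGraph V)
    (P : Finpartition (Finset.univ : Finset V)) : ℕ :=
  Set.ncard {e : Sym2 V | e ∈ G.edgeSet ∧ ¬ ∃ S ∈ P.parts, ∀ v ∈ e, v ∈ S}

/-- The correlation clustering cost (complete, unweighted, min-disagree). -/
noncomputable def ccCost {V : Type*} [Fintype V] [DecidableEq V] (G : SimpleGraph V)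
    (P : Finpartition (Finset.univ : Finset V)) : ℕ :=
  intraCost G P + interCost G P

end FairCC

/-! ### A random access machine with step count

Programs are structured (sequence, conditional, while loop) over elementary RAM instructions.
A program mentions finitely many registers and finitely many arrays; registers and array cells hold
natural numbers. There is no multiplication: in one step the largest stored value at
most doubles (or becomes a constant of the program), so that unit cost is a reasonable cost measure
(polynomially related to Turing machine time). -/

namespace RAM

inductive Prog : Type
  | skip : Prog
  /-- `x := m` -/
  | const (x m : ℕ) : Prog
  /-- `x := y` -/
  | copy (x y : ℕ) : Prog
  /-- `x := y + z` -/
  | add (x y z : ℕ) : Prog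
  /-- `x := max (y - z) 0` -/
  | sub (x y z : ℕ) : Prog
  /-- `x := a[i]`, where the index is the content of register `i` -/
  | load (x a i : ℕ) : Prog
  /-- `a[i] := x`, where the index is the content of register `i` -/
  | store (a i x : ℕ) : Prog
  /-- `p; q` -/
  | seq (p q : Prog) : Prog
  /-- `if x ≠ 0 then p else q` -/
  | cond (x : ℕ) (p q : Prog) : Prog
  /-- `while x ≠ 0 do p` -/
  | loop (x : ℕ) (p : Prog) : Prog

structure State where
  /-- contents of the registers -/
  reg : ℕ → ℕ
  /-- `arr a j` is the content of cell `j` of array `a` -/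
  arr : ℕ → ℕ → ℕ

def State.setReg (s : State) (x v : ℕ) : State :=
  { s with reg := Function.update s.reg x v }

def State.setArr (s : State) (a j v : ℕ) : State :=
  { s with arr := Function.update s.arr a (Function.update (s.arr a) j v) }

/-- `Runs p s t s'`: started in state `s`, the program `p` halts after exactly `t` steps in state
`s'`. Every elementary instruction and every evaluation of a test is one step. -/
inductive Runs : Prog → State → ℕ → State → Prop
  | skip (s : State) : Runs .skip s 1 s
  | const (s : State) (x m : ℕ) : Runs (.const x m) s 1 (s.setReg x m)
  | copy (s : State) (x y : ℕ) : Runs (.copy x y) s 1 (s.setReg x (s.reg y))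
  | add (s : State) (x y z : ℕ) : Runs (.add x y z) s 1 (s.setReg x (s.reg y + s.reg z))
  | sub (s : State) (x y z : ℕ) : Runs (.sub x y z) s 1 (s.setReg x (s.reg y - s.reg z))
  | load (s : State) (x a i : ℕ) : Runs (.load x a i) s 1 (s.setReg x (s.arr a (s.reg i)))
  | store (s : State) (a i x : ℕ) : Runs (.store a i x) s 1 (s.setArr a (s.reg i) (s.reg x))
  | seq {p q : Prog} {s s' s'' : State} {t t' : ℕ} :
      Runs p s t s' → Runs q s' t' s'' → Runs (.seq p q) s (t + t') s''
  | condTrue {x : ℕ} {p q : Prog} {s s' : State} {t : ℕ} :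
      s.reg x ≠ 0 → Runs p s t s' → Runs (.cond x p q) s (t + 1) s'
  | condFalse {x : ℕ} {p q : Prog} {s s' : State} {t : ℕ} :
      s.reg x = 0 → Runs q s t s' → Runs (.cond x p q) s (t + 1) s'
  | loopDone {x : ℕ} {p : Prog} {s : State} :
      s.reg x = 0 → Runs (.loop x p) s 1 s
  | loopStep {x : ℕ} {p : Prog} {s s' s'' : State} {t t' : ℕ} :
      s.reg x ≠ 0 → Runs p s t s' → Runs (.loop x p) s' t' s'' →
        Runs (.loop x p) s (t + t' + 1) s''

/-- The machine is deterministic: step count and final state are determined by program and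
initial state. -/
theorem Runs.deterministic {p : Prog} {s s₁ : State} {t₁ : ℕ} (h₁ : Runs p s t₁ s₁) :
    ∀ {t₂ : ℕ} {s₂ : State}, Runs p s t₂ s₂ → t₁ = t₂ ∧ s₁ = s₂ := by
  induction h₁ with
  | seq _ _ ih ih' =>
    intro t₂ s₂ h
    cases h with
    | seq a b =>
      obtain ⟨rfl, rfl⟩ := ih a
      obtain ⟨rfl, rfl⟩ := ih' b
      exact ⟨rfl, rfl⟩
  | condTrue hx _ ih =>
    intro t₂ s₂ h
    cases h with
    | condTrue _ a => obtain ⟨rfl, rfl⟩ := ih a; exact ⟨rfl, rfl⟩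
    | condFalse hy _ => exact absurd hy hx
  | condFalse hx _ ih =>
    intro t₂ s₂ h
    cases h with
    | condTrue hy _ => exact absurd hx hy
    | condFalse _ a => obtain ⟨rfl, rfl⟩ := ih a; exact ⟨rfl, rfl⟩
  | loopDone hx =>
    intro t₂ s₂ h
    cases h with
    | loopDone _ => exact ⟨rfl, rfl⟩
    | loopStep hy _ _ => exact absurd hx hy
  | loopStep hx _ _ ih ih' =>
    intro t₂ s₂ h
    cases h with
    | loopDone hy => exact absurd hy hx
    | loopStep _ a b =>
      obtain ⟨rfl, rfl⟩ := ih a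
      obtain ⟨rfl, rfl⟩ := ih' b
      exact ⟨rfl, rfl⟩
  | _ => intro t₂ s₂ h; cases h; exact ⟨rfl, rfl⟩

end RAM

namespace FairCC

/-- Initial machine state for the instance `(G, c)` and the accuracy parameter `ε`.
Registers 0, 1, 2, 3 hold `n`, `k`, and numerator and denominator of `ε`; array 0 holds the colours,
array 1 the adjacency matrix of `G` row by row; everything else is 0. -/
noncomputable def inputState {n k : ℕ} (G : SimpleGraph (Fin n)) (c : Fin n → Fin k) (ε : ℚ) :
    RAM.State where
  reg := fun x =>
    if x = 0 then n else if x = 1 then k else if x = 2 then ε.num.toNat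
    else if x = 3 then ε.den else 0
  arr := fun a j =>
    open scoped Classical in
    if a = 0 then (if h : j < n then (c ⟨j, h⟩ : ℕ) else 0)
    else if a = 1 then (if ∃ u v : Fin n, j = u.val * n + v.val ∧ G.Adj u v then 1 else 0)
    else 0

/-- The clustering `P` is the one that state `s` outputs: cell `u` of array 2 holds the label of the
cluster of vertex `u`. -/
def Outputs {n : ℕ} (s : RAM.State) (P : Finpartition (Finset.univ : Finset (Fin n))) : Prop :=
  ∀ u v : Fin n, P.part u = P.part v ↔ s.arr 2 u = s.arr 2 v

/-- `P` is a fair clustering of cost at most `α` times the minimum cost of a fair clustering. -/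
def IsApproxFairClustering {n k : ℕ} (G : SimpleGraph (Fin n)) (c : Fin n → Fin k) (α : ℝ)
    (P : Finpartition (Finset.univ : Finset (Fin n))) : Prop :=
  FairPartition c P ∧
    ∀ Q : Finpartition (Finset.univ : Finset (Fin n)), FairPartition c Q →
      (ccCost G P : ℝ) ≤ α * (ccCost G Q : ℝ)

/-- The single program `A` is an approximation scheme for Fair Correlation Clustering on forests
with running time `O(n ^ f ε)`: given a forest with `n ≥ 1` coloured vertices and
a rational `ε > 0`, it halts with a `(1 + ε)`-approximate fair clustering after at most
`C * n ^ f ε` steps, where `C` depends on `ε` only. -/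
def IsForestApproxScheme (A : RAM.Prog) (f : ℚ → ℝ) : Prop :=
  ∀ ε : ℚ, 0 < ε → ∃ C : ℝ,
    ∀ (n k : ℕ) (G : SimpleGraph (Fin n)) (c : Fin n → Fin k), 0 < n → G.IsAcyclic →
      ∃ (t : ℕ) (s : RAM.State) (P : Finpartition (Finset.univ : Finset (Fin n))),
        RAM.Runs A (inputState G c ε) t s ∧
        (t : ℝ) ≤ C * (n : ℝ) ^ (f ε) ∧
        Outputs s P ∧
        IsApproxFairClustering G c (1 + (ε : ℝ)) P

end FairCC

set_option linter.unusedSectionVars false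

namespace RAM

/-! ### A structured language with total semantics, compiled to the machine -/

/-! Let `g` be the greatest common divisor of the colour class sizes and `d = n / g`. Every fair set
contains the colours `j` times as often as a smallest fair set, which has `d` vertices
(`Palette.exists_multiple`). Counting ordered pairs, twice the cost of a clustering is `samePairs +
arcs univ - 2 * sameArcs` (`two_mul_ccCost`): clusters should be small and contain many edges. Of
the forest only one property is used, namely that every nonempty set of vertices spans a vertex of
degree at most one (`Degenerate`). Let `b` be the denominator of `ε`, so that `1 / b ≤ ε`. The size
of `d` decides what to do.

If `d = 1`, every nonempty set is fair and the edges of a maximum matching, with singletons, are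
optimal. If `d = 2`, the same holds with a matching along bichromatic edges. A greedy matching along
a leaf elimination comes with a cover of the relevant edges by at most half of the matched vertices
(`MatchInv.two_mul_card_covering_le`), and such a cover bounds what any clustering can gain
(`two_mul_sameArcs_le_of_cover`, `two_mul_sameArcs_add_card_le_of_cover`).

If `d ≥ 3`, cutting clusters into minimal fair sets does not raise the cost
(`exists_minimal_labeling`). Then `samePairs` is fixed, and only the number of edges inside clusters
matters. If moreover `d ≥ 4 * b + 3`, the pairs inside clusters outweigh all edges, and every
clustering into minimal fair sets is good enough (`approximates_of_large`).

In the middle range the cost is at least proportional to `n`, so that `n / (3 * b)` arcs may be lost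
(`approximates_of_sameArcs_le`). Leaf elimination cuts the forest into pieces of bounded size;
clusters of size `d` lose few arcs by this (`PieceInv.sameArcs_le`). Up to isomorphism of coloured
graphs with ordered vertices there are boundedly many types of pieces. The pieces of each type are
dealt round robin to about `n / K` chunks of bounded size, for a constant `K`. Each chunk is a
scaled copy of the whole: rounding down the number of clusters of each configuration turns any
minimal clustering into a partial clustering of the chunk that keeps its share of arcs up to a
constant (`exists_chunk_labeling`). So exhaustive search in every chunk is nearly optimal
(`search_spec`), and the vertices left over can be cut into minimal fair sets (`complete_labeling`).

The program is written in a small language with bounded loops and a total semantics, and compiled to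
the machine. If all loop bounds are at most `M` and are never overwritten, the time is at most `size
* (M + 1) ^ depth` (`Cmd.exec_comp`). The loops of the main program run up to `n` or up to an
iterated power of two that depends on `b` only. Hence the exponent of `n` is even an absolute
constant, and `ε` enters the constant factor alone. -/

@[simp] theorem State.reg_setReg (s : State) (x v y : ℕ) :
    (s.setReg x v).reg y = if y = x then v else s.reg y := by
  simp [State.setReg, Function.update_apply]

@[simp] theorem State.arr_setReg (s : State) (x v : ℕ) : (s.setReg x v).arr = s.arr := rfl

@[simp] theorem State.reg_setArr (s : State) (a j v : ℕ) : (s.setArr a j v).reg = s.reg := rfl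

theorem State.arr_setArr (s : State) (a j v a' : ℕ) :
    (s.setArr a j v).arr a' = if a' = a then Function.update (s.arr a) j v else s.arr a' := by
  simp only [State.setArr, Function.update_apply]

/-- Two states agree on all arrays and on the registers below `t`. -/
def Agree (t : ℕ) (s s' : State) : Prop := (∀ y < t, s.reg y = s'.reg y) ∧ s.arr = s'.arr

theorem Agree.refl (t : ℕ) (s : State) : Agree t s s := ⟨fun _ _ => rfl, rfl⟩

theorem Agree.trans {t : ℕ} {s s' s'' : State} (h : Agree t s s') (h' : Agree t s' s'') :
    Agree t s s'' := ⟨fun y hy => (h.1 y hy).trans (h'.1 y hy), h.2.trans h'.2⟩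

theorem Agree.mono {t t' : ℕ} {s s' : State} (h : Agree t s s') (htt : t' ≤ t) : Agree t' s s' :=
  ⟨fun y hy => h.1 y (hy.trans_le htt), h.2⟩

theorem Agree.setReg {t : ℕ} {s s' : State} (h : Agree t s s') (x v : ℕ) :
    Agree t (s.setReg x v) (s'.setReg x v) := by
  refine ⟨fun y hy => ?_, h.2⟩
  simp [h.1 y hy]

theorem Agree.setReg_left {t x : ℕ} {s s' : State} (h : Agree t s s') (hx : t ≤ x) (v : ℕ) :
    Agree t (s.setReg x v) s' := by
  refine ⟨fun y hy => ?_, h.2⟩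
  simp [h.1 y hy, (hy.trans_le hx).ne]

/-- Expressions, with sums over `x < r` for a register `r`. -/
inductive Expr : Type
  | lit (m : ℕ) : Expr
  | var (x : ℕ) : Expr
  | add (e f : Expr) : Expr
  | sub (e f : Expr) : Expr
  | get (a : ℕ) (e : Expr) : Expr
  | ite (c e f : Expr) : Expr
  | sum (x r : ℕ) (e : Expr) : Expr

namespace Expr

def eval : Expr → State → ℕ
  | lit m, _ => m
  | var x, s => s.reg x
  | add e f, s => e.eval s + f.eval s
  | sub e f, s => e.eval s - f.eval s
  | get a e, s => s.arr a (e.eval s)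
  | ite c e f, s => if c.eval s ≠ 0 then e.eval s else f.eval s
  | sum x r e, s => ∑ j ∈ Finset.range (s.reg r), e.eval (s.setReg x j)

/-- All registers that occur are below `t`. -/
def Below (t : ℕ) : Expr → Prop
  | lit _ => True
  | var x => x < t
  | add e f => e.Below t ∧ f.Below t
  | sub e f => e.Below t ∧ f.Below t
  | get _ e => e.Below t
  | ite c e f => c.Below t ∧ e.Below t ∧ f.Below t
  | sum x r e => x < t ∧ r < t ∧ e.Below t

instance decidableBelow (t : ℕ) : (e : Expr) → Decidable (e.Below t)
  | lit _ => instDecidableTrue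
  | var x => inferInstanceAs (Decidable (x < t))
  | add e f => @instDecidableAnd _ _ (decidableBelow t e) (decidableBelow t f)
  | sub e f => @instDecidableAnd _ _ (decidableBelow t e) (decidableBelow t f)
  | get _ e => decidableBelow t e
  | ite c e f => @instDecidableAnd _ _ (decidableBelow t c)
      (@instDecidableAnd _ _ (decidableBelow t e) (decidableBelow t f))
  | sum x r e => @instDecidableAnd _ _ (inferInstanceAs (Decidable (x < t)))
      (@instDecidableAnd _ _ (inferInstanceAs (Decidable (r < t))) (decidableBelow t e))

theorem Below.mono {t t' : ℕ} (htt : t ≤ t') : ∀ {e : Expr}, e.Below t → e.Below t'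
  | lit _, _ => trivial
  | var _, h => lt_of_lt_of_le h htt
  | add _ _, h => ⟨h.1.mono htt, h.2.mono htt⟩
  | sub _ _, h => ⟨h.1.mono htt, h.2.mono htt⟩
  | get _ e, h => Below.mono (e := e) htt h
  | ite _ _ _, h => ⟨h.1.mono htt, h.2.1.mono htt, h.2.2.mono htt⟩
  | sum _ _ _, h => ⟨h.1.trans_le htt, h.2.1.trans_le htt, h.2.2.mono htt⟩

/-- The registers that bound sums. -/
def bnds : Expr → List ℕ
  | lit _ => []
  | var _ => []
  | add e f => e.bnds ++ f.bnds
  | sub e f => e.bnds ++ f.bnds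
  | get _ e => e.bnds
  | ite c e f => c.bnds ++ (e.bnds ++ f.bnds)
  | sum _ r e => r :: e.bnds

/-- The summation variables. -/
def mods : Expr → List ℕ
  | lit _ => []
  | var _ => []
  | add e f => e.mods ++ f.mods
  | sub e f => e.mods ++ f.mods
  | get _ e => e.mods
  | ite c e f => c.mods ++ (e.mods ++ f.mods)
  | sum x _ e => x :: e.mods

/-- With `depth` this yields the time bound `size * (M + 1) ^ depth` when all bounds are at most
`M`. The added constants pay for the bookkeeping at each node. -/
def size : Expr → ℕ
  | lit _ => 1
  | var _ => 1
  | add e f => e.size + f.size + 1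
  | sub e f => e.size + f.size + 1
  | get _ e => e.size + 1
  | ite c e f => c.size + e.size + f.size + 2
  | sum _ _ e => e.size + 12

def depth : Expr → ℕ
  | lit _ => 0
  | var _ => 0
  | add e f => max e.depth f.depth
  | sub e f => max e.depth f.depth
  | get _ e => e.depth
  | ite c e f => max c.depth (max e.depth f.depth)
  | sum _ _ e => e.depth + 1

theorem eval_congr {t : ℕ} : ∀ {e : Expr} {s s' : State}, e.Below t → Agree t s s' →
    e.eval s = e.eval s'
  | lit _, _, _, _, _ => rfl
  | var x, _, _, h, ha => ha.1 x h
  | add e f, _, _, h, ha => by simp only [eval, eval_congr h.1 ha, eval_congr h.2 ha]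
  | sub e f, _, _, h, ha => by simp only [eval, eval_congr h.1 ha, eval_congr h.2 ha]
  | get a e, _, _, h, ha => by
      have : e.Below t := h
      simp only [eval, eval_congr this ha, ha.2]
  | ite c e f, _, _, h, ha => by
      simp only [eval, eval_congr h.1 ha, eval_congr h.2.1 ha, eval_congr h.2.2 ha]
  | sum x r e, _, _, h, ha => by
      simp only [eval, ha.1 r h.2.1]
      exact Finset.sum_congr rfl fun j _ => eval_congr h.2.2 (ha.setReg x j)

/-- Code that leaves the value of the expression in register `t`, using registers from `t` on. -/
def comp : Expr → ℕ → Prog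
  | lit m, t => .const t m
  | var x, t => .copy t x
  | add e f, t => .seq (e.comp t) (.seq (f.comp (t + 1)) (.add t t (t + 1)))
  | sub e f, t => .seq (e.comp t) (.seq (f.comp (t + 1)) (.sub t t (t + 1)))
  | get a e, t => .seq (e.comp t) (.load t a t)
  | ite c e f, t => .seq (c.comp t) (.cond t (e.comp t) (f.comp t))
  -- Register `t` accumulates, `t + 1` saves `x`, `t + 2` counts down, `t + 3` holds 1 and `t + 4`
  -- the index. Restoring `x` at the end leaves everything below `t` unchanged.
  | sum x r e, t =>
      .seq (.const t 0) <| .seq (.copy (t + 1) x) <| .seq (.copy (t + 2) r) <|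
      .seq (.const (t + 3) 1) <| .seq (.const (t + 4) 0) <|
      .seq (.loop (t + 2) (.seq (.copy x (t + 4)) <| .seq (e.comp (t + 5)) <|
        .seq (.add t t (t + 5)) <| .seq (.add (t + 4) (t + 4) (t + 3))
          (.sub (t + 2) (t + 2) (t + 3))))
      (.copy x (t + 1))

end Expr

/-- From `s`, the program halts within `T` steps in a state satisfying `Q`. -/
def Exec (p : Prog) (s : State) (T : ℕ) (Q : State → Prop) : Prop :=
  ∃ t s', Runs p s t s' ∧ t ≤ T ∧ Q s'

theorem Exec.mono {p : Prog} {s : State} {T T' : ℕ} {Q Q' : State → Prop} (h : Exec p s T Q)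
    (hT : T ≤ T') (hQ : ∀ s', Q s' → Q' s') : Exec p s T' Q' := by
  obtain ⟨t, s', hr, ht, hq⟩ := h
  exact ⟨t, s', hr, ht.trans hT, hQ _ hq⟩

theorem Exec.seq {p q : Prog} {s : State} {T T' : ℕ} {Q R : State → Prop} (h : Exec p s T Q)
    (h' : ∀ s', Q s' → Exec q s' T' R) : Exec (.seq p q) s (T + T') R := by
  obtain ⟨t, s', hr, ht, hq⟩ := h
  obtain ⟨t', s'', hr', ht', hq'⟩ := h' s' hq
  exact ⟨t + t', s'', hr.seq hr', by omega, hq'⟩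

theorem Exec.seq_of_runs {p q : Prog} {s s' : State} {T : ℕ} {R : State → Prop}
    (h : Runs p s 1 s') (h' : Exec q s' T R) : Exec (.seq p q) s (T + 1) R := by
  obtain ⟨t', s'', hr', ht', hq'⟩ := h'
  exact ⟨1 + t', s'', h.seq hr', by omega, hq'⟩

theorem Exec.of_runs {p : Prog} {s s' : State} {Q : State → Prop}
    (h : Runs p s 1 s') (h' : Q s') : Exec p s 1 Q := ⟨1, s', h, le_rfl, h'⟩

/-- A loop whose counter register decreases by one in each round. -/
theorem Exec.loop {x : ℕ} {p : Prog} {T : ℕ} (Inv : ℕ → State → Prop)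
    (hx : ∀ m s, Inv m s → s.reg x = m)
    (hp : ∀ m s, Inv (m + 1) s → Exec p s T (Inv m)) :
    ∀ m s, Inv m s → Exec (.loop x p) s (m * (T + 1) + 1) (Inv 0) := by
  intro m
  induction m with
  | zero =>
    intro s h
    exact ⟨1, s, .loopDone (hx 0 s h), by omega, h⟩
  | succ m ih =>
    intro s h
    obtain ⟨t, s', hr, ht, hq⟩ := hp m s h
    obtain ⟨t', s'', hr', ht', hq'⟩ := ih s' hq
    refine ⟨t + t' + 1, s'', .loopStep (by rw [hx _ _ h]; omega) hr hr', ?_, hq'⟩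
    nlinarith

theorem mul_pow_le_mul_pow_max (a M : ℕ) {k l : ℕ} (h : k ≤ l) :
    a * (M + 1) ^ k ≤ a * (M + 1) ^ l :=
  Nat.mul_le_mul_left _ (Nat.pow_le_pow_right (Nat.succ_pos M) h)

namespace Expr

/-- Structural induction. As no bound is a summation variable, inner sums see the bounds of the
initial state in every round, so all rounds obey the same time bound. -/
theorem exec_comp {M : ℕ} : ∀ (e : Expr) (t : ℕ) (s : State), e.Below t →
    (∀ r ∈ e.bnds, r ∉ e.mods) → (∀ r ∈ e.bnds, s.reg r ≤ M) →
    Exec (e.comp t) s (e.size * (M + 1) ^ e.depth)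
      (fun s' => Agree t s' s ∧ s'.reg t = e.eval s)
  | lit m, t, s, _, _, _ =>
      (Exec.of_runs (.const s t m) ⟨(Agree.refl t s).setReg_left le_rfl m, by simp [eval]⟩).mono
        (by simp [size, depth]) fun _ h => h
  | var x, t, s, _, _, _ =>
      (Exec.of_runs (.copy s t x) ⟨(Agree.refl t s).setReg_left le_rfl _, by simp [eval]⟩).mono
        (by simp [size, depth]) fun _ h => h
  | add e f, t, s, hb, hd, hM => by
      simp only [bnds, mods, List.mem_append] at hd hM
      have he := exec_comp e t s hb.1 (fun r hr h => hd r (.inl hr) (.inl h))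
        fun r hr => hM r (.inl hr)
      refine Exec.mono (he.seq (T' := f.size * (M + 1) ^ f.depth + 1)
        (R := fun s' => Agree t s' s ∧ s'.reg t = (add e f).eval s) ?_) ?_ fun _ h => h
      · rintro s₁ ⟨ha, hv⟩
        have hfM : ∀ r ∈ f.bnds, s₁.reg r ≤ M := fun r hr => by
          rw [ha.1 r (bnds_lt hb.2 r hr)]; exact hM r (.inr hr)
        have hf := exec_comp f (t + 1) s₁ (hb.2.mono (Nat.le_succ t))
          (fun r hr h => hd r (.inr hr) (.inr h)) hfM
        refine hf.seq ?_
        rintro s₂ ⟨ha₂, hv₂⟩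
        refine Exec.of_runs (.add s₂ t t (t + 1)) ⟨?_, ?_⟩
        · exact ((ha₂.mono (Nat.le_succ t)).trans ha).setReg_left le_rfl _
        · rw [State.reg_setReg, if_pos rfl, hv₂, ha₂.1 t (Nat.lt_succ_self t), hv,
            eval_congr hb.2 ha]; rfl
      · have h1 := mul_pow_le_mul_pow_max e.size M (le_max_left e.depth f.depth)
        have h2 := mul_pow_le_mul_pow_max f.size M (le_max_right e.depth f.depth)
        have h3 : 1 ≤ (M + 1) ^ (max e.depth f.depth) := Nat.one_le_pow _ _ (Nat.succ_pos M)
        simp only [size, depth]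
        nlinarith
  | sub e f, t, s, hb, hd, hM => by
      simp only [bnds, mods, List.mem_append] at hd hM
      have he := exec_comp e t s hb.1 (fun r hr h => hd r (.inl hr) (.inl h))
        fun r hr => hM r (.inl hr)
      refine Exec.mono (he.seq (T' := f.size * (M + 1) ^ f.depth + 1)
        (R := fun s' => Agree t s' s ∧ s'.reg t = (sub e f).eval s) ?_) ?_ fun _ h => h
      · rintro s₁ ⟨ha, hv⟩
        have hfM : ∀ r ∈ f.bnds, s₁.reg r ≤ M := fun r hr => by
          rw [ha.1 r (bnds_lt hb.2 r hr)]; exact hM r (.inr hr)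
        have hf := exec_comp f (t + 1) s₁ (hb.2.mono (Nat.le_succ t))
          (fun r hr h => hd r (.inr hr) (.inr h)) hfM
        refine hf.seq ?_
        rintro s₂ ⟨ha₂, hv₂⟩
        refine Exec.of_runs (.sub s₂ t t (t + 1)) ⟨?_, ?_⟩
        · exact ((ha₂.mono (Nat.le_succ t)).trans ha).setReg_left le_rfl _
        · rw [State.reg_setReg, if_pos rfl, hv₂, ha₂.1 t (Nat.lt_succ_self t), hv,
            eval_congr hb.2 ha]; rfl
      · have h1 := mul_pow_le_mul_pow_max e.size M (le_max_left e.depth f.depth)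
        have h2 := mul_pow_le_mul_pow_max f.size M (le_max_right e.depth f.depth)
        have h3 : 1 ≤ (M + 1) ^ (max e.depth f.depth) := Nat.one_le_pow _ _ (Nat.succ_pos M)
        simp only [size, depth]
        nlinarith
  | get a e, t, s, hb, hd, hM => by
      have hb' : e.Below t := hb
      have he := exec_comp e t s hb' hd hM
      refine Exec.mono (he.seq (T' := 1)
        (R := fun s' => Agree t s' s ∧ s'.reg t = (get a e).eval s) ?_) ?_ fun _ h => h
      · rintro s₁ ⟨ha, hv⟩
        refine Exec.of_runs (.load s₁ t a t) ⟨ha.setReg_left le_rfl _, ?_⟩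
        rw [State.reg_setReg, if_pos rfl, hv, ha.2]; rfl
      · have h3 : 1 ≤ (M + 1) ^ e.depth := Nat.one_le_pow _ _ (Nat.succ_pos M)
        simp only [size, depth]
        nlinarith
  | ite c e f, t, s, hb, hd, hM => by
      simp only [bnds, mods, List.mem_append] at hd hM
      have hc := exec_comp c t s hb.1 (fun r hr h => hd r (.inl hr) (.inl h))
        fun r hr => hM r (.inl hr)
      refine Exec.mono (hc.seq
        (T' := e.size * (M + 1) ^ e.depth + f.size * (M + 1) ^ f.depth + 1)
        (R := fun s' => Agree t s' s ∧ s'.reg t = (ite c e f).eval s) ?_) ?_ fun _ h => h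
      · rintro s₁ ⟨ha, hv⟩
        have he := exec_comp e t s₁ hb.2.1
          (fun r hr h => hd r (.inr (.inl hr)) (.inr (.inl h)))
          fun r hr => by rw [ha.1 r (bnds_lt hb.2.1 r hr)]; exact hM r (.inr (.inl hr))
        have hf := exec_comp f t s₁ hb.2.2
          (fun r hr h => hd r (.inr (.inr hr)) (.inr (.inr h)))
          fun r hr => by rw [ha.1 r (bnds_lt hb.2.2 r hr)]; exact hM r (.inr (.inr hr))
        by_cases h0 : s₁.reg t = 0
        · obtain ⟨t', s', hr, ht, ha', hv'⟩ := hf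
          refine ⟨t' + 1, s', .condFalse h0 hr, by omega, ha'.trans ha, ?_⟩
          rw [hv', eval_congr hb.2.2 ha, eval, if_neg (by rw [← hv]; simpa using h0)]
        · obtain ⟨t', s', hr, ht, ha', hv'⟩ := he
          refine ⟨t' + 1, s', .condTrue h0 hr, by omega, ha'.trans ha, ?_⟩
          rw [hv', eval_congr hb.2.1 ha, eval, if_pos (by rw [← hv]; simpa using h0)]
      · have h1 := mul_pow_le_mul_pow_max c.size M (le_max_left c.depth (max e.depth f.depth))
        have h2 := mul_pow_le_mul_pow_max e.size M
          ((le_max_left e.depth f.depth).trans (le_max_right c.depth _))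
        have h4 := mul_pow_le_mul_pow_max f.size M
          ((le_max_right e.depth f.depth).trans (le_max_right c.depth _))
        have h3 : 1 ≤ (M + 1) ^ (max c.depth (max e.depth f.depth)) :=
          Nat.one_le_pow _ _ (Nat.succ_pos M)
        simp only [size, depth]
        nlinarith
  | sum x r e, t, s, hb, hd, hM => by
      obtain ⟨hxt, hrt, hbe⟩ := hb
      simp only [bnds, mods, List.mem_cons] at hd hM
      have hrx : r ≠ x := fun h => hd r (.inl rfl) (.inl h)
      have hrM := hM r (.inl rfl)
      set T := e.size * (M + 1) ^ e.depth with hT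
      -- `m` rounds remain and the accumulator holds the first `s.reg r - m` terms. Register `x` is
      -- exempt from the agreement until it is restored.
      let Inv : ℕ → State → Prop := fun m s' =>
        (∀ y < t, y ≠ x → s'.reg y = s.reg y) ∧ s'.arr = s.arr ∧ m ≤ s.reg r ∧
        s'.reg (t + 1) = s.reg x ∧ s'.reg (t + 2) = m ∧ s'.reg (t + 3) = 1 ∧
        s'.reg (t + 4) = s.reg r - m ∧
        s'.reg t = ∑ j ∈ Finset.range (s.reg r - m), e.eval (s.setReg x j)
      have hloop := Exec.loop (x := t + 2) (p := .seq (.copy x (t + 4)) <|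
        .seq (e.comp (t + 5)) <| .seq (.add t t (t + 5)) <| .seq (.add (t + 4) (t + 4) (t + 3))
          (.sub (t + 2) (t + 2) (t + 3))) (T := T + (1 + 1 + 1) + 1) Inv
        (fun m s' h => h.2.2.2.2.1) (by
          rintro m s' ⟨i1, i2, i3, i4, i5, i6, i7, i8⟩
          refine Exec.seq_of_runs (.copy s' x (t + 4)) ?_
          have he := exec_comp (M := M) e (t + 5) (s'.setReg x (s'.reg (t + 4)))
            (hbe.mono (by omega)) (fun r hr h => hd r (.inr hr) (.inr h)) (fun r' hr' => by
              have h1 : r' ≠ x := fun h => hd r' (.inr hr') (.inl h)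
              rw [State.reg_setReg, if_neg h1, i1 r' (bnds_lt hbe r' hr') h1]
              exact hM r' (.inr hr'))
          have hag : Agree t (s'.setReg x (s'.reg (t + 4))) (s.setReg x (s.reg r - (m + 1))) := by
            refine ⟨fun y hy => ?_, i2⟩
            simp only [State.reg_setReg]
            split
            · exact i7
            · exact i1 y hy ‹_›
          rw [eval_congr hbe hag] at he
          refine he.seq ?_
          rintro s₁ ⟨ha, hv⟩
          refine Exec.seq_of_runs (.add s₁ t t (t + 5)) ?_
          refine Exec.seq_of_runs (.add _ (t + 4) (t + 4) (t + 3)) ?_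
          refine Exec.of_runs (.sub _ (t + 2) (t + 2) (t + 3)) ?_
          have k : ∀ y < t + 5, y ≠ x → s₁.reg y = s'.reg y := fun y hy hyx => by
            rw [ha.1 y hy, State.reg_setReg, if_neg hyx]
          have hsub : s.reg r - m = (s.reg r - (m + 1)) + 1 := by omega
          refine ⟨fun y hy hyx => ?_, ?_, by omega, ?_, ?_, ?_, ?_, ?_⟩
          · have h1 : y ≠ t + 2 := by omega
            have h2 : y ≠ t + 4 := by omega
            have h3 : y ≠ t := by omega
            simp [h1, h2, h3, k y (by omega) hyx, i1 y hy hyx]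
          · simp only [State.arr_setReg]; rw [ha.2]; exact i2
          · simp [k (t + 1) (by omega) (by omega), i4]
          · simp [k (t + 2) (by omega) (by omega), k (t + 3) (by omega) (by omega), i5, i6]
          · simp [k (t + 3) (by omega) (by omega), i6]
          · simp [k (t + 3) (by omega) (by omega), k (t + 4) (by omega) (by omega), i6, i7]
            omega
          · simp [k t (by omega) (by omega), hv, i8]
            rw [hsub, Finset.sum_range_succ])
      simp only [comp]
      refine Exec.mono (T := (s.reg r * (T + (1 + 1 + 1) + 1 + 1) + 1 + 1) + 1 + 1 + 1 + 1 + 1)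
        (Q := fun s' => Agree t s' s ∧ s'.reg t = (sum x r e).eval s) ?_ ?_ fun _ h => h
      · refine Exec.seq_of_runs (.const _ _ _) <| Exec.seq_of_runs (.copy _ _ _) <|
          Exec.seq_of_runs (.copy _ _ _) <| Exec.seq_of_runs (.const _ _ _) <|
          Exec.seq_of_runs (.const _ _ _) ?_
        refine Exec.seq (T' := 1) (Q := Inv 0) (hloop (s.reg r) _ ?_) ?_
        · have h1 : r ≠ t := by omega
          have h2 : x ≠ t := by omega
          have h4 : r ≠ t + 1 := by omega
          refine ⟨fun y hy _ => ?_, ?_, le_rfl, ?_, ?_, ?_, ?_, ?_⟩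
          · have h1 : y ≠ t + 2 := by omega
            have h2 : y ≠ t + 4 := by omega
            have h3 : y ≠ t := by omega
            have h4 : y ≠ t + 1 := by omega
            have h5 : y ≠ t + 3 := by omega
            simp [h1, h2, h3, h4, h5]
          · rfl
          all_goals simp [h1, h2, h4]
        · rintro s₁ ⟨i1, i2, i3, i4, i5, i6, i7, i8⟩
          refine Exec.of_runs (.copy _ _ _) ⟨⟨fun y hy => ?_, i2⟩, ?_⟩
          · rw [State.reg_setReg]
            split
            · rw [i4]; congr 1; exact ‹y = x›.symm
            · exact i1 y hy ‹_›
          · rw [State.reg_setReg, if_neg (by omega), i8]; simp [eval]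
      · have h3 : 1 ≤ (M + 1) ^ e.depth := Nat.one_le_pow _ _ (Nat.succ_pos M)
        have h4 : s.reg r * (T + 5) ≤ M * (T + 5) := Nat.mul_le_mul_right _ hrM
        have h5 : 1 ≤ M + 1 := by omega
        simp only [size, depth, pow_succ]
        have h6 : (e.size + 12) * ((M + 1) ^ e.depth * (M + 1)) =
          (T + 12 * (M + 1) ^ e.depth) * (M + 1) := by rw [hT]; ring
        rw [h6]
        nlinarith
where
  bnds_lt {t : ℕ} : ∀ {e : Expr}, e.Below t → ∀ r ∈ e.bnds, r < t
    | lit _, _, r, hr => by simp [bnds] at hr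
    | var _, _, r, hr => by simp [bnds] at hr
    | add e f, h, r, hr => (List.mem_append.1 hr).elim (bnds_lt h.1 r) (bnds_lt h.2 r)
    | sub e f, h, r, hr => (List.mem_append.1 hr).elim (bnds_lt h.1 r) (bnds_lt h.2 r)
    | get _ e, h, r, hr => bnds_lt (e := e) h r hr
    | ite c e f, h, r, hr => (List.mem_append.1 hr).elim (bnds_lt h.1 r) fun hr =>
        (List.mem_append.1 hr).elim (bnds_lt h.2.1 r) (bnds_lt h.2.2 r)
    | sum x r' e, h, r, hr => (List.mem_cons.1 hr).elim (fun h' => h' ▸ h.2.1)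
        (bnds_lt h.2.2 r)

end Expr

end RAM

/-! ### Commands with bounded loops, and their running time -/

namespace RAM

/-- Commands with loops over `x < r`, where `r` is a register. -/
inductive Cmd : Type
  | skip : Cmd
  | assign (x : ℕ) (e : Expr) : Cmd
  | store (a : ℕ) (i e : Expr) : Cmd
  | seq (c d : Cmd) : Cmd
  | ite (e : Expr) (c d : Cmd) : Cmd
  | loop (x r : ℕ) (c : Cmd) : Cmd

namespace Cmd

/-- The bound of a loop is read once, before the first round, and the loop variable is set anew in
each round. Hence every command terminates. -/
def run : Cmd → State → State
  | skip, s => s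
  | assign x e, s => s.setReg x (e.eval s)
  | store a i e, s => s.setArr a (i.eval s) (e.eval s)
  | seq c d, s => d.run (c.run s)
  | ite e c d, s => if e.eval s ≠ 0 then c.run s else d.run s
  | loop x r c, s => Nat.rec s (fun j s' => c.run (s'.setReg x j)) (s.reg r)

def Below (t : ℕ) : Cmd → Prop
  | skip => True
  | assign x e => x < t ∧ e.Below t
  | store _ i e => i.Below t ∧ e.Below t
  | seq c d => c.Below t ∧ d.Below t
  | ite e c d => e.Below t ∧ c.Below t ∧ d.Below t
  | loop x r c => x < t ∧ r < t ∧ c.Below t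

instance decidableBelow (t : ℕ) : (c : Cmd) → Decidable (c.Below t)
  | skip => instDecidableTrue
  | assign x e => inferInstanceAs (Decidable (x < t ∧ e.Below t))
  | store _ i e => inferInstanceAs (Decidable (i.Below t ∧ e.Below t))
  | seq c d => @instDecidableAnd _ _ (decidableBelow t c) (decidableBelow t d)
  | ite e c d => @instDecidableAnd _ _ (inferInstanceAs (Decidable (e.Below t)))
      (@instDecidableAnd _ _ (decidableBelow t c) (decidableBelow t d))
  | loop x r c => @instDecidableAnd _ _ (inferInstanceAs (Decidable (x < t)))
      (@instDecidableAnd _ _ (inferInstanceAs (Decidable (r < t))) (decidableBelow t c))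

theorem Below.mono {t t' : ℕ} (htt : t ≤ t') : ∀ {c : Cmd}, c.Below t → c.Below t'
  | skip, _ => trivial
  | assign _ _, h => ⟨h.1.trans_le htt, h.2.mono htt⟩
  | store _ _ _, h => ⟨h.1.mono htt, h.2.mono htt⟩
  | seq _ _, h => ⟨h.1.mono htt, h.2.mono htt⟩
  | ite _ _ _, h => ⟨h.1.mono htt, h.2.1.mono htt, h.2.2.mono htt⟩
  | loop _ _ _, h => ⟨h.1.trans_le htt, h.2.1.trans_le htt, h.2.2.mono htt⟩

/-- The registers that bound loops and sums. -/
def bnds : Cmd → List ℕ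
  | skip => []
  | assign _ e => e.bnds
  | store _ i e => i.bnds ++ e.bnds
  | seq c d => c.bnds ++ d.bnds
  | ite e c d => e.bnds ++ (c.bnds ++ d.bnds)
  | loop _ r c => r :: c.bnds

/-- The registers written by the command itself, not counting summation variables. -/
def writes : Cmd → List ℕ
  | skip => []
  | assign x _ => [x]
  | store _ _ _ => []
  | seq c d => c.writes ++ d.writes
  | ite _ c d => c.writes ++ d.writes
  | loop x _ c => x :: c.writes

/-- The arrays written. -/
def stores : Cmd → List ℕ
  | skip => []
  | assign _ _ => []
  | store a _ _ => [a]
  | seq c d => c.stores ++ d.stores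
  | ite _ c d => c.stores ++ d.stores
  | loop _ _ c => c.stores

/-- The registers written and the summation variables. -/
def mods : Cmd → List ℕ
  | skip => []
  | assign x e => x :: e.mods
  | store _ i e => i.mods ++ e.mods
  | seq c d => c.mods ++ d.mods
  | ite e c d => e.mods ++ (c.mods ++ d.mods)
  | loop x _ c => x :: c.mods

def size : Cmd → ℕ
  | skip => 1
  | assign _ e => e.size + 1
  | store _ i e => i.size + e.size + 1
  | seq c d => c.size + d.size
  | ite e c d => e.size + c.size + d.size + 1
  | loop _ _ c => c.size + 8

def depth : Cmd → ℕ
  | skip => 0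
  | assign _ e => e.depth
  | store _ i e => max i.depth e.depth
  | seq c d => max c.depth d.depth
  | ite e c d => max e.depth (max c.depth d.depth)
  | loop _ _ c => c.depth + 1

theorem writes_subset_mods : ∀ (c : Cmd), c.writes ⊆ c.mods
  | skip => by simp [writes]
  | assign x e => by simp [writes, mods]
  | store _ _ _ => by simp [writes]
  | seq c d => by
      have h1 := writes_subset_mods c
      have h2 := writes_subset_mods d
      intro x
      simp only [writes, mods, List.mem_append]
      exact Or.imp (@h1 x) (@h2 x)
  | ite e c d => by
      have h1 := writes_subset_mods c
      have h2 := writes_subset_mods d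
      intro x
      simp only [writes, mods, List.mem_append]
      exact fun h => .inr (h.imp (@h1 x) (@h2 x))
  | loop x r c => by
      have h1 := writes_subset_mods c
      intro y
      simp only [writes, mods, List.mem_cons]
      exact Or.imp_right (@h1 y)

theorem run_reg : ∀ (c : Cmd) (s : State) (x : ℕ), x ∉ c.writes → (c.run s).reg x = s.reg x
  | skip, _, _, _ => rfl
  | assign y e, s, x, h => by
      simp only [writes, List.mem_singleton] at h
      simp [run, h]
  | store _ _ _, _, _, _ => rfl
  | seq c d, s, x, h => by
      simp only [writes, List.mem_append, not_or] at h
      rw [run, run_reg d _ x h.2, run_reg c _ x h.1]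
  | ite e c d, s, x, h => by
      simp only [writes, List.mem_append, not_or] at h
      rw [run]; split
      · exact run_reg c _ x h.1
      · exact run_reg d _ x h.2
  | loop y r c, s, x, h => by
      simp only [writes, List.mem_cons, not_or] at h
      rw [run]
      induction s.reg r with
      | zero => rfl
      | succ m ih => rw [← ih]; simp only []; rw [run_reg c _ x h.2]; simp [h.1]

theorem run_arr : ∀ (c : Cmd) (s : State) (a : ℕ), a ∉ c.stores → (c.run s).arr a = s.arr a
  | skip, _, _, _ => rfl
  | assign y e, s, x, h => rfl
  | store b _ _, _, a, h => by
      simp only [stores, List.mem_singleton] at h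
      simp [run, State.arr_setArr, h]
  | seq c d, s, x, h => by
      simp only [stores, List.mem_append, not_or] at h
      rw [run, run_arr d _ x h.2, run_arr c _ x h.1]
  | ite e c d, s, x, h => by
      simp only [stores, List.mem_append, not_or] at h
      rw [run]; split
      · exact run_arr c _ x h.1
      · exact run_arr d _ x h.2
  | loop y r c, s, x, h => by
      simp only [stores] at h
      rw [run]
      induction s.reg r with
      | zero => rfl
      | succ m ih => rw [← ih]; simp only []; rw [run_arr c _ x h]; rfl

/-- The effect of a command cannot depend on scratch registers, so compiled code may leave anything
there. -/
theorem run_congr {t : ℕ} : ∀ {c : Cmd} {s s' : State}, c.Below t → Agree t s s' →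
    Agree t (c.run s) (c.run s')
  | skip, _, _, _, h => h
  | assign x e, s, s', hb, h => by
      simp only [run, Expr.eval_congr hb.2 h]; exact h.setReg _ _
  | store a i e, s, s', hb, h => by
      simp only [run, Expr.eval_congr hb.2 h, Expr.eval_congr hb.1 h]
      exact ⟨h.1, by simp only [State.setArr, h.2]⟩
  | seq c d, _, _, hb, h => run_congr (c := d) hb.2 (run_congr (c := c) hb.1 h)
  | ite e c d, s, s', hb, h => by
      simp only [run, Expr.eval_congr hb.1 h]
      split
      · exact run_congr hb.2.1 h
      · exact run_congr hb.2.2 h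
  | loop x r c, s, s', hb, h => by
      simp only [run, h.1 r hb.2.1]
      induction s'.reg r with
      | zero => exact h
      | succ m ih => exact run_congr hb.2.2 (ih.setReg x m)

/-- Machine code for the command, using registers from `t` on as scratch space. -/
def comp : Cmd → ℕ → Prog
  | skip, _ => .skip
  | assign x e, t => .seq (e.comp t) (.copy x t)
  | store a i e, t => .seq (i.comp t) (.seq (e.comp (t + 1)) (.store a t (t + 1)))
  | seq c d, t => .seq (c.comp t) (d.comp t)
  | ite e c d, t => .seq (e.comp t) (.cond t (c.comp t) (d.comp t))
  | loop x r c, t =>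
      .seq (.const t 0) <| .seq (.copy (t + 1) r) <| .seq (.const (t + 2) 1) <|
      .loop (t + 1) (.seq (.copy x t) <| .seq (c.comp (t + 3)) <|
        .seq (.add t t (t + 2)) (.sub (t + 1) (t + 1) (t + 2)))

theorem Below.bnds_lt {t : ℕ} : ∀ {c : Cmd}, c.Below t → ∀ r ∈ c.bnds, r < t
  | skip, _, r, hr => by simp [bnds] at hr
  | assign x e, h, r, hr => Expr.exec_comp.bnds_lt h.2 r hr
  | store a i e, h, r, hr => (List.mem_append.1 hr).elim (Expr.exec_comp.bnds_lt h.1 r)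
      (Expr.exec_comp.bnds_lt h.2 r)
  | seq c d, h, r, hr => (List.mem_append.1 hr).elim (h.1.bnds_lt r) (h.2.bnds_lt r)
  | ite e c d, h, r, hr => (List.mem_append.1 hr).elim (Expr.exec_comp.bnds_lt h.1 r)
      fun hr => (List.mem_append.1 hr).elim (h.2.1.bnds_lt r) (h.2.2.bnds_lt r)
  | loop x r' c, h, r, hr => (List.mem_cons.1 hr).elim (fun h' => h' ▸ h.2.1)
      (h.2.2.bnds_lt r)

theorem Below.writes_lt {t : ℕ} : ∀ {c : Cmd}, c.Below t → ∀ r ∈ c.writes, r < t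
  | skip, _, r, hr => by simp [writes] at hr
  | assign x e, h, r, hr => by rw [List.mem_singleton.1 hr]; exact h.1
  | store a i e, h, r, hr => by simp [writes] at hr
  | seq c d, h, r, hr => (List.mem_append.1 hr).elim (h.1.writes_lt r) (h.2.writes_lt r)
  | ite e c d, h, r, hr => (List.mem_append.1 hr).elim (h.2.1.writes_lt r) (h.2.2.writes_lt r)
  | loop x r' c, h, r, hr => (List.mem_cons.1 hr).elim (fun h' => h' ▸ h.1)
      (h.2.2.writes_lt r)

/-- Bound registers are never written, so their initial bound `M` holds throughout. Each loop
therefore contributes one factor `M + 1`, and the exponent is the nesting depth of the program text.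
-/
theorem exec_comp {M : ℕ} : ∀ (c : Cmd) (t : ℕ) (s : State), c.Below t →
    (∀ r ∈ c.bnds, r ∉ c.mods) → (∀ r ∈ c.bnds, s.reg r ≤ M) →
    Exec (c.comp t) s (c.size * (M + 1) ^ c.depth) (fun s' => Agree t s' (c.run s))
  | skip, t, s, _, _, _ => (Exec.of_runs (Q := fun s' => Agree t s' s) (.skip s) (Agree.refl t s)).mono
        (by simp [size, depth]) fun _ h => h
  | assign x e, t, s, hb, hd, hM => by
      simp only [bnds, mods, List.mem_cons, not_or] at hd hM
      refine Exec.mono ((Expr.exec_comp e t s hb.2 (fun r hr => (hd r hr).2) hM).seq (T' := 1)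
        (R := fun s' => Agree t s' ((assign x e).run s)) ?_) ?_ fun _ h => h
      · rintro s₁ ⟨ha, hv⟩
        refine Exec.of_runs (.copy _ _ _) ?_
        rw [hv, run]
        exact ha.setReg _ _
      · have h3 : 1 ≤ (M + 1) ^ e.depth := Nat.one_le_pow _ _ (Nat.succ_pos M)
        simp only [size, depth]
        nlinarith
  | store a i e, t, s, hb, hd, hM => by
      simp only [bnds, mods, List.mem_append, not_or] at hd hM
      have hi := Expr.exec_comp i t s hb.1 (fun r hr => (hd r (.inl hr)).1)
        (fun r hr => hM r (.inl hr))
      refine Exec.mono (hi.seq (T' := e.size * (M + 1) ^ e.depth + 1)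
        (R := fun s' => Agree t s' ((store a i e).run s)) ?_) ?_ fun _ h => h
      · rintro s₁ ⟨ha, hv⟩
        have he := Expr.exec_comp (M := M) e (t + 1) s₁ (hb.2.mono (Nat.le_succ t))
          (fun r hr => (hd r (.inr hr)).2) (fun r hr => by
            rw [ha.1 r (Expr.exec_comp.bnds_lt hb.2 r hr)]; exact hM r (.inr hr))
        refine he.seq ?_
        rintro s₂ ⟨ha₂, hv₂⟩
        refine Exec.of_runs (.store _ _ _ _) ?_
        have hag := (ha₂.mono (Nat.le_succ t)).trans ha
        rw [hv₂, ha₂.1 t (Nat.lt_succ_self t), hv, Expr.eval_congr hb.2 ha, run]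
        exact ⟨hag.1, by simp only [State.setArr, hag.2]⟩
      · have h1 := mul_pow_le_mul_pow_max i.size M (le_max_left i.depth e.depth)
        have h2 := mul_pow_le_mul_pow_max e.size M (le_max_right i.depth e.depth)
        have h3 : 1 ≤ (M + 1) ^ (max i.depth e.depth) := Nat.one_le_pow _ _ (Nat.succ_pos M)
        simp only [size, depth]
        nlinarith
  | seq c d, t, s, hb, hd, hM => by
      simp only [bnds, mods, List.mem_append, not_or] at hd hM
      have hc := exec_comp c t s hb.1 (fun r hr => (hd r (.inl hr)).1) fun r hr => hM r (.inl hr)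
      refine Exec.mono (hc.seq (T' := d.size * (M + 1) ^ d.depth)
        (R := fun s' => Agree t s' ((seq c d).run s)) ?_) ?_ fun _ h => h
      · intro s₁ ha
        refine (exec_comp d t s₁ hb.2 (fun r hr => (hd r (.inr hr)).2) ?_).mono le_rfl ?_
        · intro r hr
          rw [ha.1 r (hb.2.bnds_lt r hr), run_reg c s r
            fun h => (hd r (.inr hr)).1 (writes_subset_mods c h)]
          exact hM r (.inr hr)
        · exact fun s' h => h.trans (run_congr hb.2 ha)
      · have h1 := mul_pow_le_mul_pow_max c.size M (le_max_left c.depth d.depth)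
        have h2 := mul_pow_le_mul_pow_max d.size M (le_max_right c.depth d.depth)
        simp only [size, depth]
        nlinarith
  | ite e c d, t, s, hb, hd, hM => by
      simp only [bnds, mods, List.mem_append, not_or] at hd hM
      have he := Expr.exec_comp e t s hb.1 (fun r hr => (hd r (.inl hr)).1)
        fun r hr => hM r (.inl hr)
      refine Exec.mono (he.seq
        (T' := c.size * (M + 1) ^ c.depth + d.size * (M + 1) ^ d.depth + 1)
        (R := fun s' => Agree t s' ((ite e c d).run s)) ?_) ?_ fun _ h => h
      · rintro s₁ ⟨ha, hv⟩
        have hc := exec_comp (M := M) c t s₁ hb.2.1 (fun r hr => (hd r (.inr (.inl hr))).2.1)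
          fun r hr => by rw [ha.1 r (hb.2.1.bnds_lt r hr)]; exact hM r (.inr (.inl hr))
        have hd := exec_comp (M := M) d t s₁ hb.2.2 (fun r hr => (hd r (.inr (.inr hr))).2.2)
          fun r hr => by rw [ha.1 r (hb.2.2.bnds_lt r hr)]; exact hM r (.inr (.inr hr))
        by_cases h0 : s₁.reg t = 0
        · obtain ⟨t', s', hr, ht, ha'⟩ := hd
          refine ⟨t' + 1, s', .condFalse h0 hr, by omega, ?_⟩
          rw [run, if_neg (by rw [← hv]; simpa using h0)]
          exact ha'.trans (run_congr hb.2.2 ha)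
        · obtain ⟨t', s', hr, ht, ha'⟩ := hc
          refine ⟨t' + 1, s', .condTrue h0 hr, by omega, ?_⟩
          rw [run, if_pos (by rw [← hv]; simpa using h0)]
          exact ha'.trans (run_congr hb.2.1 ha)
      · have h1 := mul_pow_le_mul_pow_max e.size M (le_max_left e.depth (max c.depth d.depth))
        have h2 := mul_pow_le_mul_pow_max c.size M
          ((le_max_left c.depth d.depth).trans (le_max_right e.depth _))
        have h4 := mul_pow_le_mul_pow_max d.size M
          ((le_max_right c.depth d.depth).trans (le_max_right e.depth _))
        have h3 : 1 ≤ (M + 1) ^ (max e.depth (max c.depth d.depth)) :=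
          Nat.one_le_pow _ _ (Nat.succ_pos M)
        simp only [size, depth]
        nlinarith
  | loop x r c, t, s, hb, hd, hM => by
      obtain ⟨hxt, hrt, hbc⟩ := hb
      simp only [bnds, mods, List.mem_cons, not_or] at hd hM
      have hrM := hM r (.inl rfl)
      set T := c.size * (M + 1) ^ c.depth with hT
      -- The state after `j` rounds in the abstract semantics; the bounds inside the body have the
      -- same values in all these states.
      let F : ℕ → State := fun j => Nat.rec s (fun j s' => c.run (s'.setReg x j)) j
      have hF : ∀ j, ∀ r' ∈ c.bnds, (F j).reg r' = s.reg r' := by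
        intro j r' hr'
        have h1 := hd r' (.inr hr')
        induction j with
        | zero => rfl
        | succ j ih =>
          change (c.run ((F j).setReg x j)).reg r' = _
          rw [run_reg c _ _ fun h => h1.2 (writes_subset_mods c h), State.reg_setReg,
            if_neg h1.1, ih]
      let Inv : ℕ → State → Prop := fun m s' =>
        Agree t s' (F (s.reg r - m)) ∧ m ≤ s.reg r ∧
        s'.reg (t + 1) = m ∧ s'.reg (t + 2) = 1 ∧ s'.reg t = s.reg r - m
      have hloop := Exec.loop (x := t + 1) (p := .seq (.copy x t) <| .seq (c.comp (t + 3)) <|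
        .seq (.add t t (t + 2)) (.sub (t + 1) (t + 1) (t + 2))) (T := T + (1 + 1) + 1) Inv
        (fun m s' h => h.2.2.1) (by
          rintro m s' ⟨i1, i2, i3, i4, i5⟩
          refine Exec.seq_of_runs (.copy s' x t) ?_
          have he := exec_comp (M := M) c (t + 3) (s'.setReg x (s'.reg t))
            (hbc.mono (by omega)) (fun r hr => (hd r (.inr hr)).2) (fun r' hr' => by
              rw [State.reg_setReg, if_neg (hd r' (.inr hr')).1, i1.1 r' (hbc.bnds_lt r' hr'),
                hF _ r' hr']
              exact hM r' (.inr hr'))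
          refine he.seq ?_
          intro s₁ ha
          refine Exec.seq_of_runs (.add s₁ t t (t + 2)) ?_
          refine Exec.of_runs (.sub _ (t + 1) (t + 1) (t + 2)) ?_
          have k : ∀ y < t + 3, t ≤ y → s₁.reg y = s'.reg y := fun y hy hyt => by
            rw [ha.1 y hy, run_reg c _ y fun h => (hbc.writes_lt y h).not_ge hyt,
              State.reg_setReg, if_neg (by omega)]
          have hsub : s.reg r - m = (s.reg r - (m + 1)) + 1 := by omega
          refine ⟨⟨fun y hy => ?_, ?_⟩, by omega, ?_, ?_, ?_⟩
          · have h1 : y ≠ t + 1 := by omega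
            have h3 : y ≠ t := by omega
            rw [State.reg_setReg, if_neg h1, State.reg_setReg, if_neg h3, ha.1 y (by omega), hsub,
              i5]
            exact (run_congr hbc (i1.setReg x _)).1 y hy
          · rw [State.arr_setReg, State.arr_setReg, ha.2, hsub, i5]
            exact (run_congr hbc (i1.setReg x _)).2
          · simp [k (t + 1) (by omega) (by omega), k (t + 2) (by omega) (by omega), i3, i4]
          · simp [k (t + 2) (by omega) (by omega), i4]
          · simp [k t (by omega) (by omega), k (t + 2) (by omega) (by omega), i4, i5]
            omega)
      simp only [comp]
      refine Exec.mono (T := (s.reg r * (T + (1 + 1) + 1 + 1) + 1) + 1 + 1 + 1)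
        (Q := fun s' => Agree t s' ((loop x r c).run s)) ?_ ?_ fun _ h => h
      · refine Exec.seq_of_runs (.const _ _ _) <| Exec.seq_of_runs (.copy _ _ _) <|
          Exec.seq_of_runs (.const _ _ _) ?_
        refine (hloop (s.reg r) _ ?_).mono le_rfl fun s' h => ?_
        · have h1 : r ≠ t := by omega
          refine ⟨⟨fun y hy => ?_, ?_⟩, le_rfl, ?_, ?_, ?_⟩
          · have h1 : y ≠ t + 2 := by omega
            have h3 : y ≠ t := by omega
            have h4 : y ≠ t + 1 := by omega
            simp [h1, h3, h4, F]
          · simp [F]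
          all_goals simp [h1]
        · have h1 := h.1
          rwa [Nat.sub_zero] at h1
      · have h3 : 1 ≤ (M + 1) ^ c.depth := Nat.one_le_pow _ _ (Nat.succ_pos M)
        have h4 : s.reg r * (T + 4) ≤ M * (T + 4) := Nat.mul_le_mul_right _ hrM
        simp only [size, depth, pow_succ]
        have h6 : (c.size + 8) * ((M + 1) ^ c.depth * (M + 1)) =
          (T + 8 * (M + 1) ^ c.depth) * (M + 1) := by rw [hT]; ring
        rw [h6]
        nlinarith

/-- Invariant rule for loops. -/
theorem run_loop {x r : ℕ} {c : Cmd} {s : State} (Inv : ℕ → State → Prop) (h0 : Inv 0 s)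
    (hs : ∀ j < s.reg r, ∀ s', Inv j s' → Inv (j + 1) (c.run (s'.setReg x j))) :
    Inv (s.reg r) ((loop x r c).run s) := by
  rw [run]
  have : ∀ m ≤ s.reg r, Inv m (Nat.rec s (fun j s' => c.run (s'.setReg x j)) m) := by
    intro m
    induction m with
    | zero => exact fun _ => h0
    | succ m ih => exact fun hm => hs m hm _ (ih (by omega))
  exact this _ le_rfl

end Cmd

end RAM

namespace FairCC

open Finset

/-! ### Sparse graphs -/

section Sparse

variable {V : Type*} [DecidableEq V] (G : SimpleGraph V) [DecidableRel G.Adj]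

/-- Every nonempty finite set of vertices spans a graph with a vertex of degree at most one. -/
def Degenerate : Prop :=
  ∀ S : Finset V, S.Nonempty → ∃ v ∈ S, #{w ∈ S | G.Adj v w} ≤ 1

/-- The number of ordered pairs of adjacent vertices of `S`. -/
def arcs (S : Finset V) : ℕ := #{p ∈ S ×ˢ S | G.Adj p.1 p.2}

variable {G}

/-- A component of the induced forest is a tree, so it is a single vertex or has a leaf; all
neighbours of this vertex in `S` lie in the same component. -/
theorem Degenerate.of_isAcyclic (h : G.IsAcyclic) : Degenerate G := by
  intro S hS
  obtain ⟨v₀, hv₀⟩ := hS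
  have hH := h.induce (S : Set V)
  set H := G.induce (S : Set V)
  set C := H.connectedComponentMk ⟨v₀, hv₀⟩
  have hT := hH.isTree_connectedComponent C
  have key : ∃ x : C, ∀ y z : C, C.toSimpleGraph.Adj x y → C.toSimpleGraph.Adj x z → y = z := by
    have : Fintype C := Fintype.ofFinite _
    classical
    rcases subsingleton_or_nontrivial C with hs | hn
    · exact ⟨⟨⟨v₀, hv₀⟩, rfl⟩, fun y z _ _ => Subsingleton.elim _ _⟩
    · obtain ⟨x, hx⟩ := hT.exists_vert_degree_one_of_nontrivial
      rw [SimpleGraph.degree_eq_one_iff_existsUnique_adj] at hx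
      exact ⟨x, fun y z hy hz => hx.unique hy hz⟩
  obtain ⟨x, hx⟩ := key
  have lift : ∀ y ∈ S, G.Adj x.1 y → ∃ y' : C, (y'.1 : V) = y ∧ C.toSimpleGraph.Adj x y' := by
    intro y hy hxy
    have hadj : H.Adj x.1 ⟨y, hy⟩ := hxy
    exact ⟨⟨⟨y, hy⟩, C.mem_supp_of_adj_mem_supp x.2 hadj⟩, rfl, hadj⟩
  refine ⟨x.1, x.1.2, card_le_one.2 fun y hy z hz => ?_⟩
  simp only [mem_filter] at hy hz
  obtain ⟨y', rfl, hy'⟩ := lift y hy.1 hy.2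
  obtain ⟨z', rfl, hz'⟩ := lift z hz.1 hz.2
  rw [hx y' z' hy' hz']

theorem arcs_eq_sum (S : Finset V) : arcs G S = ∑ u ∈ S, #{v ∈ S | G.Adj u v} := by
  rw [arcs, card_filter, sum_product]
  exact sum_congr rfl fun u _ => (card_filter _ _).symm

theorem arcs_insert_le {S : Finset V} {v : V} (hv : v ∉ S) :
    arcs G (insert v S) ≤ arcs G S + 2 * #{w ∈ insert v S | G.Adj v w} := by
  have h1 : #{w ∈ insert v S | G.Adj v w} = #{w ∈ S | G.Adj v w} := by
    rw [filter_insert, if_neg (G.loopless.irrefl v)]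
  rw [arcs_eq_sum, arcs_eq_sum, sum_insert hv, h1]
  have h2 : ∀ u ∈ S, #{w ∈ insert v S | G.Adj u w} =
      #{w ∈ S | G.Adj u w} + if G.Adj v u then 1 else 0 := by
    intro u hu
    rw [filter_insert]
    by_cases h : G.Adj u v
    · rw [if_pos h, if_pos h.symm, card_insert_of_notMem (by simp [hv])]
    · rw [if_neg h, if_neg fun h' => h h'.symm, add_zero]
  rw [sum_congr rfl h2, sum_add_distrib, ← card_filter]
  omega

/-- Removing a vertex of degree at most one loses at most one edge, that is two arcs, and a single
vertex spans none. -/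
theorem Degenerate.arcs_le (h : Degenerate G) (S : Finset V) (hS : S.Nonempty) :
    arcs G S + 2 ≤ 2 * #S := by
  induction hn : #S generalizing S with
  | zero => simp [card_eq_zero] at hn; exact absurd hn hS.ne_empty
  | succ m ih =>
    obtain ⟨v, hv, hd⟩ := h S hS
    have hcard : #(S.erase v) = m := by rw [card_erase_of_mem hv]; omega
    have hins := arcs_insert_le (G := G) (notMem_erase v S)
    rw [insert_erase hv] at hins
    rcases Nat.eq_zero_or_pos m with rfl | hm
    · have hE : S = {v} := by
        rw [← insert_erase hv, card_eq_zero.1 hcard]; rfl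
      have : arcs G S = 0 := by rw [hE]; simp [arcs]
      omega
    · have := ih (S.erase v) (card_pos.1 (by omega)) hcard
      omega

theorem Degenerate.arcs_le' (h : Degenerate G) (S : Finset V) : arcs G S ≤ 2 * #S := by
  rcases S.eq_empty_or_nonempty with rfl | hS
  · simp [arcs]
  · have := h.arcs_le S hS; omega

/-- If no edge joins the two nonempty parts of `S`, then at least two edges are missing. -/
theorem Degenerate.arcs_le_of_split (h : Degenerate G) (S : Finset V) (p : V → Prop)
    [DecidablePred p] (h1 : ∃ v ∈ S, p v) (h2 : ∃ v ∈ S, ¬ p v)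
    (hsep : ∀ u ∈ S, ∀ v ∈ S, G.Adj u v → (p u ↔ p v)) : arcs G S + 4 ≤ 2 * #S := by
  obtain ⟨a, ha, hpa⟩ := h1
  obtain ⟨b, hb, hpb⟩ := h2
  have e1 := h.arcs_le {v ∈ S | p v} ⟨a, by simp [ha, hpa]⟩
  have e2 := h.arcs_le {v ∈ S | ¬ p v} ⟨b, by simp [hb, hpb]⟩
  have e3 : #{v ∈ S | p v} + #{v ∈ S | ¬ p v} = #S := card_filter_add_card_filter_not (s := S) p
  have e4 : arcs G S ≤ arcs G {v ∈ S | p v} + arcs G {v ∈ S | ¬ p v} := by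
    unfold arcs
    refine le_trans (card_le_card ?_) (card_union_le _ _)
    intro q hq
    simp only [mem_filter, mem_product, mem_union] at hq ⊢
    have := hsep _ hq.1.1 _ hq.1.2 hq.2
    tauto
  omega

end Sparse

/-! ### Labelings -/

section Labelings

variable {V : Type*} [Fintype V] [DecidableEq V] (G : SimpleGraph V) [DecidableRel G.Adj]
  {ι : Type*} [DecidableEq ι]

/-- The number of ordered pairs of adjacent vertices with the same label. -/
def sameArcs (f : V → ι) : ℕ := #{p : V × V | G.Adj p.1 p.2 ∧ f p.1 = f p.2}

/-- The number of ordered pairs of distinct vertices with the same label. -/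
def samePairs (f : V → ι) : ℕ := #{p : V × V | p.1 ≠ p.2 ∧ f p.1 = f p.2}

/-- The vertices labelled `i`. -/
def cls (f : V → ι) (i : ι) : Finset V := {v | f v = i}

@[simp] theorem mem_cls {f : V → ι} {i : ι} {v : V} : v ∈ cls f i ↔ f v = i := by simp [cls]

variable {G}

theorem sameArcs_eq_sum (f : V → ι) : sameArcs G f = ∑ i ∈ univ.image f, arcs G (cls f i) := by
  rw [sameArcs, card_eq_sum_card_fiberwise (f := fun p => f p.1) (t := univ.image f)
    (fun p _ => by simp)]
  refine sum_congr rfl fun i _ => ?_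
  rw [arcs]
  congr 1
  ext p
  simp only [mem_filter, mem_univ, true_and, mem_product, mem_cls]
  constructor
  · rintro ⟨⟨h1, h2⟩, h3⟩; exact ⟨⟨h3, h2 ▸ h3⟩, h1⟩
  · rintro ⟨⟨h1, h2⟩, h3⟩; exact ⟨⟨h3, h1.trans h2.symm⟩, h1⟩

theorem samePairs_eq_sum (f : V → ι) :
    samePairs f = ∑ i ∈ univ.image f, #(cls f i) * (#(cls f i) - 1) := by
  rw [samePairs, card_eq_sum_card_fiberwise (f := fun p => f p.1) (t := univ.image f)
    (fun p _ => by simp)]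
  refine sum_congr rfl fun i _ => ?_
  rw [Nat.mul_sub_one, ← offDiag_card]
  congr 1
  ext p
  simp only [mem_filter, mem_univ, true_and, mem_offDiag, mem_cls]
  constructor
  · rintro ⟨⟨h1, h2⟩, h3⟩; exact ⟨h3, h2 ▸ h3, h1⟩
  · rintro ⟨h1, h2, h3⟩; exact ⟨⟨h3, h1.trans h2.symm⟩, h1⟩

theorem card_eq_sum_cls (f : V → ι) : Fintype.card V = ∑ i ∈ univ.image f, #(cls f i) := by
  rw [← card_univ, card_eq_sum_card_image f]; rfl

theorem cls_nonempty {f : V → ι} {i : ι} (hi : i ∈ univ.image f) : (cls f i).Nonempty := by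
  obtain ⟨v, _, hv⟩ := mem_image.1 hi
  exact ⟨v, by simpa using hv⟩

theorem sameArcs_le_arcs_univ (f : V → ι) : sameArcs G f ≤ arcs G univ := by
  unfold sameArcs arcs
  exact card_le_card fun p hp => by simpa using (by simpa using hp : _ ∧ _).1

end Labelings

/-! ### Cost -/

section Cost

variable {V : Type*} [Fintype V] [DecidableEq V]

theorem two_mul_ncard_edgeSet (H : SimpleGraph V) [DecidableRel H.Adj] :
    2 * H.edgeSet.ncard = #{p : V × V | H.Adj p.1 p.2} := by
  rw [← SimpleGraph.coe_edgeFinset, Set.ncard_coe_finset, ← SimpleGraph.sum_degrees_eq_twice_card_edges,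
    card_filter, ← univ_product_univ, sum_product]
  refine sum_congr rfl fun u _ => ?_
  rw [← card_filter, ← SimpleGraph.card_neighborFinset_eq_degree, SimpleGraph.neighborFinset_eq_filter]

/-- The graphs `A` and `B` consist of the two kinds of disagreements. A pair inside a cluster is in
`A` or is an edge, and an edge is in `B` or lies inside a cluster; the factor 2 comes from ordered
pairs. -/
theorem two_mul_ccCost (G : SimpleGraph V) [DecidableRel G.Adj] {ι : Type*} [DecidableEq ι]
    (P : Finpartition (univ : Finset V)) (f : V → ι) (hf : ∀ u v, P.part u = P.part v ↔ f u = f v) :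
    2 * ccCost G P + 2 * sameArcs G f = samePairs f + arcs G univ := by
  classical
  have hpart : ∀ u v : V, (∃ S ∈ P.parts, ∀ w ∈ s(u, v), w ∈ S) ↔ f u = f v := by
    intro u v
    rw [← hf]
    constructor
    · rintro ⟨S, hS, hw⟩
      rw [P.part_eq_of_mem hS (hw u (by simp)), P.part_eq_of_mem hS (hw v (by simp))]
    · intro h
      refine ⟨P.part u, P.part_mem.2 (mem_univ u), fun w hw => ?_⟩
      rcases Sym2.mem_iff.1 hw with rfl | rfl
      · exact P.mem_part (mem_univ w)
      · rw [h]; exact P.mem_part (mem_univ w)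
  let A : SimpleGraph V :=
    { Adj := fun u v => (u ≠ v ∧ ¬ G.Adj u v) ∧ f u = f v
      symm := ⟨fun u v h => ⟨⟨h.1.1.symm, fun h' => h.1.2 h'.symm⟩, h.2.symm⟩⟩
      loopless := ⟨fun u h => h.1.1 rfl⟩ }
  let B : SimpleGraph V :=
    { Adj := fun u v => G.Adj u v ∧ ¬ f u = f v
      symm := ⟨fun u v h => ⟨h.1.symm, fun h' => h.2 h'.symm⟩⟩
      loopless := ⟨fun u h => h.2 rfl⟩ }
  have hA : intraCost G P = A.edgeSet.ncard := by
    rw [intraCost]; congr 1; ext e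
    induction e with | _ u v => ?_
    rw [Set.mem_ofPred_eq, hpart, SimpleGraph.mem_edgeSet, SimpleGraph.mem_edgeSet,
      SimpleGraph.compl_adj]
  have hB : interCost G P = B.edgeSet.ncard := by
    rw [interCost]; congr 1; ext e
    induction e with | _ u v => ?_
    rw [Set.mem_ofPred_eq, hpart, SimpleGraph.mem_edgeSet, SimpleGraph.mem_edgeSet]
  rw [ccCost, hA, hB, mul_add, two_mul_ncard_edgeSet, two_mul_ncard_edgeSet]
  have e1 : samePairs f = #{p : V × V | A.Adj p.1 p.2} + sameArcs G f := by
    rw [samePairs, sameArcs, ← card_union_of_disjoint]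
    · congr 1; ext p
      have : G.Adj p.1 p.2 → p.1 ≠ p.2 := fun h => h.ne
      simp only [mem_filter, mem_univ, true_and, mem_union, A]
      tauto
    · rw [disjoint_filter]; rintro p _ h h'; exact h.1.2 h'.1
  have e2 : arcs G univ = #{p : V × V | B.Adj p.1 p.2} + sameArcs G f := by
    rw [arcs, sameArcs, ← card_union_of_disjoint]
    · congr 1; ext p
      simp only [mem_filter, mem_univ, true_and, mem_union, B, mem_product]
      tauto
    · rw [disjoint_filter]; rintro p _ h h'; exact h.2 h'.2
  rw [e1, e2]; ring

end Cost

end FairCC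

namespace FairCC

open Finset

/-! ### Ranks -/

theorem rank_mem_range {V : Type*} (A : Finset V) (κ : V → ℕ) {u : V}
    (hu : u ∈ A) : #{v ∈ A | κ v < κ u} < #A :=
  card_lt_card ⟨filter_subset _ _, fun h => by simpa using h hu⟩

theorem rank_injOn {V : Type*} (A : Finset V) (κ : V → ℕ)
    (hκ : Set.InjOn κ A) : Set.InjOn (fun u => #{v ∈ A | κ v < κ u}) A := by
  have key : ∀ u ∈ A, ∀ w ∈ A, κ u < κ w → #{v ∈ A | κ v < κ u} < #{v ∈ A | κ v < κ w} := by
    intro u hu w _ h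
    refine card_lt_card ⟨fun v hv => ?_, fun h' => ?_⟩
    · simp only [mem_filter] at hv ⊢; exact ⟨hv.1, hv.2.trans h⟩
    · have := h' (show u ∈ _ by simp [hu, h])
      simp at this
  intro u hu w hw h
  rcases lt_trichotomy (κ u) (κ w) with h' | h' | h'
  · exact absurd h (key u hu w hw h').ne
  · exact hκ hu hw h'
  · exact absurd h (key w hw u hu h').ne'

theorem image_rank {V : Type*} (A : Finset V) (κ : V → ℕ)
    (hκ : Set.InjOn κ A) : A.image (fun u => #{v ∈ A | κ v < κ u}) = range #A := by
  refine eq_of_subset_of_card_le (fun x hx => ?_) ?_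
  · obtain ⟨u, hu, rfl⟩ := mem_image.1 hx
    exact mem_range.2 (rank_mem_range A κ hu)
  · rw [card_image_of_injOn (rank_injOn A κ hκ), card_range]

theorem card_range_div_eq {c J t : ℕ} (hc : 0 < c) (ht : t < J) :
    #{x ∈ range (J * c) | x / c = t} = c := by
  have : {x ∈ range (J * c) | x / c = t} = Ico (t * c) ((t + 1) * c) := by
    ext x
    simp only [mem_filter, mem_range, mem_Ico, Nat.div_eq_iff hc]
    have h1 : (t + 1) * c ≤ J * c := Nat.mul_le_mul_right c ht
    have h2 : (t + 1) * c = t * c + c := by ring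
    omega
  rw [this, Nat.card_Ico, add_mul, one_mul, Nat.add_sub_cancel_left]

/-- Cutting a set into consecutive blocks of size `c`. -/
theorem card_rank_div_eq {V : Type*} (A : Finset V) (κ : V → ℕ)
    (hκ : Set.InjOn κ A) {c J t : ℕ} (hc : 0 < c) (hA : #A = J * c) (ht : t < J) :
    #{u ∈ A | #{v ∈ A | κ v < κ u} / c = t} = c := by
  have h := card_range_div_eq hc ht
  rw [← hA, ← image_rank A κ hκ, filter_image, card_image_of_injOn] at h
  · exact h
  · exact (rank_injOn A κ hκ).mono (coe_subset.2 (filter_subset _ _))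

/-! ### Fairness -/

section Palette

variable {V γ : Type*} [Fintype V] [DecidableEq V] [DecidableEq γ]

/-- The vertices are coloured by `col`; the greatest common divisor of the sizes of the colour
classes is `g`, and a fair set of the minimal size `d` contains `cc u` vertices of the colour
of `u`. -/
structure Palette (col : V → γ) (cc : V → ℕ) (g d : ℕ) : Prop where
  pos : 0 < g
  card_color : ∀ u, #{v | col v = col u} = cc u * g
  card_univ : Fintype.card V = d * g
  dvd : ∀ h, (∀ u, h ∣ #{v | col v = col u}) → h ∣ g

/-- `S` contains every colour `j` times as often as a minimal fair set. -/
def Multiple (col : V → γ) (cc : V → ℕ) (j : ℕ) (S : Finset V) : Prop :=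
  ∀ u, #{v ∈ S | col v = col u} = j * cc u

variable {col : V → γ} {cc : V → ℕ} {g d : ℕ}

namespace Palette

theorem cc_congr (h : Palette col cc g d) {u v : V} (huv : col u = col v) : cc u = cc v := by
  have h1 := h.card_color u
  rw [huv, h.card_color v] at h1
  exact (Nat.eq_of_mul_eq_mul_right h.pos h1).symm

theorem cc_pos (h : Palette col cc g d) (u : V) : 0 < cc u := by
  have h1 := h.card_color u
  have h2 : 0 < #{v | col v = col u} := card_pos.2 ⟨u, by simp⟩
  exact Nat.pos_of_mul_pos_right (h1 ▸ h2)

theorem card_eq_of_multiple (h : Palette col cc g d) {j : ℕ} {S : Finset V}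
    (hS : Multiple col cc j S) : #S = j * d := by
  have e1 := card_eq_sum_card_fiberwise (f := col) (s := S) (t := univ.image col)
    (fun p _ => by simp)
  have e2 := card_eq_sum_card_fiberwise (f := col) (s := (univ : Finset V)) (t := univ.image col)
    (fun p _ => by simp)
  refine Nat.eq_of_mul_eq_mul_right h.pos ?_
  rw [mul_assoc, ← h.card_univ, ← Finset.card_univ, e1, e2, mul_sum, sum_mul]
  refine sum_congr rfl fun i hi => ?_
  obtain ⟨u, _, rfl⟩ := mem_image.1 hi
  rw [hS u, h.card_color u, mul_assoc]

/-- Put `e = d / gcd(d, #S)`. The proportions force `e` to divide every `cc u`, so `e * g` divides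
every class size and hence `g`. Thus `e = 1` and `d` divides `#S`; the quotient is the multiplicity.
-/
theorem exists_multiple (h : Palette col cc g d) (S : Finset V)
    (hS : ∀ u, #{v ∈ S | col v = col u} * Fintype.card V = #{v | col v = col u} * #S) :
    ∃ j, Multiple col cc j S := by
  have hV : ∀ u, #{v ∈ S | col v = col u} * d = cc u * #S := by
    intro u
    have := hS u
    rw [h.card_univ, h.card_color u] at this
    refine Nat.eq_of_mul_eq_mul_right h.pos ?_
    linarith
  rcases isEmpty_or_nonempty V with hE | ⟨⟨v₀⟩⟩
  · exact ⟨0, fun u => hE.elim u⟩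
  have hd : 0 < d := by
    have h1 : 0 < Fintype.card V := Fintype.card_pos_iff.2 ⟨v₀⟩
    rw [h.card_univ] at h1
    exact Nat.pos_of_mul_pos_right h1
  have hdS : d ∣ #S := by
    set e := d / Nat.gcd d #S with he
    have hg : 0 < Nat.gcd d #S := Nat.gcd_pos_of_pos_left _ hd
    have hcop : Nat.Coprime e (#S / Nat.gcd d #S) := Nat.coprime_div_gcd_div_gcd hg
    have hed : e * Nat.gcd d #S = d := Nat.div_mul_cancel (Nat.gcd_dvd_left _ _)
    have hes : #S / Nat.gcd d #S * Nat.gcd d #S = #S := Nat.div_mul_cancel (Nat.gcd_dvd_right _ _)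
    have h1 : ∀ u, e ∣ cc u := by
      intro u
      refine hcop.dvd_of_dvd_mul_right ⟨#{v ∈ S | col v = col u}, ?_⟩
      refine Nat.eq_of_mul_eq_mul_right hg ?_
      have := hV u
      rw [mul_assoc, hes, ← this]
      nth_rewrite 1 [← hed]
      ring
    have h2 : e * g ∣ g := h.dvd _ fun u => by
      rw [h.card_color]; exact Nat.mul_dvd_mul_right (h1 u) g
    have h3 : e = 1 := by
      have := Nat.le_of_dvd h.pos h2
      have he0 : 0 < e := Nat.pos_of_mul_pos_right (hed ▸ hd)
      have := h.pos
      nlinarith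
    rw [h3, one_mul] at hed
    exact hed ▸ Nat.gcd_dvd_right d #S
  obtain ⟨j, hj⟩ := hdS
  refine ⟨j, fun u => Nat.eq_of_mul_eq_mul_right hd ?_⟩
  rw [hV u, hj]; ring

theorem exists_mem_color (h : Palette col cc g d) {j : ℕ} {S : Finset V} (hj : 0 < j)
    (hS : Multiple col cc j S) (u : V) : ∃ v ∈ S, col v = col u := by
  have : 0 < #{v ∈ S | col v = col u} := by rw [hS u]; exact Nat.mul_pos hj (h.cc_pos u)
  obtain ⟨v, hv⟩ := card_pos.1 this
  exact ⟨v, by simpa using hv⟩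

theorem exists_col_ne (h : Palette col cc g d) (hd : 2 ≤ d) : ∃ u v, col u ≠ col v := by
  by_contra! hc
  have h1 := h.dvd (Fintype.card V) fun u => by
    rw [filter_true_of_mem (fun v _ => hc v u), Finset.card_univ]
  have h2 := Nat.le_of_dvd h.pos h1
  rw [h.card_univ] at h2
  have := h.pos
  nlinarith

/-- The rank of a vertex within its colour, divided by `cc`, cuts each colour of `S` into `j` blocks
of the right size. The blocks with number `t` of all colours together form a minimal fair set, for
any ordering `κ`. -/
theorem multiple_one_of_multiple (h : Palette col cc g d) {S : Finset V} {A : V → ℕ} {j t : ℕ}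
    (hj : t < j) (κ : V → ℕ) (hκ : Set.InjOn κ S) (hS : Multiple col cc j S)
    (hA : ∀ u ∈ S, A u = #{v ∈ S | col v = col u ∧ κ v < κ u} / cc u) :
    Multiple col cc 1 {u ∈ S | A u = t} := by
  intro u
  rw [one_mul]
  have := card_rank_div_eq {v ∈ S | col v = col u} κ
    (hκ.mono fun x hx => (mem_filter.1 (mem_coe.1 hx)).1) (h.cc_pos u) (hS u) hj
  convert this using 2
  ext w
  simp only [mem_filter]
  constructor
  · rintro ⟨⟨h1, h2⟩, h3⟩
    refine ⟨⟨h1, h3⟩, ?_⟩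
    rw [← h2, hA w h1, h.cc_congr h3, h3, filter_filter]
  · rintro ⟨⟨h1, h3⟩, h2⟩
    refine ⟨⟨h1, ?_⟩, h3⟩
    rw [← h2, hA w h1, h.cc_congr h3, h3, filter_filter]

/-- If `d = 1`, then all vertices have the same colour. -/
theorem multiple_of_one (h : Palette col cc g 1) (S : Finset V) (u : V) :
    #{v ∈ S | col v = col u} * Fintype.card V = #{v | col v = col u} * #S := by
  have h1 : #{v | col v = col u} = Fintype.card V := by
    refine le_antisymm (card_le_univ _) ?_
    rw [h.card_color u, h.card_univ]
    exact Nat.mul_le_mul_right g (h.cc_pos u)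
  have h2 := (card_eq_iff_eq_univ _).1 h1
  have h3 : {v ∈ S | col v = col u} = S :=
    filter_true_of_mem fun v _ => filter_eq_self.1 h2 v (mem_univ v)
  rw [h3, h1, mul_comm]

theorem rank_div_lt (h : Palette col cc g d) {S : Finset V} {j : ℕ}
    (κ : V → ℕ) (hS : Multiple col cc j S) {u : V} (hu : u ∈ S) :
    #{v ∈ S | col v = col u ∧ κ v < κ u} / cc u < j := by
  rw [Nat.div_lt_iff_lt_mul (h.cc_pos u), ← hS u, ← filter_filter]
  exact rank_mem_range _ κ (by simp [hu])

end Palette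

/-- All clusters are fair. -/
def FairLabeling (col : V → γ) (cc : V → ℕ) {ι : Type*} [DecidableEq ι] (f : V → ι) : Prop :=
  ∀ i ∈ univ.image f, ∃ j, 0 < j ∧ Multiple col cc j (cls f i)

/-- All clusters are fair of minimal size. -/
def MinimalLabeling (col : V → γ) (cc : V → ℕ) {ι : Type*} [DecidableEq ι] (f : V → ι) : Prop :=
  ∀ i ∈ univ.image f, Multiple col cc 1 (cls f i)

theorem samePairs_of_minimal (h : Palette col cc g d) {ι : Type*} [DecidableEq ι] {f : V → ι}
    (hf : MinimalLabeling col cc f) : samePairs f = Fintype.card V * (d - 1) := by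
  rw [samePairs_eq_sum, card_eq_sum_cls f, sum_mul]
  refine sum_congr rfl fun i hi => ?_
  rw [h.card_eq_of_multiple (hf i hi), one_mul]

theorem le_samePairs_of_fair (h : Palette col cc g d) {ι : Type*} [DecidableEq ι] {f : V → ι}
    (hf : FairLabeling col cc f) : Fintype.card V * (d - 1) ≤ samePairs f := by
  rw [samePairs_eq_sum, card_eq_sum_cls f, sum_mul]
  refine sum_le_sum fun i hi => ?_
  obtain ⟨j, hj, hS⟩ := hf i hi
  rw [h.card_eq_of_multiple hS]
  refine Nat.mul_le_mul_left _ (Nat.sub_le_sub_right ?_ 1)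
  nlinarith

variable {G : SimpleGraph V} [DecidableRel G.Adj]

theorem sum_card_cls_inter {ι : Type*} [DecidableEq ι] (f : V → ι) (C : Finset V) :
    ∑ i ∈ univ.image f, #{v ∈ cls f i | v ∈ C} = #C := by
  rw [card_eq_sum_card_fiberwise (f := f) (s := C) (t := univ.image f) (fun p _ => by simp)]
  refine sum_congr rfl fun i _ => ?_
  congr 1; ext v; simp [and_comm]

/-- Cluster by cluster: a cluster without cover vertices spans no arcs, and one with `m` vertices
has at most `2 (m - 1)` arcs, where `4 (m - 1) ≤ m (m - 1) + 2`. Equality at `m = 2` is the matched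
pair. -/
theorem two_mul_sameArcs_le_of_cover (hG : Degenerate G) {ι : Type*} [DecidableEq ι] (f : V → ι)
    {C : Finset V} (hC : ∀ u v, G.Adj u v → u ∈ C ∨ v ∈ C) :
    2 * sameArcs G f ≤ samePairs f + 2 * #C := by
  rw [sameArcs_eq_sum, samePairs_eq_sum, ← sum_card_cls_inter f C, mul_sum, mul_sum,
    ← sum_add_distrib]
  refine sum_le_sum fun i hi => ?_
  have h1 := hG.arcs_le _ (cls_nonempty hi)
  have h0 : 0 < #(cls f i) := card_pos.2 (cls_nonempty hi)
  generalize cls f i = S at *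
  rcases Nat.eq_zero_or_pos #{v ∈ S | v ∈ C} with h2 | h2
  · have : arcs G S = 0 := by
      rw [arcs, card_eq_zero, filter_eq_empty_iff]
      rintro ⟨u, v⟩ hp hadj
      rw [mem_product] at hp
      rw [card_eq_zero, filter_eq_empty_iff] at h2
      exact (hC u v hadj).elim (h2 hp.1) (h2 hp.2)
    omega
  · obtain ⟨m, hm⟩ : ∃ m, #S = m + 1 := ⟨#S - 1, by omega⟩
    rw [hm] at h1 ⊢
    rw [Nat.add_sub_cancel]
    rcases Nat.lt_or_ge m 3 with h3 | h3
    · interval_cases m <;> omega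
    · nlinarith

/-- In a cluster without cover vertices the two colours are not joined, so two edges of a tree are
missing. For a cluster of `2 j` vertices the claim then comes down to `0 ≤ 4 (j - 1) (j - 2)`. -/
theorem two_mul_sameArcs_add_card_le_of_cover (h : Palette col cc g 2) (hG : Degenerate G)
    {ι : Type*} [DecidableEq ι] {f : V → ι} (hf : FairLabeling col cc f) {C : Finset V}
    (hC : ∀ u v, G.Adj u v → col u ≠ col v → u ∈ C ∨ v ∈ C) :
    2 * sameArcs G f + Fintype.card V ≤ samePairs f + 4 * #C := by
  rw [sameArcs_eq_sum, samePairs_eq_sum, ← sum_card_cls_inter f C, mul_sum, mul_sum,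
    ← sum_add_distrib, card_eq_sum_cls f, ← sum_add_distrib]
  refine sum_le_sum fun i hi => ?_
  obtain ⟨j, hj, hS⟩ := hf i hi
  have h1 := hG.arcs_le _ (cls_nonempty hi)
  have hc := h.card_eq_of_multiple hS
  obtain ⟨a, b, hab⟩ := h.exists_col_ne le_rfl
  have ha := h.exists_mem_color hj hS a
  have hb := h.exists_mem_color hj hS b
  generalize cls f i = S at *
  have h3 : arcs G S + 4 ≤ 2 * #S + 2 * #{v ∈ S | v ∈ C} := by
    rcases Nat.eq_zero_or_pos #{v ∈ S | v ∈ C} with h2 | h2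
    · rw [card_eq_zero, filter_eq_empty_iff] at h2
      have := hG.arcs_le_of_split S (fun v => col v = col a) ha
        (by obtain ⟨v, hv, hvb⟩ := hb; exact ⟨v, hv, by rw [hvb]; exact hab.symm⟩)
        (fun u hu v hv hadj => by
          have : col u = col v := by
            by_contra hne
            exact (hC u v hadj hne).elim (h2 hu) (h2 hv)
          rw [this])
      omega
    · omega
  rw [hc] at h1 h3 ⊢
  obtain ⟨m, rfl⟩ : ∃ m, j = m + 1 := ⟨j - 1, by omega⟩
  have : (m + 1) * 2 - 1 = 2 * m + 1 := by omega
  rw [this]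
  rcases m with _ | m
  · omega
  · nlinarith

/-- Splitting clusters into minimal ones does not increase the cost if the minimal size is at
least three. -/
theorem exists_minimal_labeling (h : Palette col cc g d) (hd : 3 ≤ d) (hG : Degenerate G)
    {ι : Type*} [DecidableEq ι] {f : V → ι} (hf : FairLabeling col cc f) :
    ∃ f' : V → ι × ℕ, MinimalLabeling col cc f' ∧
      2 * sameArcs G f + Fintype.card V * (d - 1) ≤ samePairs f + 2 * sameArcs G f' := by
  classical
  let E : ι → Prop := fun i => ∃ p : V × V, G.Adj p.1 p.2 ∧ f p.1 = i ∧ f p.2 = i ∧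
    col p.1 ≠ col p.2
  let X : V → Prop := fun v => ∃ hE : E (f v), v = hE.choose.1 ∨ v = hE.choose.2
  let enc := Fintype.equivFin V
  -- In each cluster that has a bichromatic edge, the ends of one such edge come first in the
  -- ordering. Their colours differ, so each is first of its colour, both fall into block 0, and the
  -- edge survives the cut.
  let κ : V → ℕ := fun v => if X v then enc v else Fintype.card V + enc v
  have hκ : Function.Injective κ := by
    intro u v huv
    have h1 := (enc u).2
    have h2 := (enc v).2
    refine enc.injective (Fin.ext ?_)
    simp only [κ] at huv
    split_ifs at huv <;> omega
  let A : V → ℕ := fun u => #{v ∈ cls f (f u) | col v = col u ∧ κ v < κ u} / cc u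
  let f' : V → ι × ℕ := fun u => (f u, A u)
  have hX : ∀ v, X v → A v = 0 := by
    rintro v hv
    have : #{w ∈ cls f (f v) | col w = col v ∧ κ w < κ v} = 0 := by
      rw [card_eq_zero, filter_eq_empty_iff]
      rintro w hw ⟨hcol, hlt⟩
      have hwf : f w = f v := by simpa using hw
      have hXw : X w := by
        by_contra hXw
        simp only [κ, if_pos hv, if_neg hXw] at hlt
        have := (enc v).2
        omega
      obtain ⟨hE, hv'⟩ := hv
      obtain ⟨hE', hw'⟩ := hXw
      have key : ∀ i (_ : i = f v) (hE' : E i), (w = hE'.choose.1 ∨ w = hE'.choose.2) →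
          w = hE.choose.1 ∨ w = hE.choose.2 := by
        rintro i rfl hE' hw; exact hw
      have hw'' := key _ hwf hE' hw'
      have hne := hE.choose_spec.2.2.2
      have hwv : w = v := by
        rcases hv' with h1 | h1 <;> rcases hw'' with h2 | h2
        · rw [h1, h2]
        · exact absurd (by rw [← h1, ← h2, hcol]) hne
        · exact absurd (by rw [← h1, ← h2, hcol]) hne
        · rw [h1, h2]
      rw [hwv] at hlt
      exact lt_irrefl _ hlt
    simp only [A, this, Nat.zero_div]
  refine ⟨f', ?_, ?_⟩
  · intro i hi
    obtain ⟨v, _, rfl⟩ := mem_image.1 hi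
    obtain ⟨j, hj, hS⟩ := hf (f v) (mem_image_of_mem _ (mem_univ v))
    have h1 := h.multiple_one_of_multiple (A := A) (t := A v) (h.rank_div_lt κ hS (by simp)) κ
      hκ.injOn hS (fun u hu => by
        have : f u = f v := by simpa using hu
        simp only [A, this])
    convert h1 using 1
    ext u
    simp [f', Prod.ext_iff]
  · have e1 : sameArcs G f' = ∑ i ∈ univ.image f,
        #{p ∈ cls f i ×ˢ cls f i | G.Adj p.1 p.2 ∧ A p.1 = A p.2} := by
      rw [sameArcs, card_eq_sum_card_fiberwise (f := fun p => f p.1) (t := univ.image f)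
        (fun p _ => by simp)]
      refine sum_congr rfl fun i _ => ?_
      congr 1
      ext p
      simp only [mem_filter, mem_univ, true_and, mem_product, mem_cls, f', Prod.ext_iff]
      constructor
      · rintro ⟨⟨h1, h2, h4⟩, h3⟩; exact ⟨⟨h3, h2 ▸ h3⟩, h1, h4⟩
      · rintro ⟨⟨h1, h2⟩, h3, h4⟩; exact ⟨⟨h3, h1.trans h2.symm, h4⟩, h1⟩
    rw [e1, sameArcs_eq_sum, samePairs_eq_sum, mul_sum, mul_sum, card_eq_sum_cls f, sum_mul,
      ← sum_add_distrib, ← sum_add_distrib]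
    refine sum_le_sum fun i hi => ?_
    obtain ⟨j, hj, hS⟩ := hf i hi
    have hc := h.card_eq_of_multiple hS
    have hlt : ∀ u ∈ cls f i, A u < j := fun u hu => by
      obtain rfl : f u = i := by simpa using hu
      exact h.rank_div_lt κ hS hu
    obtain ⟨a, b, hab⟩ := h.exists_col_ne (by omega : 2 ≤ d)
    have ha := h.exists_mem_color hj hS a
    have hb := h.exists_mem_color hj hS b
    have h1 := hG.arcs_le _ (cls_nonempty hi)
    rcases Nat.lt_or_ge j 2 with hj2 | hj2
    · obtain rfl : j = 1 := by omega
      have : {p ∈ cls f i ×ˢ cls f i | G.Adj p.1 p.2 ∧ A p.1 = A p.2} =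
          {p ∈ cls f i ×ˢ cls f i | G.Adj p.1 p.2} := by
        refine filter_congr fun p hp => ?_
        rw [mem_product] at hp
        have h1 := hlt _ hp.1
        have h2 := hlt _ hp.2
        simp only [and_iff_left_iff_imp]
        omega
      rw [this, hc, one_mul, arcs]
      omega
    -- Either the chosen bichromatic edge survives and contributes two arcs on the right, or no edge
    -- is bichromatic and the cluster spans at least two edges fewer than its number of vertices.
    · have h3 : arcs G (cls f i) + 4 ≤ 2 * #(cls f i) +
          #{p ∈ cls f i ×ˢ cls f i | G.Adj p.1 p.2 ∧ A p.1 = A p.2} := by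
        by_cases hE : E i
        · have hs := hE.choose_spec
          set q := hE.choose with hq
          have hXq : ∀ v, v = q.1 ∨ v = q.2 → X v := by
            intro v hv
            have hfv : f v = i := by rcases hv with rfl | rfl; exacts [hs.2.1, hs.2.2.1]
            have key : ∀ k (_ : k = i) (hE' : E k), v = hE'.choose.1 ∨ v = hE'.choose.2 := by
              rintro k rfl hE'; exact hv
            exact ⟨hfv ▸ hE, key _ hfv _⟩
          have h2 : #({(q.1, q.2), (q.2, q.1)} : Finset (V × V)) ≤
              #{p ∈ cls f i ×ˢ cls f i | G.Adj p.1 p.2 ∧ A p.1 = A p.2} := by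
            refine card_le_card fun p hp => ?_
            have e1 := hX _ (hXq q.1 (.inl rfl))
            have e2 := hX _ (hXq q.2 (.inr rfl))
            simp only [mem_insert, mem_singleton] at hp
            rcases hp with rfl | rfl
            · simp [hs.1, hs.2.1, hs.2.2.1, e1, e2]
            · simp [hs.1.symm, hs.2.1, hs.2.2.1, e1, e2]
          rw [card_pair (fun h' => hs.1.ne (Prod.ext_iff.1 h').1)] at h2
          omega
        · have := hG.arcs_le_of_split (cls f i) (fun v => col v = col a) ha
            (by obtain ⟨v, hv, hvb⟩ := hb; exact ⟨v, hv, by rw [hvb]; exact hab.symm⟩)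
            (fun u hu v hv hadj => by
              have : col u = col v := by
                by_contra hne
                exact hE ⟨(u, v), hadj, by simpa using hu, by simpa using hv, hne⟩
              rw [this])
          omega
      rw [hc] at h3 ⊢
      generalize #{p ∈ cls f i ×ˢ cls f i | G.Adj p.1 p.2 ∧ A p.1 = A p.2} = B at *
      obtain ⟨j, rfl⟩ : ∃ k, j = k + 2 := ⟨j - 2, by omega⟩
      obtain ⟨d, rfl⟩ : ∃ k, d = k + 3 := ⟨d - 3, by omega⟩
      have e2 : d + 3 - 1 = d + 2 := rfl
      have e3 : (j + 2) * (d + 3) - 1 = j * (d + 3) + 2 * d + 5 := by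
        have : (j + 2) * (d + 3) = j * (d + 3) + 2 * d + 6 := by ring
        omega
      rw [e2, e3]
      -- Before the shifts of `j` and `d` this needs `0 ≤ j d (j d - d - 4) + 8`. For `j = 2` the
      -- right side is `2 (d - 2) ^ 2`; for `j ≥ 3` the bracket is positive because `d ≥ 3`.
      nlinarith [Nat.zero_le (j * d), Nat.zero_le (j * d * d), Nat.zero_le (j * j * d)]

end Palette

end FairCC

namespace FairCC

open Finset

/-! ### Selections with prescribed numbers -/

theorem exists_subset_card_fiber {α β : Type*} [DecidableEq α] [DecidableEq β] (S : Finset α)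
    (κ : α → β) (m : β → ℕ) (hm : ∀ k, m k ≤ #{q ∈ S | κ q = k}) :
    ∃ X ⊆ S, ∀ k, #{q ∈ X | κ q = k} = m k := by
  choose F hF hcard using fun k => exists_subset_card_eq (hm k)
  refine ⟨{q ∈ S | q ∈ F (κ q)}, filter_subset _ _, fun k => ?_⟩
  rw [← hcard k]
  congr 1
  ext q
  simp only [mem_filter]
  constructor
  · rintro ⟨⟨_, h⟩, rfl⟩; exact h
  · intro h
    obtain ⟨h1, rfl⟩ := mem_filter.1 (hF k h)
    exact ⟨⟨h1, h⟩, rfl⟩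

/-- Injections chosen fibre by fibre glue to one, because `f'` tells from the image which fibre was
used. -/
theorem exists_injOn_fiber {α α' β : Type*} [Nonempty α'] [DecidableEq β]
    (A : Finset α) (B : Finset α') (f : α → β) (f' : α' → β)
    (h : ∀ t, #{a ∈ A | f a = t} ≤ #{b ∈ B | f' b = t}) :
    ∃ e : α → α', (∀ a ∈ A, e a ∈ B ∧ f' (e a) = f a) ∧ Set.InjOn e A := by
  classical
  have key : ∀ t, Nonempty ({a // a ∈ A.filter (f · = t)} ↪ {b // b ∈ B.filter (f' · = t)}) := by
    intro t
    refine Function.Embedding.nonempty_of_card_le ?_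
    simpa only [Fintype.card_coe] using h t
  let E := fun t => (key t).some
  let e : α → α' := fun a => if ha : a ∈ A then E (f a) ⟨a, by simp [ha]⟩ else Classical.arbitrary _
  have he : ∀ a (ha : a ∈ A), e a = E (f a) ⟨a, by simp [ha]⟩ := fun a ha => by simp [e, ha]
  refine ⟨e, fun a ha => ?_, fun a ha b hb hab => ?_⟩
  · rw [he a ha]
    exact mem_filter.1 (E (f a) ⟨a, by simp [ha]⟩).2
  · have hfa : f' (e a) = f a := by
      rw [he a ha]; exact (mem_filter.1 (E (f a) ⟨a, by simpa using ha⟩).2).2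
    have hfb : f' (e b) = f b := by
      rw [he b hb]; exact (mem_filter.1 (E (f b) ⟨b, by simpa using hb⟩).2).2
    have hf : f a = f b := by rw [← hfa, ← hfb, hab]
    have h2 : ∀ t (ht : t = f a), e a = E t ⟨a, by simpa [ht] using ha⟩ := by
      rintro t rfl; exact he a ha
    have h3 := h2 (f b) hf.symm
    rw [hab, he b hb] at h3
    have := (E (f b)).injective (Subtype.ext h3)
    exact (congrArg Subtype.val this).symm

theorem sum_div_le_div {α : Type*} (S : Finset α) (f : α → ℕ) {N : ℕ} (hN : 0 < N) :
    ∑ k ∈ S, f k / N ≤ (∑ k ∈ S, f k) / N := by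
  rw [Nat.le_div_iff_mul_le hN, sum_mul]
  exact sum_le_sum fun k _ => Nat.div_mul_le_self _ _

theorem div_mul_le_mul_div (x m : ℕ) {N : ℕ} (hN : 0 < N) : x / N * m ≤ x * m / N := by
  rw [Nat.le_div_iff_mul_le hN, mul_right_comm]
  exact Nat.mul_le_mul_right m (Nat.div_mul_le_self _ _)

/-! ### Dealing the pieces of a partition to many similar chunks -/

/-- The possible ways in which a cluster of at most `d` vertices meets pieces of at most `w`
vertices of given types. -/
abbrev Config (T : Type*) (w d : ℕ) : Type _ :=
  ((T × Finset (Finset (Fin w))) × Finset (Fin w) → Fin (d + 1)) × Fin (d * d + 1)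

/-- Here `pc` gives the piece of a vertex, `rk` its position there, `τ` the type of a piece and `ch`
its chunk. A cluster has a configuration: how often it occupies a given block of positions in pieces
of a given type and pattern, and how many arcs it has inside pieces. Of every configuration, and of
the pieces of every type and pattern, the fraction `1 / N` is selected, rounded down. The selected
pieces fit into chunk `j`, and the selected clusters fit into the selected pieces. Moving vertices
to equal positions keeps colours and the arcs inside pieces. Rounding loses at most `N - 1` clusters
per configuration, each with at most `d * d` arcs. The label bound ensures that the search meets
this labeling. -/
theorem exists_chunk_labeling {V γ ι T : Type*} [Fintype V] [DecidableEq V] [DecidableEq γ]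
    [DecidableEq ι] [Fintype T] [DecidableEq T] {G : SimpleGraph V} [DecidableRel G.Adj]
    {col : V → γ} {cc : V → ℕ} {d w N j : ℕ} {Q : V → ι} {pc : V → V} {rk : V → ℕ} {τ : V → T}
    {ch : V → ℕ} (hN : 0 < N)
    (hQ : MinimalLabeling col cc Q) (hQd : ∀ i ∈ univ.image Q, #(cls Q i) = d)
    (hrk : ∀ u v, pc u = pc v → rk u = rk v → u = v) (hw : ∀ u, rk u < w)
    (hτ : ∀ u y, τ (pc u) = τ y → ∃ v, pc v = y ∧ rk v = rk u ∧ col v = col u)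
    (hadj : ∀ u v u' v', pc u = pc v → pc u' = pc v' → τ (pc u) = τ (pc u') → rk u = rk u' →
      rk v = rk v' → G.Adj u v → G.Adj u' v')
    (hch : ∀ t, #{y | τ y = t} / N ≤ #{y | τ y = t ∧ ch y = j}) :
    ∃ h : V → ℕ, (∀ u, h u ≠ 0 → ch (pc u) = j) ∧
      (∀ u, h u ≠ 0 → Multiple col cc 1 (cls h (h u))) ∧
      (∀ u, h u ≤ #{v | ch (pc v) = j}) ∧
      #{p : V × V | G.Adj p.1 p.2 ∧ Q p.1 = Q p.2 ∧ pc p.1 = pc p.2} ≤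
        N * #{p : V × V | G.Adj p.1 p.2 ∧ h p.1 = h p.2 ∧ h p.1 ≠ 0} +
        (N - 1) * (Fintype.card (Config T w d) * (d * d)) := by
  classical
  rcases isEmpty_or_nonempty V with hE | hne
  · exact ⟨fun _ => 0, fun u => hE.elim u, fun u => hE.elim u, fun u => hE.elim u, by
      rw [card_eq_zero.2 (filter_eq_empty_iff.2 fun p _ => hE.elim p.1)]; exact Nat.zero_le _⟩
  have : Nonempty ι := hne.map Q
  let I : Finset ι := univ.image Q
  have hI : ∀ u, Q u ∈ I := fun u => mem_image_of_mem _ (mem_univ u)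
  let val : ι → ℕ := fun q => #{p : V × V | (G.Adj p.1 p.2 ∧ Q p.1 = Q p.2 ∧ pc p.1 = pc p.2) ∧
    Q p.1 = q}
  -- The positions of piece `y` that belong to cluster `q`. The pattern of `y` is the set of all its
  -- blocks, without the names of the clusters.
  let blk : V → ι → Finset (Fin w) := fun y q => {r | ∃ u, pc u = y ∧ Q u = q ∧ rk u = r}
  let pat : V → Finset (Finset (Fin w)) := fun y => I.image (blk y)
  let Y : V → T × Finset (Finset (Fin w)) := fun y => (τ y, pat y)
  let conf : ι → (T × Finset (Finset (Fin w))) × Finset (Fin w) → ℕ := fun q σ =>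
    #{y | (Y y, blk y q) = σ ∧ blk y q ≠ ∅}
  have hblk : ∀ u, (⟨rk u, hw u⟩ : Fin w) ∈ blk (pc u) (Q u) := fun u => by
    simp only [blk, mem_filter, mem_univ, true_and]; exact ⟨u, rfl, rfl, rfl⟩
  have hmemblk : ∀ u q, (⟨rk u, hw u⟩ : Fin w) ∈ blk (pc u) q → Q u = q := by
    intro u q hq
    simp only [blk, mem_filter, mem_univ, true_and] at hq
    obtain ⟨v, h1, h2, h3⟩ := hq
    rw [hrk u v h1.symm h3.symm, h2]
  have hblkuniq : ∀ y q q', blk y q = blk y q' → blk y q ≠ ∅ → q = q' := by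
    intro y q q' heq hne
    obtain ⟨r, hr⟩ := nonempty_iff_ne_empty.2 hne
    obtain ⟨u, rfl, hq, hur⟩ : ∃ u, pc u = y ∧ Q u = q ∧ rk u = r := by simpa [blk] using hr
    have : r = ⟨rk u, hw u⟩ := Fin.ext hur.symm
    rw [heq, this] at hr
    rw [← hq, hmemblk u q' hr]
  have hconf : ∀ q ∈ I, ∀ σ, conf q σ ≤ d := by
    intro q hq σ
    rw [← hQd q hq]
    refine le_trans (card_le_card (t := (cls Q q).image pc) fun y hy => ?_) card_image_le
    obtain ⟨_, hne⟩ := (mem_filter.1 hy).2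
    obtain ⟨r, hr⟩ := nonempty_iff_ne_empty.2 hne
    obtain ⟨u, rfl, hq, hur⟩ : ∃ u, pc u = y ∧ Q u = q ∧ rk u = r := by simpa [blk] using hr
    exact mem_image_of_mem _ (by simpa using hq)
  have hval : ∀ q ∈ I, val q ≤ d * d := by
    intro q hq
    rw [← hQd q hq, ← card_product]
    refine card_le_card fun p hp => ?_
    simp only [mem_filter, mem_univ, true_and] at hp
    simp only [mem_product, mem_cls]
    exact ⟨hp.2, hp.1.2.1 ▸ hp.2⟩
  -- By `hconf` and `hval` the minima change nothing for actual clusters; they only make the set of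
  -- configurations finite.
  let κ : ι → Config T w d := fun q =>
    (fun σ => ⟨min (conf q σ) d, by omega⟩, ⟨min (val q) (d * d), by omega⟩)
  have hκ1 : ∀ q ∈ I, ∀ σ, ((κ q).1 σ : ℕ) = conf q σ := fun q hq σ => min_eq_left (hconf q hq σ)
  have hκ2 : ∀ q ∈ I, ((κ q).2 : ℕ) = val q := fun q hq => min_eq_left (hval q hq)
  let x : Config T w d → ℕ := fun k => #{q ∈ I | κ q = k}
  obtain ⟨X, hXI, hX⟩ := exists_subset_card_fiber I κ (fun k => x k / N)
    fun k => Nat.div_le_self _ _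
  have hsum : ∀ (F : ι → ℕ) (F' : Config T w d → ℕ) (hF : ∀ q ∈ I, F q = F' (κ q))
      (Z : Finset ι) (_ : Z ⊆ I), ∑ q ∈ Z, F q = ∑ k, #{q ∈ Z | κ q = k} * F' k := by
    intro F F' hF Z hZ
    rw [← sum_fiberwise_of_maps_to (s := Z) (t := univ) (g := κ) (fun _ _ => mem_univ _)]
    refine sum_congr rfl fun k _ => ?_
    refine sum_const_nat fun q hq => ?_
    rw [mem_filter] at hq
    rw [hF q (hZ hq.1), hq.2]
  -- `O` takes the fraction `1 / N` of the pieces of each type and pattern, in parallel to the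
  -- selection `X` of clusters.
  obtain ⟨O, -, hO⟩ := exists_subset_card_fiber (univ : Finset V) Y
    (fun t => #{y | Y y = t} / N) fun k => Nat.div_le_self _ _
  -- the selected pieces are mapped into the chunk
  have hOτ : ∀ t, #{y ∈ O | τ y = t} ≤ #{y ∈ ({y | ch y = j} : Finset V) | τ y = t} := by
    intro t
    have e1 : ∀ Z : Finset V, #{y ∈ Z | τ y = t} = ∑ P, #{y ∈ Z | Y y = (t, P)} := by
      intro Z
      rw [card_eq_sum_card_fiberwise (f := pat) (t := univ) (fun _ _ => mem_coe.2 (mem_univ _))]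
      refine sum_congr rfl fun P _ => ?_
      rw [filter_filter]
      simp only [Y, Prod.mk.injEq]
    rw [e1, sum_congr rfl fun P _ => hO (t, P)]
    refine (sum_div_le_div _ (fun P => #{y | Y y = (t, P)}) hN).trans ?_
    rw [← e1 univ]
    refine (hch t).trans (card_le_card fun y hy => ?_)
    simp only [mem_filter, mem_univ, true_and] at hy ⊢
    exact hy.symm
  obtain ⟨e, he, heinj⟩ := exists_injOn_fiber O {y | ch y = j} τ τ hOτ
  -- the blocks of the selected clusters are mapped to the selected pieces
  let D : Finset (V × ι) := {a ∈ univ ×ˢ X | blk a.1 a.2 ≠ ∅}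
  -- Demand is at most supply. A piece has at most one cluster with a given nonempty block, so the
  -- inequality holds before the selection, and rounding down after summation is at least the sum of
  -- the parts rounded down.
  have hD : ∀ σ, #{a ∈ D | (Y a.1, blk a.1 a.2) = σ} ≤
      #{b ∈ O ×ˢ (univ : Finset (Finset (Fin w))) | (Y b.1, b.2) = σ} := by
    rintro ⟨t, B⟩
    have e0 : ∀ Z : Finset ι, #{a ∈ (univ : Finset V) ×ˢ Z | (Y a.1, blk a.1 a.2) = (t, B) ∧
        blk a.1 a.2 ≠ ∅} = ∑ q ∈ Z, conf q (t, B) := by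
      intro Z
      rw [card_filter, sum_product_right]
      refine sum_congr rfl fun q _ => ?_
      simp only [conf]
      rw [card_filter]
    have e1 : #{a ∈ D | (Y a.1, blk a.1 a.2) = (t, B)} = ∑ q ∈ X, conf q (t, B) := by
      rw [← e0, filter_filter]
      congr 1
      ext a; simp only [mem_filter]; tauto
    have e2 : #{b ∈ O ×ˢ (univ : Finset (Finset (Fin w))) | (Y b.1, b.2) = (t, B)} =
        #{y | Y y = t} / N := by
      rw [← hO t]
      refine card_nbij' (fun b => b.1) (fun y => (y, B)) ?_ ?_ ?_ ?_
      · intro b hb; simp only [mem_coe, mem_filter, mem_product, Prod.mk.injEq] at hb ⊢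
        exact ⟨hb.1.1, hb.2.1⟩
      · intro y hy; simp only [mem_coe, mem_filter, mem_product, Prod.mk.injEq] at hy ⊢
        exact ⟨⟨hy.1, mem_univ _⟩, hy.2, trivial⟩
      · intro b hb; simp only [mem_coe, mem_filter, Prod.mk.injEq] at hb
        exact Prod.ext rfl hb.2.2.symm
      · intro y _; rfl
    rw [e1, e2, hsum (fun q => conf q (t, B)) (fun k => (k.1 (t, B) : ℕ))
      (fun q hq => (hκ1 q hq _).symm) X hXI]
    have e3 : ∑ k, #{q ∈ X | κ q = k} * (k.1 (t, B) : ℕ) ≤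
        ∑ k, (x k * (k.1 (t, B) : ℕ)) / N := by
      refine sum_le_sum fun k _ => ?_
      rw [hX k]; exact div_mul_le_mul_div _ _ hN
    refine e3.trans ((sum_div_le_div _ _ hN).trans (Nat.div_le_div_right ?_))
    rw [← hsum (fun q => conf q (t, B)) (fun k => (k.1 (t, B) : ℕ))
      (fun q hq => (hκ1 q hq _).symm) I le_rfl, ← e0]
    refine card_le_card_of_injOn (fun a => a.1) ?_ ?_
    · intro a ha
      simp only [mem_coe, mem_filter, Prod.mk.injEq] at ha
      simp [ha.2.1.1]
    · intro a ha b hb hab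
      simp only [mem_coe, mem_filter, Prod.mk.injEq] at ha hb
      refine Prod.ext hab (hblkuniq a.1 _ _ ?_ ha.2.2)
      rw [ha.2.1.2]
      change a.1 = b.1 at hab
      rw [hab, hb.2.1.2]
  obtain ⟨z, hz, hzinj⟩ := exists_injOn_fiber D (O ×ˢ univ) (fun a => (Y a.1, blk a.1 a.2))
    (fun b => (Y b.1, b.2)) hD
  have hDmem : ∀ u, Q u ∈ X → (pc u, Q u) ∈ D := fun u hu => by
    simp only [D, mem_filter, mem_product, mem_univ, true_and]
    exact ⟨hu, ne_empty_of_mem (hblk u)⟩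
  have hplace : ∀ u, ∃ v, Q u ∈ X →
      pc v = e (z (pc u, Q u)).1 ∧ rk v = rk u ∧ col v = col u := by
    intro u
    by_cases hu : Q u ∈ X
    · have h1 := hz _ (hDmem u hu)
      have h2 := he _ (mem_product.1 h1.1).1
      have h3 : τ (pc u) = τ (e (z (pc u, Q u)).1) := by
        rw [h2.2]
        exact (congrArg (fun t => t.1.1) h1.2).symm
      obtain ⟨v, hv⟩ := hτ u _ h3
      exact ⟨v, fun _ => hv⟩
    · exact ⟨u, fun h => absurd h hu⟩
  choose Z hZ using hplace
  have hτZ : ∀ u, Q u ∈ X → τ (pc u) = τ (pc (Z u)) ∧ ch (pc (Z u)) = j := by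
    intro u hu
    have h1 := hz _ (hDmem u hu)
    have h2 := he _ (mem_product.1 h1.1).1
    rw [(hZ u hu).1]
    refine ⟨?_, (mem_filter.1 h2.1).2⟩
    rw [h2.2]
    exact (congrArg (fun t => t.1.1) h1.2).symm
  -- If the images agree, both vertices use the same selected piece and the same position. Blocks in
  -- one pattern are disjoint, so the blocks agree too; then injectivity of `z` yields the same
  -- piece and cluster.
  have hZinj : ∀ u v, Q u ∈ X → Q v ∈ X → Z u = Z v → u = v := by
    intro u v hu hv huv
    have hu1 := hz _ (hDmem u hu)
    have hv1 := hz _ (hDmem v hv)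
    have hpc : e (z (pc u, Q u)).1 = e (z (pc v, Q v)).1 := by
      rw [← (hZ u hu).1, ← (hZ v hv).1, huv]
    have ho := heinj (mem_product.1 hu1.1).1 (mem_product.1 hv1.1).1 hpc
    have hr : rk u = rk v := by rw [← (hZ u hu).2.1, ← (hZ v hv).2.1, huv]
    have hu2 : Y (z (pc u, Q u)).1 = Y (pc u) ∧ (z (pc u, Q u)).2 = blk (pc u) (Q u) :=
      Prod.ext_iff.1 hu1.2
    have hv2 : Y (z (pc v, Q v)).1 = Y (pc v) ∧ (z (pc v, Q v)).2 = blk (pc v) (Q v) :=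
      Prod.ext_iff.1 hv1.2
    have hYY : Y (pc u) = Y (pc v) := by rw [← hu2.1, ← hv2.1, ho]
    have hBB : blk (pc u) (Q u) = blk (pc v) (Q v) := by
      have h1 : blk (pc v) (Q v) ∈ pat (pc u) := by
        have : pat (pc u) = pat (pc v) := (Prod.ext_iff.1 hYY).2
        rw [this]; exact mem_image_of_mem _ (hI v)
      obtain ⟨q, _, hq⟩ := mem_image.1 h1
      have h2 := hblk v
      rw [← hq] at h2
      have h3 : (⟨rk v, hw v⟩ : Fin w) = ⟨rk u, hw u⟩ := Fin.ext hr.symm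
      rw [h3] at h2
      rw [← hq, hmemblk u q h2]
    have hzz : z (pc u, Q u) = z (pc v, Q v) := by
      refine Prod.ext ho ?_
      rw [hu2.2, hv2.2, hBB]
    have := hzinj (hDmem u hu) (hDmem v hv) hzz
    exact hrk u v (Prod.ext_iff.1 this).1 hr
  -- Labels start at 1, as 0 means unmarked.
  let lab : ι → ℕ := fun q => if hq : q ∈ X then (X.equivFin ⟨q, hq⟩ : ℕ) + 1 else 0
  have hlab : ∀ q ∈ X, ∀ q' ∈ X, lab q = lab q' → q = q' := by
    intro q hq q' hq' h
    simp only [lab, dif_pos hq, dif_pos hq', Nat.add_right_cancel_iff] at h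
    exact congrArg Subtype.val (X.equivFin.injective (Fin.ext h))
  have hlab0 : ∀ q ∈ X, lab q ≠ 0 := fun q hq => by simp [lab, hq]
  have hlable : ∀ q, lab q ≤ #X := fun q => by
    simp only [lab]
    split
    · exact (X.equivFin ⟨q, ‹_›⟩).2
    · exact Nat.zero_le _
  let h : V → ℕ := fun v => if hv : ∃ u, Q u ∈ X ∧ Z u = v then lab (Q hv.choose) else 0
  have hhZ : ∀ u, Q u ∈ X → h (Z u) = lab (Q u) := by
    intro u hu
    have hv : ∃ u', Q u' ∈ X ∧ Z u' = Z u := ⟨u, hu, rfl⟩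
    have h1 := hv.choose_spec
    simp only [h, dif_pos hv]
    rw [hZinj _ _ h1.1 hu h1.2]
  have hh0 : ∀ v, h v ≠ 0 → ∃ u, Q u ∈ X ∧ Z u = v := by
    intro v hv
    by_contra hc
    exact hv (by simp only [h, dif_neg hc])
  refine ⟨h, ?_, ?_, ?_, ?_⟩
  · intro v hv
    obtain ⟨u, hu, rfl⟩ := hh0 v hv
    exact (hτZ u hu).2
  · intro v hv t
    obtain ⟨u, hu, rfl⟩ := hh0 v hv
    rw [← hQ (Q u) (hI u) t]
    symm
    have hmem : ∀ v, v ∈ cls Q (Q u) → Q v ∈ X := fun v hv => by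
      rw [mem_cls] at hv; rw [hv]; exact hu
    refine card_nbij Z ?_ ?_ ?_
    · intro v hv
      simp only [mem_coe, mem_filter] at hv
      have hvX := hmem v hv.1
      simp only [mem_coe, mem_filter, mem_cls, hhZ u hu, hhZ v hvX]
      rw [mem_cls] at hv
      exact ⟨by rw [hv.1], by rw [(hZ v hvX).2.2, hv.2]⟩
    · intro a ha b hb hab
      simp only [mem_coe, mem_filter] at ha hb
      exact hZinj a b (hmem a ha.1) (hmem b hb.1) hab
    · intro v hv
      simp only [mem_coe, mem_filter, mem_cls] at hv
      obtain ⟨v', hv', rfl⟩ := hh0 v (by rw [hv.1]; assumption)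
      rw [hhZ u hu, hhZ v' hv', (hZ v' hv').2.2] at hv
      refine ⟨v', ?_, rfl⟩
      simp only [mem_coe, mem_filter, mem_cls]
      exact ⟨hlab _ hv' _ hu hv.1, hv.2⟩
  -- Each selected cluster places a vertex of its own in the chunk, so there are no more labels than
  -- vertices.
  · have hXcard : #X ≤ #{v | ch (pc v) = j} := by
      have : ∀ q ∈ X, ∃ u, Q u = q := fun q hq => by
        obtain ⟨u, _, hu⟩ := mem_image.1 (hXI hq)
        exact ⟨u, hu⟩
      let s : ι → V := fun q => if hq : ∃ u, Q u = q then hq.choose else Classical.arbitrary V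
      have hs : ∀ q ∈ X, Q (s q) = q := fun q hq => by
        simp only [s, dif_pos (this q hq)]; exact (this q hq).choose_spec
      refine card_le_card_of_injOn (fun q => Z (s q)) (fun q hq => ?_) fun q hq q' hq' heq => ?_
      · simp only [mem_coe, mem_filter, mem_univ, true_and]
        exact (hτZ (s q) (by rw [hs q hq]; exact hq)).2
      · have := hZinj _ _ (by rw [hs q hq]; exact hq) (by rw [hs q' hq']; exact hq') heq
        rw [← hs q hq, this, hs q' hq']
    intro v
    refine le_trans ?_ hXcard
    simp only [h]
    split
    · exact hlable _
    · exact Nat.zero_le _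
  · have e1 : ∀ W : Finset ι, #{p : V × V | (G.Adj p.1 p.2 ∧ Q p.1 = Q p.2 ∧ pc p.1 = pc p.2) ∧
        Q p.1 ∈ W} = ∑ q ∈ W, val q := by
      intro W
      rw [card_eq_sum_card_fiberwise (f := fun p => Q p.1) (t := W) (fun p hp => by
        simp only [mem_coe, mem_filter] at hp; exact hp.2.2)]
      refine sum_congr rfl fun q hq => ?_
      rw [filter_filter]
      simp only [val]
      congr 1
      ext p
      simp only [mem_filter, mem_univ, true_and]
      constructor
      · rintro ⟨⟨h1, _⟩, h2⟩; exact ⟨h1, h2⟩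
      · rintro ⟨h1, h2⟩; exact ⟨⟨h1, h2 ▸ hq⟩, h2⟩
    have e2 : #{p : V × V | G.Adj p.1 p.2 ∧ Q p.1 = Q p.2 ∧ pc p.1 = pc p.2} =
        ∑ q ∈ I, val q := by
      rw [← e1]
      congr 1
      ext p
      simp only [mem_filter, mem_univ, true_and, hI, and_true]
    have e3 : ∑ q ∈ X, val q ≤
        #{p : V × V | G.Adj p.1 p.2 ∧ h p.1 = h p.2 ∧ h p.1 ≠ 0} := by
      rw [← e1]
      refine card_le_card_of_injOn (fun p => (Z p.1, Z p.2)) (fun p hp => ?_)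
        fun p hp q hq heq => ?_
      · simp only [mem_coe, mem_filter, mem_univ, true_and] at hp ⊢
        obtain ⟨⟨h1, h2, h3⟩, h4⟩ := hp
        have h5 : Q p.2 ∈ X := h2 ▸ h4
        rw [hhZ _ h4, hhZ _ h5]
        refine ⟨?_, by rw [h2], hlab0 _ h4⟩
        refine hadj p.1 p.2 _ _ h3 ?_ (hτZ _ h4).1 (hZ _ h4).2.1.symm (hZ _ h5).2.1.symm h1
        rw [(hZ _ h4).1, (hZ _ h5).1, h2, h3]
      · simp only [mem_coe, mem_filter, mem_univ, true_and] at hp hq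
        rw [Prod.mk.injEq] at heq
        exact Prod.ext (hZinj _ _ hp.2 hq.2 heq.1)
          (hZinj _ _ (hp.1.2.1 ▸ hp.2) (hq.1.2.1 ▸ hq.2) heq.2)
    rw [e2]
    refine le_trans ?_ (Nat.add_le_add_right (Nat.mul_le_mul_left N e3) _)
    rw [hsum val (fun k => (k.2 : ℕ)) (fun q hq => (hκ2 q hq).symm) X hXI,
      hsum val (fun k => (k.2 : ℕ)) (fun q hq => (hκ2 q hq).symm) I le_rfl]
    have e4 : Fintype.card (Config T w d) * (d * d) = ∑ _k : Config T w d, d * d := by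
      rw [sum_const, smul_eq_mul, Finset.card_univ]
    rw [e4, mul_sum, mul_sum, ← sum_add_distrib]
    refine sum_le_sum fun k _ => ?_
    rw [hX k]
    -- Rounding down loses less than `N` clusters of each configuration.
    have h1 : #{q ∈ I | κ q = k} ≤ N * (x k / N) + (N - 1) := by
      have := Nat.div_add_mod (x k) N
      have := Nat.mod_lt (x k) hN
      change x k ≤ _
      omega
    have h2 : (k.2 : ℕ) ≤ d * d := Nat.lt_succ_iff.1 k.2.2
    calc #{q ∈ I | κ q = k} * (k.2 : ℕ) ≤ (N * (x k / N) + (N - 1)) * (k.2 : ℕ) :=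
          Nat.mul_le_mul_right _ h1
      _ = N * (x k / N * (k.2 : ℕ)) + (N - 1) * (k.2 : ℕ) := by ring
      _ ≤ _ := Nat.add_le_add_left (Nat.mul_le_mul_left _ h2) _

end FairCC

namespace FairCC

open Finset

/-! ### Leaf elimination -/

section Elimination

variable {n : ℕ} {G : SimpleGraph (Fin n)}

/-- The vertices that were matched with a vertex eliminated earlier than themselves. -/
def Covering (h : Fin n → ℕ) (u : Fin n) : Prop := h u ≠ 0 ∧ h u ≠ u + 1

instance (h : Fin n → ℕ) : DecidablePred (Covering h) := fun u =>
  inferInstanceAs (Decidable (h u ≠ 0 ∧ h u ≠ u + 1))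

/-- State of the greedy matching along a leaf elimination; `h` labels the matched pairs. -/
structure MatchInv (G : SimpleGraph (Fin n)) (ok : Fin n → Fin n → Prop) (dead : Fin n → Prop)
    (h : Fin n → ℕ) : Prop where
  pair : ∀ u, h u ≠ 0 → ∃ x p, h u = x.val + 1 ∧ dead x ∧ x ≠ p ∧ G.Adj x p ∧ ok x p ∧
    ∀ v, h v = h u ↔ v = x ∨ v = p
  alive : ∀ u, ¬ dead u → h u ≠ u + 1
  cover : ∀ u v, G.Adj u v → ok u v → dead u → Covering h u ∨ Covering h v

namespace MatchInv

variable {ok : Fin n → Fin n → Prop} {dead : Fin n → Prop} {h : Fin n → ℕ}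

theorem init (hd : ∀ u, ¬ dead u) (hh : ∀ u, h u = 0) : MatchInv G ok dead h where
  pair u hu := absurd (hh u) hu
  alive u _ := by rw [hh u]; omega
  cover u _ _ _ hu := absurd hu (hd u)

theorem congr {dead' : Fin n → Prop} {h' : Fin n → ℕ} (hI : MatchInv G ok dead h)
    (hd : ∀ u, dead' u ↔ dead u) (hh : ∀ u, h' u = h u) : MatchInv G ok dead' h' := by
  obtain rfl : dead' = dead := funext fun u => propext (hd u)
  obtain rfl : h' = h := funext hh
  exact hI

/-- An edge from `x` to a live vertex already has a matched end, and both ends were alive, so by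
`alive` the label of this end comes from a vertex other than itself: it is covering. -/
theorem skip (hok : ∀ u v, ok u v → ok v u) (hI : MatchInv G ok dead h) {x : Fin n}
    (hx : ¬ dead x)
    (hp : ∀ p, ¬ dead p → G.Adj x p → ok x p → h x ≠ 0 ∨ h p ≠ 0) :
    MatchInv G ok (fun u => dead u ∨ u = x) h where
  pair u hu := by
    obtain ⟨y, p, h1, h2, h3⟩ := hI.pair u hu
    exact ⟨y, p, h1, .inl h2, h3⟩
  alive u hu := hI.alive u fun h => hu (.inl h)
  cover u v huv hokuv hdu := by
    by_cases hu : dead u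
    · exact hI.cover u v huv hokuv hu
    obtain rfl : u = x := hdu.resolve_left hu
    by_cases hv : dead v
    · exact (hI.cover v u huv.symm (hok _ _ hokuv) hv).symm
    · exact (hp v hv huv hokuv).imp (fun h => ⟨h, hI.alive u hu⟩) fun h => ⟨h, hI.alive v hv⟩

/-- The pair is labelled `x + 1`, which is new since `x` was alive. Then `p` becomes covering, and
by uniqueness `x p` is the only edge from `x` to a live vertex. -/
theorem join (hok : ∀ u v, ok u v → ok v u) (hI : MatchInv G ok dead h) {x p : Fin n}
    (hx : ¬ dead x) (hdp : ¬ dead p) (hadj : G.Adj x p) (hokp : ok x p) (hhx : h x = 0)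
    (hhp : h p = 0) (huniq : ∀ w, ¬ dead w → G.Adj x w → w = p) :
    MatchInv G ok (fun u => dead u ∨ u = x)
      (fun u => if u = x ∨ u = p then x.val + 1 else h u) := by
  have hne : x ≠ p := hadj.ne
  have hfresh : ∀ u, h u ≠ x.val + 1 := by
    intro u hu
    obtain ⟨y, q, h1, h2, -⟩ := hI.pair u (by omega)
    exact hx (by rwa [Fin.ext (by omega : x.val = y.val)])
  have hmono : ∀ u, Covering h u →
      Covering (fun u => if u = x ∨ u = p then x.val + 1 else h u) u := by
    rintro u ⟨h1, h2⟩
    have h3 : ¬ (u = x ∨ u = p) := by rintro (rfl | rfl) <;> contradiction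
    simp only [Covering, if_neg h3]
    exact ⟨h1, h2⟩
  have hcp : Covering (fun u => if u = x ∨ u = p then x.val + 1 else h u) p := by
    refine ⟨by simp, ?_⟩
    simp only [or_true, if_true]
    exact fun h => hne (Fin.ext (by omega))
  refine ⟨fun u hu => ?_, fun u hu => ?_, fun u v huv hokuv hdu => ?_⟩
  · by_cases hux : u = x ∨ u = p
    · refine ⟨x, p, by simp [hux], .inr rfl, hne, hadj, hokp, fun v => ?_⟩
      simp only [if_pos hux]
      by_cases hv : v = x ∨ v = p
      · simp [hv]
      · simp only [hv, iff_false]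
        exact hfresh v
    · simp only [if_neg hux] at hu ⊢
      obtain ⟨y, q, h1, h2, h3, h4, h5, h6⟩ := hI.pair u hu
      refine ⟨y, q, h1, .inl h2, h3, h4, h5, fun v => ?_⟩
      rw [← h6]
      by_cases hv : v = x ∨ v = p
      · simp only [if_pos hv]
        have h0 : h v = 0 := by rcases hv with rfl | rfl <;> assumption
        have := hfresh u
        rw [h0]
        constructor
        · intro h; exact absurd h.symm this
        · intro h; exact absurd h.symm hu
      · simp only [if_neg hv]
  · have hux : u ≠ x := fun h => hu (.inr h)
    by_cases hup : u = p
    · subst hup; simpa using hcp.2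
    · simp only [hux, hup, or_self, if_false]
      exact hI.alive u fun h => hu (.inl h)
  · by_cases hu : dead u
    · exact (hI.cover u v huv hokuv hu).imp (hmono u) (hmono v)
    obtain rfl : u = x := hdu.resolve_left hu
    by_cases hv : dead v
    · exact (hI.cover v u huv.symm (hok _ _ hokuv) hv).symm.imp (hmono u) (hmono v)
    · obtain rfl := huniq v hv huv
      exact .inr hcp

/-- In a pair labelled `x + 1` the vertex `x` itself is not covering. So the covering vertices
inject into the matched vertices that are not covering. -/
theorem two_mul_card_covering_le (hI : MatchInv G ok dead h) :
    2 * #{u | Covering h u} ≤ #{u | h u ≠ 0} := by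
  classical
  have hx : ∀ u, ∃ x : Fin n, h u ≠ 0 → h u = x + 1 ∧ h x = x + 1 ∧
      ∀ v, h v = h u → v ≠ x → ∀ v', h v' = h u → v' ≠ x → v = v' := by
    intro u
    by_cases hu : h u ≠ 0
    · obtain ⟨x, p, h1, h2, h3, h4, h5, h6⟩ := hI.pair u hu
      refine ⟨x, fun _ => ⟨h1, by rw [← h1]; exact (h6 x).2 (.inl rfl), fun v hv hvx v' hv' hvx' => ?_⟩⟩
      rw [((h6 v).1 hv).resolve_left hvx, ((h6 v').1 hv').resolve_left hvx']
    · exact ⟨u, fun h => absurd h hu⟩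
  choose X hX using hx
  have h1 : #{u | Covering h u} ≤ #{u | h u ≠ 0 ∧ ¬ Covering h u} := by
    refine card_le_card_of_injOn X (fun u hu => ?_) fun u hu v hv huv => ?_
    · simp only [mem_coe, mem_filter, mem_univ, true_and] at hu ⊢
      obtain ⟨e1, e2, -⟩ := hX u hu.1
      exact ⟨by omega, fun hc => hc.2 e2⟩
    · simp only [mem_coe, mem_filter, mem_univ, true_and] at hu hv
      obtain ⟨e1, e2, e3⟩ := hX u hu.1
      obtain ⟨e4, e5, -⟩ := hX v hv.1
      refine e3 u rfl (fun h => hu.2 ?_) v ?_ (fun h => hv.2 ?_)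
      · rw [e1, ← h]
      · rw [e1, e4, huv]
      · rw [e4, ← huv, ← h]
  have h2 : #{u | h u ≠ 0} = #{u | Covering h u} + #{u | h u ≠ 0 ∧ ¬ Covering h u} := by
    rw [← card_union_of_disjoint]
    · congr 1; ext u
      simp only [mem_filter, mem_univ, true_and, mem_union]
      have : Covering h u → h u ≠ 0 := fun h => h.1
      tauto
    · rw [disjoint_filter]; exact fun u _ h1 h2 => h2.2 h1
  omega

theorem exists_partner (hI : MatchInv G ok dead h) {u : Fin n} (hu : h u ≠ 0) :
    ∃ v, v ≠ u ∧ G.Adj u v ∧ (ok u v ∨ ok v u) ∧ ∀ w, h w = h u ↔ w = u ∨ w = v := by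
  obtain ⟨x, p, h1, h2, h3, h4, h5, h6⟩ := hI.pair u hu
  rcases (h6 u).1 rfl with rfl | rfl
  · exact ⟨p, h3.symm, h4, .inl h5, h6⟩
  · exact ⟨x, h3, h4.symm, .inr h5, fun w => (h6 w).trans or_comm⟩

theorem le_of_ne_zero (hI : MatchInv G ok dead h) (u : Fin n) : h u ≤ n := by
  by_cases hu : h u = 0
  · omega
  · obtain ⟨x, -, h1, -⟩ := hI.pair u hu
    have := x.2
    omega

end MatchInv

/-- State of the decomposition into pieces along a leaf elimination; `pc` maps every vertex to
the top vertex of its piece. -/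
structure PieceInv (G : SimpleGraph (Fin n)) (s : ℕ) (dead : Fin n → Prop)
    (pc : Fin n → Fin n) : Prop where
  alive : ∀ u, ¬ dead u → pc u = u
  card_lt : ∀ y, #{w | pc w = y} < 2 * s
  edge : ∀ u v, G.Adj u v → dead u → pc u = pc v ∨ s ≤ #{w | pc w = u} ∨ s ≤ #{w | pc w = v}

namespace PieceInv

variable {s : ℕ} {dead : Fin n → Prop} {pc : Fin n → Fin n}

theorem init (hs : 0 < s) (hd : ∀ u, ¬ dead u) (hpc : ∀ u, pc u = u) :
    PieceInv G s dead pc where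
  alive u _ := hpc u
  card_lt y := by
    have : ({w | pc w = y} : Finset (Fin n)) = {y} := by ext w; simp [hpc]
    rw [this, card_singleton]; omega
  edge u _ _ hu := absurd hu (hd u)

theorem congr {dead' : Fin n → Prop} {pc' : Fin n → Fin n} (hI : PieceInv G s dead pc)
    (hd : ∀ u, dead' u ↔ dead u) (hh : ∀ u, pc' u = pc u) : PieceInv G s dead' pc' := by
  obtain rfl : dead' = dead := funext fun u => propext (hd u)
  obtain rfl : pc' = pc := funext hh
  exact hI

/-- If `x` and its live neighbour are not merged, one of them tops a piece of at least `s` vertices,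
which is what `edge` permits. -/
theorem skip (hI : PieceInv G s dead pc) {x : Fin n}
    (hp : ∀ p, ¬ dead p → G.Adj x p → s ≤ #{w | pc w = x} ∨ s ≤ #{w | pc w = p}) :
    PieceInv G s (fun u => dead u ∨ u = x) pc where
  alive u hu := hI.alive u fun h => hu (.inl h)
  card_lt := hI.card_lt
  edge u v huv hdu := by
    by_cases hu : dead u
    · exact hI.edge u v huv hu
    obtain rfl : u = x := hdu.resolve_left hu
    by_cases hv : dead v
    · have := hI.edge v u huv.symm hv
      tauto
    · exact .inr (hp v hv huv)

/-- Two pieces of fewer than `s` vertices merge into one of fewer than `2 * s`. Heavy tops stay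
heavy, because only the light piece topped by `x` is dissolved. -/
theorem join (hI : PieceInv G s dead pc) {x p : Fin n}
    (hx : ¬ dead x) (hdp : ¬ dead p) (hadj : G.Adj x p)
    (hsx : #{w | pc w = x} < s) (hsp : #{w | pc w = p} < s)
    (huniq : ∀ w, ¬ dead w → G.Adj x w → w = p) :
    PieceInv G s (fun u => dead u ∨ u = x) (fun u => if pc u = x then p else pc u) := by
  have hne : p ≠ x := hadj.ne'
  have e1 : ∀ y, y ≠ x → #{w | pc w = y} ≤ #{w | (if pc w = x then p else pc w) = y} := by
    intro y hy
    refine card_le_card fun w hw => ?_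
    simp only [mem_filter, mem_univ, true_and] at hw ⊢
    rw [hw, if_neg hy]
  have hpcx := hI.alive x hx
  have hpcp := hI.alive p hdp
  refine ⟨fun u hu => ?_, fun y => ?_, fun u v huv hdu => ?_⟩
  · have h1 := hI.alive u fun h => hu (.inl h)
    rw [h1, if_neg fun h => hu (.inr h)]
  · by_cases hy : y = p
    · subst hy
      have : ({w | (if pc w = x then y else pc w) = y} : Finset (Fin n)) ⊆
          ({w | pc w = x} : Finset (Fin n)) ∪ ({w | pc w = y} : Finset (Fin n)) := by
        intro w hw
        simp only [mem_filter, mem_univ, true_and, mem_union] at hw ⊢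
        split_ifs at hw with h
        · exact .inl h
        · exact .inr hw
      have := (card_le_card this).trans (card_union_le _ _)
      omega
    · refine lt_of_le_of_lt (card_le_card fun w hw => ?_) (hI.card_lt y)
      simp only [mem_filter, mem_univ, true_and] at hw ⊢
      split_ifs at hw with h
      · exact absurd hw.symm hy
      · exact hw
  · have key : ∀ a b, (pc a = pc b ∨ s ≤ #{w | pc w = a} ∨ s ≤ #{w | pc w = b}) →
        ((if pc a = x then p else pc a) = (if pc b = x then p else pc b) ∨
          s ≤ #{w | (if pc w = x then p else pc w) = a} ∨
          s ≤ #{w | (if pc w = x then p else pc w) = b}) := by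
      have e2 : ∀ y, s ≤ #{w | pc w = y} → s ≤ #{w | (if pc w = x then p else pc w) = y} := by
        intro y hy
        refine hy.trans (e1 y ?_)
        rintro rfl
        omega
      rintro a b (h | h | h)
      · left; rw [h]
      · exact .inr (.inl (e2 a h))
      · exact .inr (.inr (e2 b h))
    by_cases hu : dead u
    · exact key _ _ (hI.edge u v huv hu)
    obtain rfl : u = x := hdu.resolve_left hu
    by_cases hv : dead v
    · refine key _ _ ?_
      have := hI.edge v u huv.symm hv
      tauto
    · obtain rfl := huniq v hv huv
      left
      rw [hpcx, hpcp, if_pos rfl, if_neg hne]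

/-- Few edges inside clusters of size `d` join different pieces. -/
theorem sameArcs_le [DecidableRel G.Adj] {ι : Type*} [DecidableEq ι] {Q : Fin n → ι} {d : ℕ}
    (hI : PieceInv G s dead pc) (hdead : ∀ u, dead u)
    (hQ : ∀ i ∈ univ.image Q, #(cls Q i) = d) :
    s * sameArcs G Q ≤
      s * #{p : Fin n × Fin n | G.Adj p.1 p.2 ∧ Q p.1 = Q p.2 ∧ pc p.1 = pc p.2} +
        2 * (d - 1) * n := by
  -- There are at most `n / s` tops of heavy pieces, and each has `d - 1` companions in its cluster.
  -- An arc inside a cluster that crosses pieces starts or ends at such a top.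
  let H : Finset (Fin n) := {y | s ≤ #{w | pc w = y}}
  have hH : s * #H ≤ n := by
    calc s * #H = ∑ y ∈ H, s := by rw [sum_const, smul_eq_mul, mul_comm]
      _ ≤ ∑ y ∈ H, #{w | pc w = y} := sum_le_sum fun y hy => (mem_filter.1 hy).2
      _ ≤ ∑ y, #{w | pc w = y} := sum_le_sum_of_subset (subset_univ _)
      _ = n := by
        rw [← card_eq_sum_card_fiberwise (s := univ) (t := univ) (f := pc) (fun _ _ => by simp),
          Finset.card_univ, Fintype.card_fin]
  let L : Finset (Fin n × Fin n) := {p | p.1 ∈ H ∧ Q p.1 = Q p.2 ∧ p.1 ≠ p.2}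
  have hL : #L = #H * (d - 1) := by
    rw [card_eq_sum_card_fiberwise (f := Prod.fst) (t := H) (fun p hp => by
      simp only [mem_coe, L, mem_filter] at hp; exact hp.2.1)]
    refine sum_const_nat fun u hu => ?_
    rw [← hQ (Q u) (mem_image_of_mem _ (mem_univ u)), ← card_erase_of_mem (s := cls Q (Q u))
      (a := u) (by simp)]
    refine card_nbij' (fun p => p.2) (fun v => (u, v)) ?_ ?_ ?_ ?_
    · intro p hp
      simp only [mem_coe, L, mem_filter, mem_univ, true_and, mem_erase, mem_cls] at hp ⊢
      obtain ⟨⟨h1, h2, h3⟩, rfl⟩ := hp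
      exact ⟨h3.symm, h2.symm⟩
    · intro v hv
      simp only [mem_coe, L, mem_filter, mem_univ, true_and, mem_erase, mem_cls] at hv ⊢
      exact ⟨⟨hu, hv.2.symm, hv.1.symm⟩, trivial⟩
    · intro p hp
      simp only [mem_coe, mem_filter] at hp
      exact Prod.ext hp.2.symm rfl
    · intro v _; rfl
  have hmain : sameArcs G Q ≤
      #{p : Fin n × Fin n | G.Adj p.1 p.2 ∧ Q p.1 = Q p.2 ∧ pc p.1 = pc p.2} +
        (#L + #(L.image Prod.swap)) := by
    refine le_trans (card_le_card fun p hp => ?_)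
      ((card_union_le _ _).trans (Nat.add_le_add_left (card_union_le _ _) _))
    simp only [mem_filter, mem_univ, true_and, mem_union, mem_image, L, H] at hp ⊢
    rcases hI.edge p.1 p.2 hp.1 (hdead _) with h | h | h
    · exact .inl ⟨hp.1, hp.2, h⟩
    · exact .inr (.inl ⟨h, hp.2, hp.1.ne⟩)
    · exact .inr (.inr ⟨p.swap, ⟨h, hp.2.symm, hp.1.ne'⟩, by simp⟩)
  have h2 : #(L.image Prod.swap) ≤ #L := card_image_le
  rw [hL] at hmain h2
  generalize #{p : Fin n × Fin n | G.Adj p.1 p.2 ∧ Q p.1 = Q p.2 ∧ pc p.1 = pc p.2} = A at *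
  calc s * sameArcs G Q ≤ s * (A + (#H * (d - 1) + #H * (d - 1))) :=
        Nat.mul_le_mul_left _ (hmain.trans (by omega))
    _ = s * A + 2 * (d - 1) * (s * #H) := by ring
    _ ≤ _ := Nat.add_le_add_left (Nat.mul_le_mul_left _ hH) _

end PieceInv

end Elimination

end FairCC

/-! ### Conditions, bounded arithmetic and loop rules -/

namespace RAM

open Finset

namespace Expr

/-- The expression is a true condition. -/
def Holds (e : Expr) (s : State) : Prop := e.eval s ≠ 0

instance (e : Expr) (s : State) : Decidable (e.Holds s) :=
  inferInstanceAs (Decidable (e.eval s ≠ 0))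

def eqE (e f : Expr) : Expr := ite (add (sub e f) (sub f e)) (lit 0) (lit 1)
def ltE (e f : Expr) : Expr := ite (sub f e) (lit 1) (lit 0)
def notE (e : Expr) : Expr := ite e (lit 0) (lit 1)
def andE (e f : Expr) : Expr := ite e f (lit 0)
def impE (e f : Expr) : Expr := ite e f (lit 1)
def countE (x r : ℕ) (e : Expr) : Expr := sum x r (ite e (lit 1) (lit 0))
def allE (x r : ℕ) (e : Expr) : Expr := notE (countE x r (notE e))

/-- The product of registers `x` and `y`, if `x` is at most register `r`. -/
def mulE (x y r : ℕ) : Expr := sum 99 r (ite (ltE (var 99) (var x)) (var y) (lit 0))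

/-- The quotient of registers `x` and `y`, if it is at most register `r`. -/
def divE (x y r : ℕ) : Expr :=
  countE 98 r (notE (ltE (var x) (add (mulE 98 y r) (var y))))

@[simp] theorem holds_var {x : ℕ} {s : State} : (var x).Holds s ↔ s.reg x ≠ 0 := Iff.rfl
@[simp] theorem holds_get {a : ℕ} {e : Expr} {s : State} :
    (get a e).Holds s ↔ s.arr a (e.eval s) ≠ 0 := Iff.rfl

@[simp] theorem eval_lit {m : ℕ} {s : State} : (lit m).eval s = m := rfl
@[simp] theorem eval_var {x : ℕ} {s : State} : (var x).eval s = s.reg x := rfl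
@[simp] theorem eval_add {e f : Expr} {s : State} : (add e f).eval s = e.eval s + f.eval s := rfl
@[simp] theorem eval_sub {e f : Expr} {s : State} : (sub e f).eval s = e.eval s - f.eval s := rfl
@[simp] theorem eval_get {a : ℕ} {e : Expr} {s : State} :
    (get a e).eval s = s.arr a (e.eval s) := rfl
@[simp] theorem eval_ite {c e f : Expr} {s : State} :
    (ite c e f).eval s = if c.Holds s then e.eval s else f.eval s := rfl
@[simp] theorem eval_sum {x r : ℕ} {e : Expr} {s : State} :
    (sum x r e).eval s = ∑ j ∈ range (s.reg r), e.eval (s.setReg x j) := rfl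

@[simp] theorem holds_eqE {e f : Expr} {s : State} : (eqE e f).Holds s ↔ e.eval s = f.eval s := by
  by_cases h : e.eval s - f.eval s + (f.eval s - e.eval s) ≠ 0
  · have h1 : (eqE e f).eval s = 0 := if_pos h
    rw [Holds, h1]; omega
  · have h1 : (eqE e f).eval s = 1 := if_neg h
    rw [Holds, h1]; omega

@[simp] theorem holds_ltE {e f : Expr} {s : State} : (ltE e f).Holds s ↔ e.eval s < f.eval s := by
  by_cases h : f.eval s - e.eval s ≠ 0
  · have h1 : (ltE e f).eval s = 1 := if_pos h
    rw [Holds, h1]; omega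
  · have h1 : (ltE e f).eval s = 0 := if_neg h
    rw [Holds, h1]; omega

@[simp] theorem holds_notE {e : Expr} {s : State} : (notE e).Holds s ↔ ¬ e.Holds s := by
  simp only [Holds, notE, eval]
  split <;> simp_all

@[simp] theorem holds_andE {e f : Expr} {s : State} :
    (andE e f).Holds s ↔ e.Holds s ∧ f.Holds s := by
  simp only [Holds, andE, eval]
  split <;> simp_all

@[simp] theorem holds_impE {e f : Expr} {s : State} :
    (impE e f).Holds s ↔ (e.Holds s → f.Holds s) := by
  simp only [Holds, impE, eval]
  split <;> simp_all

@[simp] theorem eval_countE {x r : ℕ} {e : Expr} {s : State} :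
    (countE x r e).eval s = #{j ∈ range (s.reg r) | e.Holds (s.setReg x j)} := by
  rw [card_filter]; rfl

@[simp] theorem holds_countE {x r : ℕ} {e : Expr} {s : State} :
    (countE x r e).Holds s ↔ ∃ j < s.reg r, e.Holds (s.setReg x j) := by
  rw [Holds, eval_countE, ← Nat.pos_iff_ne_zero, card_pos]
  simp [Finset.Nonempty]

@[simp] theorem holds_allE {x r : ℕ} {e : Expr} {s : State} :
    (allE x r e).Holds s ↔ ∀ j < s.reg r, e.Holds (s.setReg x j) := by
  simp [allE]

theorem eval_mulE {x y r : ℕ} {s : State} (hx : x ≠ 99) (hy : y ≠ 99) :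
    (mulE x y r).eval s = min (s.reg x) (s.reg r) * s.reg y := by
  simp only [mulE, eval_sum, eval_ite, holds_ltE, eval_var, eval_lit, State.reg_setReg, if_pos,
    if_neg hx, if_neg hy]
  rw [← sum_filter, sum_const, smul_eq_mul]
  congr 1
  rw [← card_range (min _ _)]
  congr 1
  ext j
  simp only [mem_filter, mem_range, lt_min_iff]
  exact and_comm

/-- The quotient is the number of `j` with `(j + 1) * y ≤ x`; below the bound `r` the truncation in
the product is void. -/
theorem eval_divE {x y r : ℕ} {s : State} (hx : x < 98) (hy : y < 98) (hr : r < 98)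
    (hpos : 0 < s.reg y) : (divE x y r).eval s = min (s.reg x / s.reg y) (s.reg r) := by
  have h1 : y ≠ 98 := by omega
  have h2 : y ≠ 99 := by omega
  have h3 : x ≠ 98 := by omega
  have h4 : r ≠ 98 := by omega
  simp only [divE, eval_countE, holds_notE, holds_ltE, eval_add, eval_mulE (by decide : 98 ≠ 99) h2,
    State.reg_setReg, if_pos, if_neg h1, if_neg h3, if_neg h4, eval_var]
  rw [← card_range (min _ _)]
  congr 1
  ext j
  simp only [mem_filter, mem_range, lt_min_iff, not_lt]
  rw [and_comm (a := j < _)]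
  refine and_congr_left fun hj => ?_
  rw [min_eq_left hj.le, ← Nat.succ_le_iff (m := j), Nat.le_div_iff_mul_le hpos, Nat.succ_mul]

end Expr

namespace Cmd

open RAM.Expr

@[simp] theorem run_skip {s : State} : skip.run s = s := rfl
@[simp] theorem run_assign {x : ℕ} {e : Expr} {s : State} :
    (assign x e).run s = s.setReg x (e.eval s) := rfl
@[simp] theorem run_store {a : ℕ} {i e : Expr} {s : State} :
    (store a i e).run s = s.setArr a (i.eval s) (e.eval s) := rfl
@[simp] theorem run_seq {c d : Cmd} {s : State} : (seq c d).run s = d.run (c.run s) := rfl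
@[simp] theorem run_ite {e : Expr} {c d : Cmd} {s : State} :
    (ite e c d).run s = if e.Holds s then c.run s else d.run s := rfl

/-- Invariant rule for loops; what the body does not write may be assumed to be unchanged. -/
theorem run_loop_frame {x r : ℕ} {c : Cmd} {s : State} (Inv : ℕ → State → Prop) (h0 : Inv 0 s)
    (hs : ∀ j < s.reg r, ∀ s', (∀ y, y ∉ (loop x r c).writes → s'.reg y = s.reg y) →
      (∀ a, a ∉ c.stores → s'.arr a = s.arr a) → Inv j s' → Inv (j + 1) (c.run (s'.setReg x j))) :
    Inv (s.reg r) ((loop x r c).run s) := by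
  refine (run_loop (x := x) (r := r) (c := c) (s := s) (fun j s' =>
    (∀ y, y ∉ (loop x r c).writes → s'.reg y = s.reg y) ∧
    (∀ a, a ∉ c.stores → s'.arr a = s.arr a) ∧ Inv j s')
    ⟨fun _ _ => rfl, fun _ _ => rfl, h0⟩ ?_).2.2
  rintro j hj s' ⟨h1, h2, h3⟩
  refine ⟨fun y hy => ?_, fun a ha => ?_, hs j hj s' h1 h2 h3⟩
  · have hy' : y ∉ x :: c.writes := hy
    rw [List.mem_cons, not_or] at hy'
    rw [run_reg _ _ _ hy'.2, State.reg_setReg, if_neg hy'.1, h1 y hy]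
  · rw [run_arr _ _ _ ha, State.arr_setReg, h2 a ha]

/-- A loop that fills an array, where the new value of a cell does not depend on that array. -/
theorem run_fill {x r a : ℕ} {e : Expr} {s : State} (F : ℕ → ℕ)
    (hF : ∀ j < s.reg r, ∀ s', (∀ y, y ≠ x → s'.reg y = s.reg y) → s'.reg x = j →
      (∀ b, b ≠ a → s'.arr b = s.arr b) → e.eval s' = F j) :
    ∀ j < s.reg r, ((loop x r (store a (var x) e)).run s).arr a j = F j := by
  refine run_loop_frame (x := x) (r := r) (s := s)
    (fun m s' => ∀ j < m, s'.arr a j = F j) (fun j hj => absurd hj (Nat.not_lt_zero j)) ?_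
  intro m hm s' h1 h2 h3 j hj
  simp only [run_store, State.arr_setArr, if_true, eval_var, State.reg_setReg, State.arr_setReg,
    Function.update_apply]
  split_ifs with h
  · subst h
    refine hF j hm _ (fun y hy => ?_) (by simp) fun b hb => ?_
    · rw [State.reg_setReg, if_neg hy]; exact h1 y (by simp [writes, hy])
    · exact h2 b (by simp [stores, hb])
  · exact h3 j (by omega)

end Cmd

end RAM

namespace FairCC

open RAM RAM.Expr RAM.Cmd

/-! ### The program -/

/-- Registers: 10 is `g`, 11 is `d`, 12 the number of chunks, 13 the first label for completion, `20
+ i` the iterated powers of two; among these, 21 is the threshold for pieces, 32 the constant `K`,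
35 the base of labels and 37 the number of candidates. Register 44 is the vertex being eliminated,
45 its number of live neighbours and 46 its neighbour; 64 is the chunk, 65 the best value, 66 the
candidate and 71 the label offset. Arrays: 2 output, 4 `cc`, 5 eliminated vertices, 6 tops of
pieces, 7 labels, 8 positions in pieces, 9 chunks of pieces by top, 10 candidate labels. -/
def colE (x : ℕ) : Expr := get 0 (var x)
def adjE (x y : ℕ) : Expr := get 1 (add (mulE x 0 0) (var y))

/-- The number of vertices with the colour of `x`. -/
def colorCountE (x : ℕ) : Expr := countE 97 0 (eqE (colE 97) (colE x))

/-- The number of vertices in piece `x`. -/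
def pieceSizeE (x : ℕ) : Expr := countE 97 0 (eqE (get 6 (var 97)) (var x))

def powCmd (y x : ℕ) : Cmd :=
  seq (assign y (lit 1)) (loop 90 x (assign y (add (var y) (var y))))

/-- Register `20 + i` receives the `i`-fold iterated power of two, starting from `b + 8`. -/
def towerProg : ℕ → Prog
  | 0 => (assign 20 (add (var 3) (lit 8))).comp 100
  | i + 1 => .seq (towerProg i) ((powCmd (21 + i) (20 + i)).comp 100)

/-- The greatest common divisor of the sizes of the colour classes. -/
def gcdCmd : Cmd :=
  loop 40 0 (ite (allE 41 0 (countE 42 0 (eqE (colorCountE 41)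
      (add (sum 43 0 (ite (ltE (var 43) (var 42)) (add (var 40) (lit 1)) (lit 0)))
        (add (var 40) (lit 1))))))
    (assign 10 (add (var 40) (lit 1))) skip)

def paletteCmd : Cmd :=
  seq (loop 40 0 (seq (assign 50 (colorCountE 40)) (store 4 (var 40) (divE 50 10 0))))
    (seq (assign 50 (var 0)) (assign 11 (divE 50 10 0)))

def aliveAdjE (x y : ℕ) : Expr := andE (eqE (get 5 (var y)) (lit 0)) (adjE x y)

/-- The chosen vertex has at most one live neighbour, so the sum of the indices of its live
neighbours is that neighbour. -/
def selectCmd : Cmd :=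
  seq (loop 42 0 (ite (andE (eqE (get 5 (var 42)) (lit 0))
      (ltE (countE 43 0 (aliveAdjE 42 43)) (lit 2))) (assign 44 (var 42)) skip))
    (seq (assign 45 (countE 43 0 (aliveAdjE 44 43)))
      (assign 46 (sum 43 0 (ite (aliveAdjE 44 43) (var 43) (lit 0)))))

/-- Matching is of use only for `d < 3`; edges between equal colours are admitted only for `d = 1`.
For `d ≥ 3` the labels stay zero for the later search. -/
def matchCmd : Cmd :=
  ite (andE (ltE (var 11) (lit 3)) (andE (eqE (get 7 (var 44)) (lit 0))
      (andE (eqE (get 7 (var 46)) (lit 0))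
        (notE (andE (notE (eqE (var 11) (lit 1))) (eqE (colE 44) (colE 46)))))))
    (seq (store 7 (var 44) (add (var 44) (lit 1))) (store 7 (var 46) (add (var 44) (lit 1)))) skip

def mergeCmd : Cmd :=
  ite (andE (ltE (pieceSizeE 44) (var 21)) (ltE (pieceSizeE 46) (var 21)))
    (loop 47 0 (ite (eqE (get 6 (var 47)) (var 44)) (store 6 (var 47) (var 46)) skip)) skip

def eliminateCmd : Cmd :=
  seq (loop 40 0 (store 6 (var 40) (var 40)))
    (loop 41 0 (seq selectCmd (seq (ite (var 45) (seq matchCmd mergeCmd) skip)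
      (store 5 (var 44) (lit 1)))))

/-- Pieces `p` and `q` are isomorphic as coloured graphs with ordered vertices. -/
def sameE (p q : ℕ) : Expr :=
  andE (eqE (pieceSizeE p) (pieceSizeE q))
    (allE 60 0 (allE 61 0 (impE (andE (eqE (get 6 (var 60)) (var p))
        (andE (eqE (get 6 (var 61)) (var q)) (eqE (get 8 (var 60)) (get 8 (var 61)))))
      (andE (eqE (colE 60) (colE 61))
        (allE 62 0 (allE 63 0 (impE (andE (eqE (get 6 (var 62)) (var p))
            (andE (eqE (get 6 (var 63)) (var q)) (eqE (get 8 (var 62)) (get 8 (var 63)))))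
          (eqE (adjE 60 62) (adjE 61 63)))))))))

def dealCmd : Cmd :=
  seq (assign 50 (var 0)) <| seq (assign 12 (add (divE 50 32 0) (lit 1))) <|
  seq (loop 40 0 (store 8 (var 40)
    (countE 41 0 (andE (ltE (var 41) (var 40)) (eqE (get 6 (var 41)) (get 6 (var 40)))))))
  (loop 40 0 (seq (assign 50 (countE 41 0 (andE (ltE (var 41) (var 40)) (sameE 41 40))))
    (seq (assign 51 (divE 50 12 0)) (store 9 (var 40) (sub (var 50) (mulE 51 12 0))))))

/-- Vertex `x` lies in the current chunk. -/
def inChunkE (x : ℕ) : Expr := eqE (get 9 (get 6 (var x))) (var 64)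

/-- The digits of register 66 in base register 35 become labels of the current chunk. -/
def decodeCmd : Cmd :=
  seq (assign 67 (var 66)) (loop 68 0 (ite (inChunkE 68)
    (seq (assign 69 (divE 67 35 37)) (seq (store 10 (var 68) (sub (var 67) (mulE 69 35 37)))
      (assign 67 (var 69)))) skip))

def validE : Expr :=
  allE 60 0 (impE (andE (inChunkE 60) (get 10 (var 60)))
    (allE 61 0 (eqE (countE 62 0 (andE (inChunkE 62)
      (andE (eqE (get 10 (var 62)) (get 10 (var 60))) (eqE (colE 62) (colE 61)))))
        (get 4 (var 61)))))

def valueE : Expr :=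
  sum 60 0 (countE 61 0 (andE (inChunkE 60) (andE (inChunkE 61) (andE (get 10 (var 60))
    (andE (eqE (get 10 (var 60)) (get 10 (var 61))) (adjE 60 61))))))

def recordCmd : Cmd :=
  loop 70 0 (ite (inChunkE 70) (store 7 (var 70)
    (Expr.ite (get 10 (var 70)) (add (var 71) (get 10 (var 70))) (lit 0))) skip)

def searchCmd : Cmd :=
  seq (assign 65 (lit 0)) (loop 66 37 (seq decodeCmd
    (ite (andE validE (ltE (var 65) valueE)) (seq (assign 65 valueE) recordCmd) skip)))

def chunksCmd : Cmd :=
  seq (assign 71 (lit 0)) (loop 64 0 (seq searchCmd (assign 71 (add (var 71) (var 35)))))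

/-- The test `3 ≤ d < 4 b + 3`. -/
def middleE : Expr :=
  andE (ltE (lit 2) (var 11))
    (ltE (var 11) (add (add (add (var 3) (var 3)) (add (var 3) (var 3))) (lit 3)))

def completeCmd : Cmd :=
  seq (assign 13 (add (lit 1) (add (var 0) (sum 40 0 (var 35)))))
    (loop 40 0 (seq (assign 50 (countE 41 0 (andE (notE (get 7 (var 41)))
        (andE (ltE (var 41) (var 40)) (eqE (colE 41) (colE 40))))))
      (seq (assign 51 (get 4 (var 40)))
        (store 2 (var 40) (Expr.ite (get 7 (var 40)) (get 7 (var 40))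
          (add (var 13) (divE 50 51 0)))))))

def mainCmd : Cmd :=
  seq gcdCmd <| seq paletteCmd <| seq eliminateCmd <|
  seq (ite middleE (seq dealCmd chunksCmd) skip) completeCmd

/-- The approximation scheme. -/
def schemeProg : Prog := .seq (towerProg 17) (mainCmd.comp 100)

/-- This and the next two facts are the syntactic hypotheses of `Cmd.exec_comp`: all bounds are `n`
or the constant in register 37, and neither is written. -/
theorem mainCmd_below : mainCmd.Below 100 := by decide

theorem mainCmd_bnds : ∀ r ∈ mainCmd.bnds, r ∉ mainCmd.mods := by decide

theorem mainCmd_bnds_eq : ∀ r ∈ mainCmd.bnds, r = 0 ∨ r = 37 := by decide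

end FairCC

/-! ### The computation of the colour parameters -/

namespace FairCC

open RAM RAM.Expr RAM.Cmd Finset

theorem card_filter_range_eq {n : ℕ} (P : ℕ → Prop) [DecidablePred P] :
    #{j ∈ range n | P j} = #{u : Fin n | P u} := by
  rw [card_filter, card_filter, ← Fin.sum_univ_eq_sum_range (fun j => if P j then 1 else 0)]

theorem sum_range_ite_lt (n a m : ℕ) :
    (∑ i ∈ range n, if i < a then m else 0) = min a n * m := by
  rw [← sum_filter, sum_const, smul_eq_mul]
  congr 1
  rw [← card_range (min _ _)]
  congr 1
  ext j
  simp only [mem_filter, mem_range, lt_min_iff]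
  exact and_comm

@[simp] theorem eval_colE {x : ℕ} {s : State} : (colE x).eval s = s.arr 0 (s.reg x) := rfl

theorem holds_adjE {x y : ℕ} {s : State} (hx : x ≠ 99) :
    (adjE x y).Holds s ↔ s.arr 1 (min (s.reg x) (s.reg 0) * s.reg 0 + s.reg y) ≠ 0 := by
  rw [adjE, holds_get, eval_add, eval_mulE hx (by decide), eval_var]

theorem eval_adjE {x y : ℕ} {s : State} (hx : x ≠ 99) :
    (adjE x y).eval s = s.arr 1 (min (s.reg x) (s.reg 0) * s.reg 0 + s.reg y) := by
  rw [adjE, eval_get, eval_add, eval_mulE hx (by decide), eval_var]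

/-- The state stores the coloured graph. -/
structure Stores {n k : ℕ} (G : SimpleGraph (Fin n)) [DecidableRel G.Adj] (c : Fin n → Fin k)
    (s : State) : Prop where
  reg : s.reg 0 = n
  col : ∀ u : Fin n, s.arr 0 u = c u
  adj : ∀ u v : Fin n, s.arr 1 (u * n + v) = if G.Adj u v then 1 else 0

variable {n k : ℕ} {G : SimpleGraph (Fin n)} [DecidableRel G.Adj] {c : Fin n → Fin k} {s : State}

theorem Stores.congr (h : Stores G c s) {s' : State} (h0 : s'.reg 0 = s.reg 0)
    (h1 : s'.arr 0 = s.arr 0) (h2 : s'.arr 1 = s.arr 1) : Stores G c s' :=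
  ⟨h0.trans h.reg, fun u => by rw [h1, h.col], fun u v => by rw [h2, h.adj]⟩

theorem Stores.run (h : Stores G c s) {d : Cmd} (h0 : 0 ∉ d.writes) (h1 : 0 ∉ d.stores)
    (h2 : 1 ∉ d.stores) : Stores G c (d.run s) :=
  h.congr (run_reg _ _ _ h0) (run_arr _ _ _ h1) (run_arr _ _ _ h2)

theorem Stores.setReg (h : Stores G c s) {x v : ℕ} (hx : 0 ≠ x) : Stores G c (s.setReg x v) :=
  h.congr (by rw [State.reg_setReg, if_neg hx]) rfl rfl

theorem Stores.col_eq_iff (h : Stores G c s) (u v : Fin n) :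
    s.arr 0 u = s.arr 0 v ↔ c u = c v := by
  rw [h.col, h.col, Fin.ext_iff]

theorem Stores.holds_adjE (h : Stores G c s) {x y : ℕ} {u v : Fin n} (hx : s.reg x = u)
    (hy : s.reg y = v) (hx9 : x ≠ 99) : (adjE x y).Holds s ↔ G.Adj u v := by
  rw [FairCC.holds_adjE hx9, hx, hy, h.reg, min_eq_left u.2.le, h.adj]
  split <;> simp_all

theorem Stores.eval_colorCountE (h : Stores G c s) {x : ℕ} {u : Fin n} (hx : s.reg x = u)
    (hx9 : x ≠ 97) : (colorCountE x).eval s = #{v | c v = c u} := by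
  simp only [colorCountE, eval_countE, h.reg, card_filter_range_eq, holds_eqE, eval_colE,
    State.reg_setReg, State.arr_setReg, if_true, if_neg hx9, hx, h.col_eq_iff]

/-- The loop keeps the largest common divisor found. It is a multiple of every common divisor `m`:
the least common multiple with `m` is again a common divisor, hence not larger. -/
theorem gcdCmd_spec (h : Stores G c s) (hn : 0 < n) :
    0 < (gcdCmd.run s).reg 10 ∧ (∀ u, (gcdCmd.run s).reg 10 ∣ #{v | c v = c u}) ∧
      ∀ m, (∀ u, m ∣ #{v | c v = c u}) → m ∣ (gcdCmd.run s).reg 10 := by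
  have key := run_loop_frame (x := 40) (r := 0) (s := s)
    (c := (Cmd.ite (allE 41 0 (countE 42 0 (eqE (colorCountE 41)
      (add (sum 43 0 (ite (ltE (var 43) (var 42)) (add (var 40) (lit 1)) (lit 0)))
        (add (var 40) (lit 1))))))
      (assign 10 (add (var 40) (lit 1))) skip))
    (fun j s' => 0 < j → 0 < s'.reg 10 ∧ (∀ u, s'.reg 10 ∣ #{v | c v = c u}) ∧
      ∀ m ≤ j, (∀ u, m ∣ #{v | c v = c u}) → m ≤ s'.reg 10) (fun h => absurd h (lt_irrefl 0)) ?_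
  · obtain ⟨h1, h2, h3⟩ := key (by rw [h.reg]; exact hn)
    refine ⟨h1, h2, fun m hm => ?_⟩
    have h4 : ∀ u, Nat.lcm m ((gcdCmd.run s).reg 10) ∣ #{v | c v = c u} :=
      fun u => Nat.lcm_dvd (hm u) (h2 u)
    have hpos : 0 < #{v | c v = c ⟨0, hn⟩} := card_pos.2 ⟨⟨0, hn⟩, by simp⟩
    have h5 := h3 _ (by
      rw [h.reg]
      exact (Nat.le_of_dvd hpos (h4 ⟨0, hn⟩)).trans ((card_le_univ _).trans (by simp))) h4
    have h6 : Nat.lcm m ((gcdCmd.run s).reg 10) = (gcdCmd.run s).reg 10 := by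
      refine Nat.le_antisymm h5 (Nat.le_of_dvd ?_ (Nat.dvd_lcm_right _ _))
      exact Nat.pos_of_dvd_of_pos (h4 ⟨0, hn⟩) hpos
    rw [← h6]
    exact Nat.dvd_lcm_left _ _
  · intro j hj s' hr ha hI _
    have hS : Stores G c s' := h.congr (hr 0 (by decide)) (ha 0 (by decide)) (ha 1 (by decide))
    -- The inner sum is the product `t * (j + 1)` by repeated addition; the test asks for a quotient
    -- `t + 1`, which is at least 1 because the class is nonempty.
    have hcond : (allE 41 0 (countE 42 0 (eqE (colorCountE 41)
      (add (sum 43 0 (ite (ltE (var 43) (var 42)) (add (var 40) (lit 1)) (lit 0)))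
        (add (var 40) (lit 1)))))).Holds (s'.setReg 40 j) ↔ ∀ u, (j + 1) ∣ #{v | c v = c u} := by
      simp only [holds_allE, holds_countE, holds_eqE, State.reg_setReg, Nat.reduceEqDiff, if_false,
        hS.reg, eval_add, eval_sum, eval_ite, holds_ltE, eval_var, if_true, eval_lit,
        sum_range_ite_lt, OfNat.zero_ne_ofNat]
      rw [Fin.forall_iff]
      refine forall₂_congr fun a ha => ?_
      have e1 : ∀ t, (colorCountE 41).eval (((s'.setReg 40 j).setReg 41 a).setReg 42 t) =
          #{v | c v = c ⟨a, ha⟩} := fun t =>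
        (((hS.setReg (by decide)).setReg (by decide)).setReg (by decide)).eval_colorCountE
          (u := ⟨a, ha⟩) (by simp) (by decide)
      simp only [e1]
      have hle : #{v | c v = c ⟨a, ha⟩} ≤ n := (card_le_univ _).trans (by simp)
      have hpos : 0 < #{v | c v = c ⟨a, ha⟩} := card_pos.2 ⟨⟨a, ha⟩, by simp⟩
      constructor
      · rintro ⟨t, ht, h⟩
        rw [h, min_eq_left ht.le]
        exact ⟨t + 1, by ring⟩
      · rintro ⟨t, ht⟩
        rw [ht] at hle hpos ⊢
        have h1 : 0 < t := Nat.pos_of_mul_pos_left hpos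
        refine ⟨t - 1, by nlinarith [Nat.sub_add_cancel h1], ?_⟩
        rw [min_eq_left (by nlinarith [Nat.sub_add_cancel h1])]
        obtain ⟨t, rfl⟩ : ∃ t', t = t' + 1 := ⟨t - 1, by omega⟩
        rw [Nat.add_sub_cancel]; ring
    rw [run_ite]
    by_cases hc : ∀ u, (j + 1) ∣ #{v | c v = c u}
    · rw [if_pos (hcond.2 hc)]
      simp only [run_assign, State.reg_setReg, if_true, eval_add, eval_var, eval_lit]
      exact ⟨Nat.succ_pos j, hc, fun m hm _ => hm⟩
    · rw [if_neg fun h => hc (hcond.1 h)]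
      simp only [run_skip, State.reg_setReg, Nat.reduceEqDiff, if_false]
      have hj0 : 0 < j := by
        by_contra h0
        obtain rfl : j = 0 := by omega
        exact hc fun u => one_dvd _
      obtain ⟨h1, h2, h3⟩ := hI hj0
      refine ⟨h1, h2, fun m hm hmd => ?_⟩
      rcases Nat.lt_or_ge m (j + 1) with h4 | h4
      · exact h3 m (by omega) hmd
      · obtain rfl : m = j + 1 := by omega
        exact absurd hmd hc

/-- The parameters computed by the program. -/
theorem paletteCmd_spec (h : Stores G c s) (hg : 0 < s.reg 10)
    (hdvd : ∀ u, s.reg 10 ∣ #{v | c v = c u})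
    (hmax : ∀ m, (∀ u, m ∣ #{v | c v = c u}) → m ∣ s.reg 10) :
    Palette c (fun u : Fin n => (paletteCmd.run s).arr 4 u) (s.reg 10)
      ((paletteCmd.run s).reg 11) := by
  have hle : ∀ m, m / s.reg 10 ≤ m := fun m => Nat.div_le_self _ _
  have key := run_loop_frame (x := 40) (r := 0) (s := s)
    (c := (Cmd.seq (assign 50 (colorCountE 40)) (store 4 (var 40) (divE 50 10 0))))
    (fun j s' => ∀ u : Fin n, u < j → s'.arr 4 u = #{v | c v = c u} / s.reg 10)
    (fun u hu => absurd hu (Nat.not_lt_zero _)) ?_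
  · rw [h.reg] at key
    have e4 : ∀ u : Fin n, (paletteCmd.run s).arr 4 u = #{v | c v = c u} / s.reg 10 := by
      intro u
      rw [← key u u.2]
      rfl
    refine ⟨hg, fun u => ?_, ?_, hmax⟩
    · rw [e4, Nat.div_mul_cancel (hdvd u)]
    · have hn : s.reg 10 ∣ n := by
        have e := card_eq_sum_card_fiberwise (f := c) (s := (univ : Finset (Fin n)))
          (t := univ.image c) (fun p _ => by simp)
        rw [Finset.card_univ, Fintype.card_fin] at e
        rw [e]
        refine dvd_sum fun i hi => ?_
        obtain ⟨u, _, rfl⟩ := mem_image.1 hi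
        exact hdvd u
      rw [Fintype.card_fin, paletteCmd, run_seq, run_seq, run_assign, run_assign,
        State.reg_setReg, if_pos rfl, eval_divE (by decide) (by decide) (by decide)]
      · simp only [State.reg_setReg, Nat.reduceEqDiff, if_false, if_true, eval_var,
          OfNat.zero_ne_ofNat]
        rw [run_reg _ _ 0 (by decide), run_reg _ _ 10 (by decide), h.reg, min_eq_left (hle n),
          Nat.div_mul_cancel hn]
      · rw [State.reg_setReg, if_neg (by decide), run_reg _ _ 10 (by decide)]; exact hg
  · intro j hj s' hr ha hI u hu
    rw [h.reg] at hj
    have hS : Stores G c s' := h.congr (hr 0 (by decide)) (ha 0 (by decide)) (ha 1 (by decide))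
    simp only [run_seq, run_assign, run_store, State.arr_setArr, if_true, eval_var,
      State.reg_setReg, State.arr_setReg, Function.update_apply, Nat.reduceEqDiff, if_false]
    split_ifs with huj
    · rw [eval_divE (by decide) (by decide) (by decide)]
      · have e1 := (hS.setReg (x := 40) (v := j) (by decide)).eval_colorCountE (x := 40) (u := u)
          (by simp [huj]) (by decide)
        simp only [State.reg_setReg, Nat.reduceEqDiff, if_false, if_true, e1, OfNat.zero_ne_ofNat]
        rw [hr 0 (by decide), hr 10 (by decide), h.reg, min_eq_left]
        exact (hle _).trans ((card_le_univ _).trans (by simp))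
      · simp only [State.reg_setReg, Nat.reduceEqDiff, if_false]
        rw [hr 10 (by decide)]; exact hg
    · exact hI u (by omega)

end FairCC

/-! ### Correctness of the leaf elimination -/

namespace FairCC

open RAM RAM.Expr RAM.Cmd Finset

variable {n k : ℕ} {G : SimpleGraph (Fin n)} [DecidableRel G.Adj] {c : Fin n → Fin k} {s : State}

theorem Stores.holds_aliveAdjE (h : Stores G c s) {x y : ℕ} {u v : Fin n} (hx : s.reg x = u)
    (hy : s.reg y = v) (hx9 : x ≠ 99) :
    (aliveAdjE x y).Holds s ↔ s.arr 5 v = 0 ∧ G.Adj u v := by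
  rw [aliveAdjE, holds_andE, h.holds_adjE hx hy hx9, holds_eqE, eval_get, eval_var, hy, eval_lit]

theorem Stores.eval_count_aliveAdjE (h : Stores G c s) {x : ℕ} {u : Fin n} (hx : s.reg x = u)
    (hx9 : x ≠ 99) (hx43 : x ≠ 43) :
    (countE 43 0 (aliveAdjE x 43)).eval s = #{v : Fin n | s.arr 5 v = 0 ∧ G.Adj u v} := by
  rw [eval_countE, h.reg, card_filter_range_eq]
  congr 1
  ext v
  rw [mem_filter, mem_filter, (h.setReg (x := 43) (v := v) (by decide)).holds_aliveAdjE (u := u)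
    (v := v) (by rw [State.reg_setReg, if_neg hx43, hx]) (by simp) hx9]
  rfl

theorem Stores.eval_pieceSizeE (h : Stores G c s) {x : ℕ} {y : Fin n} (hx : s.reg x = y)
    (hx9 : x ≠ 97) {pc : Fin n → Fin n} (hpc : ∀ u : Fin n, s.arr 6 u = pc u) :
    (pieceSizeE x).eval s = #{w | pc w = y} := by
  simp only [pieceSizeE, eval_countE, h.reg, card_filter_range_eq, holds_eqE, eval_get, eval_var,
    State.reg_setReg, State.arr_setReg, if_true, if_neg hx9, hx, hpc, Fin.ext_iff]

theorem selectCmd_spec (h : Stores G c s)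
    (hex : ∃ u : Fin n, s.arr 5 u = 0 ∧ #{v : Fin n | s.arr 5 v = 0 ∧ G.Adj u v} ≤ 1) :
    ∃ x : Fin n, (selectCmd.run s).reg 44 = x ∧ s.arr 5 x = 0 ∧
      (((selectCmd.run s).reg 45 = 0 ∧ ∀ w : Fin n, s.arr 5 w = 0 → ¬ G.Adj x w) ∨
      ((selectCmd.run s).reg 45 ≠ 0 ∧ ∃ p : Fin n, (selectCmd.run s).reg 46 = p ∧ s.arr 5 p = 0 ∧
        G.Adj x p ∧ ∀ w : Fin n, s.arr 5 w = 0 → G.Adj x w → w = p)) := by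
  have key := run_loop_frame (x := 42) (r := 0) (s := s)
    (c := (Cmd.ite (andE (eqE (get 5 (var 42)) (lit 0))
      (ltE (countE 43 0 (aliveAdjE 42 43)) (lit 2))) (assign 44 (var 42)) skip))
    (fun j s' => (∃ u : Fin n, u < j ∧ s.arr 5 u = 0 ∧
      #{v : Fin n | s.arr 5 v = 0 ∧ G.Adj u v} ≤ 1) → ∃ x : Fin n, s'.reg 44 = x ∧
      s.arr 5 x = 0 ∧ #{v : Fin n | s.arr 5 v = 0 ∧ G.Adj x v} ≤ 1)
    (fun ⟨u, hu, _⟩ => absurd hu (Nat.not_lt_zero _)) ?_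
  · obtain ⟨u, hu⟩ := hex
    obtain ⟨x, hx, hx0, hx1⟩ := key ⟨u, by rw [h.reg]; exact u.2, hu⟩
    refine ⟨x, hx, hx0, ?_⟩
    rw [selectCmd, run_seq]
    generalize hs₁ : (Cmd.loop 42 0 (Cmd.ite (andE (eqE (get 5 (var 42)) (lit 0))
      (ltE (countE 43 0 (aliveAdjE 42 43)) (lit 2))) (assign 44 (var 42)) skip)).run s = s₁ at *
    have hS : Stores G c s₁ := by
      rw [← hs₁]; exact h.run (by decide) (by decide) (by decide)
    have h5 : s₁.arr 5 = s.arr 5 := by rw [← hs₁]; exact run_arr _ _ _ (by decide)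
    have e45 : (countE 43 0 (aliveAdjE 44 43)).eval s₁ =
        #{v : Fin n | s.arr 5 v = 0 ∧ G.Adj x v} := by
      rw [hS.eval_count_aliveAdjE hx (by decide) (by decide), h5]
    simp only [run_seq, run_assign, State.reg_setReg, Nat.reduceEqDiff, if_false, if_true, e45]
    rcases Nat.eq_zero_or_pos #{v : Fin n | s.arr 5 v = 0 ∧ G.Adj x v} with h0 | h0
    · left
      refine ⟨h0, fun w hw hadj => ?_⟩
      rw [card_eq_zero, filter_eq_empty_iff] at h0
      exact h0 (mem_univ w) ⟨hw, hadj⟩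
    · right
      obtain ⟨p, hp⟩ := card_eq_one.1 (le_antisymm hx1 h0)
      have hmem : ∀ w : Fin n, (s.arr 5 w = 0 ∧ G.Adj x w) ↔ w = p := fun w => by
        simpa using Finset.ext_iff.1 hp w
      refine ⟨h0.ne', p, ?_, ((hmem p).2 rfl).1, ((hmem p).2 rfl).2,
        fun w h1 h2 => (hmem w).1 ⟨h1, h2⟩⟩
      simp only [eval_sum, State.reg_setReg, OfNat.zero_ne_ofNat, if_false, hS.reg]
      rw [← Fin.sum_univ_eq_sum_range (fun j => ((aliveAdjE 44 43).ite (var 43) (lit 0)).eval _),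
        sum_eq_single p]
      · rw [eval_ite, if_pos]
        · simp
        · rw [((hS.setReg (by decide)).setReg (by decide)).holds_aliveAdjE (u := x) (v := p)
            (by simp [hx]) (by simp) (by decide)]
          simp only [State.arr_setReg, h5]
          exact (hmem p).2 rfl
      · intro w _ hw
        rw [eval_ite, if_neg]
        · simp
        · rw [((hS.setReg (by decide)).setReg (by decide)).holds_aliveAdjE (u := x) (v := w)
            (by simp [hx]) (by simp) (by decide)]
          simp only [State.arr_setReg, h5]
          exact fun h => hw ((hmem w).1 h)
      · exact fun h => absurd (mem_univ p) h
  · intro j hj s' hr ha hI hu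
    rw [h.reg] at hj
    have hS : Stores G c s' := h.congr (hr 0 (by decide)) (ha 0 (by decide)) (ha 1 (by decide))
    have hcond : (andE (eqE (get 5 (var 42)) (lit 0))
        (ltE (countE 43 0 (aliveAdjE 42 43)) (lit 2))).Holds (s'.setReg 42 j) ↔
        s.arr 5 j = 0 ∧ #{v : Fin n | s.arr 5 v = 0 ∧ G.Adj ⟨j, hj⟩ v} ≤ 1 := by
      rw [holds_andE, holds_ltE, (hS.setReg (by decide)).eval_count_aliveAdjE (u := ⟨j, hj⟩)
        (by simp) (by decide) (by decide)]
      simp only [holds_eqE, eval_get, State.arr_setReg, eval_var, State.reg_setReg, if_true,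
        eval_lit, ha 5 (by decide), Nat.lt_succ_iff]
    rw [run_ite]
    split_ifs with hc
    · exact ⟨⟨j, hj⟩, by simp, hcond.1 hc⟩
    · obtain ⟨u, hu1, hu2⟩ := hu
      have hne : u.val ≠ j := by
        intro he
        obtain rfl : u = ⟨j, hj⟩ := Fin.ext he
        exact hc (hcond.2 hu2)
      obtain ⟨x, hx⟩ := hI ⟨u, by omega, hu2⟩
      exact ⟨x, by simpa using hx⟩

theorem mergeCmd_spec (h : Stores G c s) {x p : Fin n} (hx : s.reg 44 = x) (hp : s.reg 46 = p)
    {pc : Fin n → Fin n} (hpc : ∀ u : Fin n, s.arr 6 u = pc u) (u : Fin n) :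
    (mergeCmd.run s).arr 6 u =
      if #{w | pc w = x} < s.reg 21 ∧ #{w | pc w = p} < s.reg 21 then
        (if pc u = x then p else pc u : Fin n) else pc u := by
  have hcond : (andE (ltE (pieceSizeE 44) (var 21)) (ltE (pieceSizeE 46) (var 21))).Holds s ↔
      #{w | pc w = x} < s.reg 21 ∧ #{w | pc w = p} < s.reg 21 := by
    rw [holds_andE, holds_ltE, holds_ltE, h.eval_pieceSizeE hx (by decide) hpc,
      h.eval_pieceSizeE hp (by decide) hpc, eval_var]
  rw [mergeCmd, run_ite]
  by_cases hc : #{w | pc w = x} < s.reg 21 ∧ #{w | pc w = p} < s.reg 21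
  · rw [if_pos (hcond.2 hc), if_pos hc]
    have key := run_loop_frame (x := 47) (r := 0) (s := s)
      (c := (Cmd.ite (eqE (get 6 (var 47)) (var 44)) (store 6 (var 47) (var 46)) skip))
      -- Round `j` changes cell `j` only, so the test always reads the old top.
      (fun j s' => ∀ u : Fin n, s'.arr 6 u = if u < j ∧ pc u = x then p else pc u)
      (fun u => by simp [hpc]) ?_
    · rw [key u, h.reg]
      by_cases hu : pc u = x <;> simp [hu]
    · intro j hj s' hr ha hI u
      rw [h.reg] at hj
      have hj6 := hI ⟨j, hj⟩
      simp only [lt_irrefl, false_and, if_false] at hj6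
      simp only [run_ite, holds_eqE, eval_get, eval_var, State.reg_setReg, if_true,
        State.arr_setReg, Nat.reduceEqDiff, if_false, hr 44 (by decide), hx, hj6, run_store,
        hr 46 (by decide), hp, run_skip, ← Fin.ext_iff]
      by_cases huj : u.val = j
      · obtain rfl : u = ⟨j, hj⟩ := Fin.ext huj
        split_ifs with h1 h2 h2
        · simp [State.arr_setArr]
        · simp_all
        · simp_all
        · simpa using hj6
      · have e1 : u.val < j + 1 ↔ u.val < j := by omega
        simp only [e1]
        rw [← hI u]
        split_ifs with h1
        · simp [State.arr_setArr, huj]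
        · simp
  · rw [if_neg fun h => hc (hcond.1 h), if_neg hc, run_skip, hpc]

/-- The edges along which vertices may be matched. -/
def Matchable (c : Fin n → Fin k) (d : ℕ) (u v : Fin n) : Prop := d = 1 ∨ c u ≠ c v

theorem Matchable.symm {d : ℕ} {u v : Fin n} (h : Matchable c d u v) : Matchable c d v u :=
  h.imp_right Ne.symm

theorem matchCmd_spec (h : Stores G c s) {x p : Fin n} (hx : s.reg 44 = x) (hp : s.reg 46 = p) :
    (s.reg 11 < 3 ∧ s.arr 7 x = 0 ∧ s.arr 7 p = 0 ∧ Matchable c (s.reg 11) x p ∧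
      ∀ u : Fin n, (matchCmd.run s).arr 7 u = if u = x ∨ u = p then x.val + 1 else s.arr 7 u) ∨
    (¬ (s.reg 11 < 3 ∧ s.arr 7 x = 0 ∧ s.arr 7 p = 0 ∧ Matchable c (s.reg 11) x p) ∧
      ∀ u : Fin n, (matchCmd.run s).arr 7 u = s.arr 7 u) := by
  have hcond : (andE (ltE (var 11) (lit 3)) (andE (eqE (get 7 (var 44)) (lit 0))
      (andE (eqE (get 7 (var 46)) (lit 0))
        (notE (andE (notE (eqE (var 11) (lit 1))) (eqE (colE 44) (colE 46))))))).Holds s ↔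
      s.reg 11 < 3 ∧ s.arr 7 x = 0 ∧ s.arr 7 p = 0 ∧ Matchable c (s.reg 11) x p := by
    simp only [holds_andE, holds_ltE, eval_var, eval_lit, holds_eqE, eval_get, hx, hp, holds_notE,
      eval_colE, h.col_eq_iff, Matchable]
    tauto
  rw [matchCmd, run_ite]
  by_cases hc : s.reg 11 < 3 ∧ s.arr 7 x = 0 ∧ s.arr 7 p = 0 ∧ Matchable c (s.reg 11) x p
  · left
    refine ⟨hc.1, hc.2.1, hc.2.2.1, hc.2.2.2, fun u => ?_⟩
    rw [if_pos (hcond.2 hc)]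
    simp only [run_seq, run_store, State.arr_setArr, if_true, eval_var, State.reg_setArr, hx, hp,
      eval_add, eval_lit, Function.update_apply, ← Fin.ext_iff]
    by_cases h1 : u = x <;> by_cases h2 : u = p <;> simp [h1, h2]
  · right
    refine ⟨hc, fun u => ?_⟩
    rw [if_neg fun h => hc (hcond.1 h), run_skip]

/-- Degeneracy, applied to the live vertices, supplies the next vertex. Matching and pieces are
built along the same elimination, so their invariants are carried together. -/
theorem eliminateCmd_spec (h : Stores G c s) (hG : Degenerate G)
    (h5 : ∀ u : Fin n, s.arr 5 u = 0) (h7 : ∀ u : Fin n, s.arr 7 u = 0) (hs : 0 < s.reg 21) :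
    (∃ pc : Fin n → Fin n, (∀ u : Fin n, (eliminateCmd.run s).arr 6 u = pc u) ∧
      PieceInv G (s.reg 21) (fun _ => True) pc) ∧
    (s.reg 11 < 3 → MatchInv G (Matchable c (s.reg 11)) (fun _ => True)
      (fun u : Fin n => (eliminateCmd.run s).arr 7 u)) ∧
    (3 ≤ s.reg 11 → ∀ u : Fin n, (eliminateCmd.run s).arr 7 u = 0) := by
  rw [eliminateCmd, run_seq]
  have hinit := run_fill (x := 40) (r := 0) (a := 6) (e := var 40) (s := s) (fun j => j)
    (fun j _ s' _ hx _ => hx)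
  rw [h.reg] at hinit
  generalize hs₁ : (Cmd.loop 40 0 (store 6 (var 40) (var 40))).run s = s₁ at *
  have hS₁ : Stores G c s₁ := by rw [← hs₁]; exact h.run (by decide) (by decide) (by decide)
  have a5 : s₁.arr 5 = s.arr 5 := by rw [← hs₁]; exact run_arr _ _ _ (by decide)
  have a7 : s₁.arr 7 = s.arr 7 := by rw [← hs₁]; exact run_arr _ _ _ (by decide)
  have r21 : s₁.reg 21 = s.reg 21 := by rw [← hs₁]; exact run_reg _ _ _ (by decide)
  have r11 : s₁.reg 11 = s.reg 11 := by rw [← hs₁]; exact run_reg _ _ _ (by decide)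
  have key := run_loop_frame (x := 41) (r := 0) (s := s₁)
    (c := (Cmd.seq selectCmd (Cmd.seq (Cmd.ite (var 45) (Cmd.seq matchCmd mergeCmd) skip)
      (store 5 (var 44) (lit 1)))))
    -- One vertex dies per round, so none is alive after `n` rounds.
    (fun j s' => #{u : Fin n | s'.arr 5 u = 0} + j = n ∧
      (∃ pc : Fin n → Fin n, (∀ u : Fin n, s'.arr 6 u = pc u) ∧
        PieceInv G (s.reg 21) (fun u => s'.arr 5 u ≠ 0) pc) ∧
      (s.reg 11 < 3 → MatchInv G (Matchable c (s.reg 11)) (fun u => s'.arr 5 u ≠ 0)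
        (fun u : Fin n => s'.arr 7 u)) ∧
      (3 ≤ s.reg 11 → ∀ u : Fin n, s'.arr 7 u = 0)) ?_ ?_
  · obtain ⟨k1, ⟨pc, k2, k3⟩, k4, k5⟩ := key
    rw [hS₁.reg, Nat.add_eq_right, card_eq_zero, filter_eq_empty_iff] at k1
    refine ⟨⟨pc, k2, k3.congr (fun u => ?_) fun _ => rfl⟩,
      fun hd => (k4 hd).congr (fun u => ?_) fun _ => rfl, k5⟩
    · simpa using k1 (mem_univ u)
    · simpa using k1 (mem_univ u)
  · refine ⟨by simp [a5, h5], ⟨id, fun u => hinit u u.2, PieceInv.init hs (fun u => ?_)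
      fun _ => rfl⟩, fun _ => MatchInv.init (fun u => ?_) fun u => ?_, fun _ u => ?_⟩
    · simp [a5, h5]
    · simp [a5, h5]
    · simp [a7, h7]
    · simp [a7, h7]
  · rintro j hj s' hr ha ⟨i1, ⟨pc, i2, i3⟩, i4, i5⟩
    rw [hS₁.reg] at hj
    have hS : Stores G c (s'.setReg 41 j) :=
      (hS₁.congr (hr 0 (by decide)) (ha 0 (by decide)) (ha 1 (by decide))).setReg (by decide)
    have hex : ∃ u : Fin n, (s'.setReg 41 j).arr 5 u = 0 ∧
        #{v : Fin n | (s'.setReg 41 j).arr 5 v = 0 ∧ G.Adj u v} ≤ 1 := by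
      obtain ⟨v, hv, hv1⟩ := hG {u : Fin n | s'.arr 5 u = 0} (card_pos.1 (by omega))
      rw [filter_filter] at hv1
      exact ⟨v, by simpa using hv, hv1⟩
    obtain ⟨x, hx, hx5, hcase⟩ := selectCmd_spec hS hex
    rw [State.arr_setReg] at hx5
    rw [run_seq, run_seq]
    generalize hs₂ : selectCmd.run (s'.setReg 41 j) = s₂ at *
    have hS₂ : Stores G c s₂ := by rw [← hs₂]; exact hS.run (by decide) (by decide) (by decide)
    have b5 : s₂.arr 5 = s'.arr 5 := by rw [← hs₂]; exact run_arr _ _ _ (by decide)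
    have b6 : s₂.arr 6 = s'.arr 6 := by rw [← hs₂]; exact run_arr _ _ _ (by decide)
    have b7 : s₂.arr 7 = s'.arr 7 := by rw [← hs₂]; exact run_arr _ _ _ (by decide)
    have c21 : s₂.reg 21 = s.reg 21 := by
      rw [← hs₂, run_reg _ _ _ (by decide), State.reg_setReg, if_neg (by decide),
        hr 21 (by decide), r21]
    have c11 : s₂.reg 11 = s.reg 11 := by
      rw [← hs₂, run_reg _ _ _ (by decide), State.reg_setReg, if_neg (by decide),
        hr 11 (by decide), r11]
    generalize hs₃ : (Cmd.ite (var 45) (Cmd.seq matchCmd mergeCmd) skip).run s₂ = s₃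
    have d5 : s₃.arr 5 = s'.arr 5 := by rw [← hs₃, ← b5]; exact run_arr _ _ _ (by decide)
    have d44 : s₃.reg 44 = x := by rw [← hs₃, ← hx]; exact run_reg _ _ _ (by decide)
    have f5 : ∀ u : Fin n, ((store 5 (var 44) (lit 1)).run s₃).arr 5 u =
        if u = x then 1 else s'.arr 5 u := by
      intro u
      simp only [run_store, State.arr_setArr, if_true, eval_var, d44, eval_lit,
        Function.update_apply, d5, ← Fin.ext_iff]
    have f6 : ((store 5 (var 44) (lit 1)).run s₃).arr 6 = s₃.arr 6 := run_arr _ _ _ (by decide)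
    have f7 : ((store 5 (var 44) (lit 1)).run s₃).arr 7 = s₃.arr 7 := run_arr _ _ _ (by decide)
    generalize (store 5 (var 44) (lit 1)).run s₃ = s₄ at *
    have hdead : ∀ u : Fin n, s₄.arr 5 u ≠ 0 ↔ (s'.arr 5 u ≠ 0 ∨ u = x) := by
      intro u
      rw [f5 u]
      by_cases hu : u = x <;> simp [hu]
    have hcard : #{u : Fin n | s₄.arr 5 u = 0} + (j + 1) = n := by
      have e1 : ({u : Fin n | s₄.arr 5 u = 0} : Finset (Fin n)) =
          ({u : Fin n | s'.arr 5 u = 0} : Finset (Fin n)).erase x := by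
        ext u
        have := hdead u
        simp only [mem_filter, mem_univ, true_and, mem_erase]
        tauto
      have hmem : x ∈ ({u : Fin n | s'.arr 5 u = 0} : Finset (Fin n)) := by simp [hx5]
      rw [e1, card_erase_of_mem hmem]
      have := card_pos.2 ⟨x, hmem⟩
      omega
    have hxd : ¬ s'.arr 5 x ≠ 0 := by simpa using hx5
    simp only [State.arr_setReg] at hcase
    rcases hcase with ⟨h45, hno⟩ | ⟨h45, p, hp, hp5, hadj, huniq⟩
    · have h3 : s₃ = s₂ := by
        rw [← hs₃, run_ite, if_neg (by simpa using h45), run_skip]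
      refine ⟨hcard, ⟨pc, fun u => by rw [f6, h3, b6, i2], ?_⟩, fun hd => ?_, fun hd u => ?_⟩
      · refine (i3.skip (x := x) fun p hp hadj => ?_).congr hdead fun _ => rfl
        exact absurd hadj (hno p (by simpa using hp))
      · refine ((i4 hd).skip (fun _ _ => Matchable.symm) hxd fun p hp hadj _ => ?_).congr hdead
          fun u => by rw [f7, h3, b7]
        exact absurd hadj (hno p (by simpa using hp))
      · rw [f7, h3, b7, i5 hd]
    · have h3 : s₃ = mergeCmd.run (matchCmd.run s₂) := by
        rw [← hs₃, run_ite, if_pos (by simpa using h45), run_seq]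
      have hpd : ¬ s'.arr 5 p ≠ 0 := by simpa using hp5
      have huniq' : ∀ w : Fin n, ¬ s'.arr 5 w ≠ 0 → G.Adj x w → w = p := fun w hw =>
        huniq w (by simpa using hw)
      have hmatch := matchCmd_spec hS₂ hx hp
      have g7 : s₃.arr 7 = (matchCmd.run s₂).arr 7 := by
        rw [h3]; exact run_arr _ _ _ (by decide)
      have hS₃ : Stores G c (matchCmd.run s₂) := hS₂.run (by decide) (by decide) (by decide)
      have hmerge := mergeCmd_spec hS₃ (x := x) (p := p)
        (by rw [run_reg _ _ _ (by decide), hx]) (by rw [run_reg _ _ _ (by decide), hp])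
        (pc := pc) (fun u => by rw [run_arr _ _ _ (by decide), b6, i2])
      rw [← h3, run_reg _ _ 21 (by decide), c21] at hmerge
      rw [c11, b7, ← g7] at hmatch
      refine ⟨hcard, ?_, fun hd => ?_, fun hd u => ?_⟩
      · rw [f6]
        by_cases hc : #{w | pc w = x} < s.reg 21 ∧ #{w | pc w = p} < s.reg 21
        · refine ⟨fun u => if pc u = x then p else pc u, fun u => by rw [hmerge u, if_pos hc], ?_⟩
          exact (i3.join hxd hpd hadj hc.1 hc.2 huniq').congr hdead fun _ => rfl
        · refine ⟨pc, fun u => by rw [hmerge u, if_neg hc], ?_⟩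
          refine (i3.skip (x := x) fun q hq hadjq => ?_).congr hdead fun _ => rfl
          rw [huniq' q hq hadjq]
          by_contra! hcc
          exact hc hcc
      · rcases hmatch with ⟨-, m1, m2, m3, m4⟩ | ⟨m1, m2⟩
        · exact ((i4 hd).join (fun _ _ => Matchable.symm) hxd hpd hadj m3 m1 m2 huniq').congr
            hdead fun u => by rw [f7, m4]
        · refine ((i4 hd).skip (fun _ _ => Matchable.symm) hxd fun q hq hadjq hok => ?_).congr
            hdead fun u => by rw [f7, m2]
          obtain rfl := huniq' q hq hadjq
          by_contra! hcc
          exact m1 ⟨hd, hcc.1, hcc.2, hok⟩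
      · rcases hmatch with ⟨m0, -⟩ | ⟨-, m2⟩
        · omega
        · rw [f7, m2, i5 hd]

end FairCC

/-! ### Types of pieces and the dealing to chunks -/

namespace FairCC

open RAM RAM.Expr RAM.Cmd Finset

theorem forall_lt_iff_fin {n : ℕ} (P : ℕ → Prop) : (∀ j < n, P j) ↔ ∀ u : Fin n, P u :=
  ⟨fun h u => h u u.2, fun h j hj => h ⟨j, hj⟩⟩

variable {n k : ℕ} {G : SimpleGraph (Fin n)} [DecidableRel G.Adj] {c : Fin n → Fin k} {s : State}

/-- The position of a vertex in its piece. -/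
def pieceRank (pc : Fin n → Fin n) (u : Fin n) : ℕ := #{v | v < u ∧ pc v = pc u}

theorem pieceRank_eq (pc : Fin n → Fin n) (u : Fin n) :
    pieceRank pc u = #{v ∈ ({v | pc v = pc u} : Finset (Fin n)) | v.val < u.val} := by
  rw [pieceRank, filter_filter]
  congr 1
  ext v
  simp only [mem_filter, mem_univ, true_and, Fin.lt_def, and_comm]

theorem pieceRank_inj {pc : Fin n → Fin n} {u v : Fin n} (h : pc u = pc v)
    (hr : pieceRank pc u = pieceRank pc v) : u = v := by
  refine rank_injOn {v | pc v = pc u} Fin.val Fin.val_injective.injOn (by simp) (by simp [h]) ?_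
  simp only []
  rw [← pieceRank_eq, hr, pieceRank_eq, h]

theorem exists_pieceRank_iff (pc : Fin n → Fin n) (y : Fin n) (r : ℕ) :
    (∃ u, pc u = y ∧ pieceRank pc u = r) ↔ r < #{u | pc u = y} := by
  have h := image_rank {v | pc v = y} Fin.val Fin.val_injective.injOn
  rw [← mem_range, ← h, mem_image]
  constructor
  · rintro ⟨u, rfl, rfl⟩
    exact ⟨u, by simp, (pieceRank_eq _ _).symm⟩
  · rintro ⟨u, hu, rfl⟩
    obtain rfl : pc u = y := by simpa using hu
    exact ⟨u, rfl, pieceRank_eq _ _⟩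

theorem pieceRank_lt {pc : Fin n → Fin n} {w : ℕ} (hw : ∀ y, #{u | pc u = y} < w) (u : Fin n) :
    pieceRank pc u < w :=
  ((exists_pieceRank_iff pc (pc u) _).1 ⟨u, rfl, rfl⟩).trans (hw _)

/-- Two pieces are isomorphic as coloured graphs with ordered vertices. -/
def SamePiece (G : SimpleGraph (Fin n)) (c : Fin n → Fin k) (pc : Fin n → Fin n)
    (p q : Fin n) : Prop :=
  #{u | pc u = p} = #{u | pc u = q} ∧
    ∀ u u', pc u = p → pc u' = q → pieceRank pc u = pieceRank pc u' → c u = c u' ∧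
      ∀ v v', pc v = p → pc v' = q → pieceRank pc v = pieceRank pc v' →
        (G.Adj u v ↔ G.Adj u' v')

/-- The type of a piece of fewer than `w` vertices. -/
abbrev PieceType (c : Fin n → Fin k) (w : ℕ) : Type :=
  Finset (Fin w × univ.image c) × Finset (Fin w × Fin w)

open Classical in
/-- Colours and adjacencies by positions. -/
noncomputable def pieceType (G : SimpleGraph (Fin n)) (c : Fin n → Fin k) (pc : Fin n → Fin n)
    (w : ℕ) (y : Fin n) : PieceType c w :=
  (univ.filter fun a : Fin w × univ.image c => ∃ u, pc u = y ∧ pieceRank pc u = a.1 ∧ c u = a.2,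
    univ.filter fun a : Fin w × Fin w => ∃ u v, pc u = y ∧ pc v = y ∧ pieceRank pc u = a.1 ∧
      pieceRank pc v = a.2 ∧ G.Adj u v)

theorem exists_of_pieceType_eq {pc : Fin n → Fin n} {w : ℕ} (hw : ∀ y, #{u | pc u = y} < w)
    {u y : Fin n} (h : pieceType G c pc w (pc u) = pieceType G c pc w y) :
    ∃ v, pc v = y ∧ pieceRank pc v = pieceRank pc u ∧ c v = c u := by
  have h1 : ((⟨pieceRank pc u, pieceRank_lt hw u⟩, ⟨c u, mem_image_of_mem _ (mem_univ u)⟩) :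
      Fin w × univ.image c) ∈ (pieceType G c pc w (pc u)).1 := by
    simp only [pieceType, mem_filter, mem_univ, true_and]
    exact ⟨u, rfl, rfl, rfl⟩
  rw [h] at h1
  simpa only [pieceType, mem_filter, mem_univ, true_and] using h1

theorem adj_of_pieceType_eq {pc : Fin n → Fin n} {w : ℕ} (hw : ∀ y, #{u | pc u = y} < w)
    {u v u' v' : Fin n} (huv : pc u = pc v) (huv' : pc u' = pc v')
    (h : pieceType G c pc w (pc u) = pieceType G c pc w (pc u'))
    (hu : pieceRank pc u = pieceRank pc u') (hv : pieceRank pc v = pieceRank pc v')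
    (hadj : G.Adj u v) : G.Adj u' v' := by
  have h1 : ((⟨pieceRank pc u, pieceRank_lt hw u⟩, ⟨pieceRank pc v, pieceRank_lt hw v⟩) :
      Fin w × Fin w) ∈ (pieceType G c pc w (pc u)).2 := by
    simp only [pieceType, mem_filter, mem_univ, true_and]
    exact ⟨u, v, rfl, huv.symm, rfl, rfl, hadj⟩
  rw [h] at h1
  simp only [pieceType, mem_filter, mem_univ, true_and] at h1
  obtain ⟨a, b, ha, hb, ha', hb', hab⟩ := h1
  rw [← pieceRank_inj ha (ha'.trans hu), ← pieceRank_inj (hb.trans huv') (hb'.trans hv)]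
  exact hab

theorem SamePiece.symm {pc : Fin n → Fin n} {p q : Fin n} (h : SamePiece G c pc p q) :
    SamePiece G c pc q p :=
  ⟨h.1.symm, fun u u' hu hu' hr => ⟨((h.2 u' u hu' hu hr.symm).1).symm,
    fun v v' hv hv' hr' => ((h.2 u' u hu' hu hr.symm).2 v' v hv' hv hr'.symm).symm⟩⟩

/-- The program compares pieces by quantifiers, whereas counting needs a finite type of invariants.
Positions in a piece form an initial segment, so equal types force equal sizes. -/
theorem samePiece_iff {pc : Fin n → Fin n} {w : ℕ} (hw : ∀ y, #{u | pc u = y} < w)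
    (p q : Fin n) : SamePiece G c pc p q ↔ pieceType G c pc w p = pieceType G c pc w q := by
  constructor
  · have key : ∀ p q, SamePiece G c pc p q →
        (pieceType G c pc w p).1 ⊆ (pieceType G c pc w q).1 ∧
        (pieceType G c pc w p).2 ⊆ (pieceType G c pc w q).2 := by
      intro p q h
      have hex : ∀ u, pc u = p → ∃ u', pc u' = q ∧ pieceRank pc u' = pieceRank pc u := by
        intro u hu
        rw [exists_pieceRank_iff, ← h.1, ← exists_pieceRank_iff]
        exact ⟨u, hu, rfl⟩
      constructor
      · intro a ha
        simp only [pieceType, mem_filter, mem_univ, true_and] at ha ⊢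
        obtain ⟨u, hu, hur, huc⟩ := ha
        obtain ⟨u', hu', hr⟩ := hex u hu
        exact ⟨u', hu', hr.trans hur, ((h.2 u u' hu hu' hr.symm).1).symm.trans huc⟩
      · intro a ha
        simp only [pieceType, mem_filter, mem_univ, true_and] at ha ⊢
        obtain ⟨u, v, hu, hv, hur, hvr, hadj⟩ := ha
        obtain ⟨u', hu', hr⟩ := hex u hu
        obtain ⟨v', hv', hr'⟩ := hex v hv
        exact ⟨u', v', hu', hv', hr.trans hur, hr'.trans hvr,
          ((h.2 u u' hu hu' hr.symm).2 v v' hv hv' hr'.symm).1 hadj⟩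
    intro h
    exact Prod.ext ((key p q h).1.antisymm (key q p h.symm).1)
      ((key p q h).2.antisymm (key q p h.symm).2)
  · intro h
    have hle : ∀ p q, pieceType G c pc w p = pieceType G c pc w q →
        #{u | pc u = p} ≤ #{u | pc u = q} := by
      intro p q h
      by_contra! hlt
      obtain ⟨u, rfl, hr⟩ := (exists_pieceRank_iff pc p _).2 hlt
      obtain ⟨v, hv, hvr, -⟩ := exists_of_pieceType_eq hw h
      have := (exists_pieceRank_iff pc q _).1 ⟨v, hv, hvr⟩
      omega
    refine ⟨le_antisymm (hle p q h) (hle q p h.symm), ?_⟩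
    rintro u u' rfl rfl hr
    refine ⟨?_, fun v v' hv hv' hr' => ⟨fun hadj => ?_, fun hadj => ?_⟩⟩
    · obtain ⟨v, hv, hvr, hvc⟩ := exists_of_pieceType_eq hw h
      rw [← hvc, pieceRank_inj hv (hvr.trans hr)]
    · exact adj_of_pieceType_eq hw hv.symm hv'.symm h hr hr' hadj
    · exact adj_of_pieceType_eq hw hv'.symm hv.symm h.symm hr.symm hr'.symm hadj

theorem card_range_mod {m N j : ℕ} (hj : j < N) :
    m / N ≤ #{x ∈ range m | x % N = j} ∧ #{x ∈ range m | x % N = j} ≤ m / N + 1 := by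
  have h := Nat.count_modEq_card m (by omega : 0 < N) j
  rw [Nat.count_eq_card_filter_range] at h
  have e : {x ∈ range m | x ≡ j [MOD N]} = {x ∈ range m | x % N = j} := by
    refine filter_congr fun x _ => ?_
    rw [Nat.ModEq, Nat.mod_eq_of_lt hj]
  rw [e] at h
  rw [h]
  split <;> omega

/-- Dealing the elements of each type round robin. -/
theorem card_deal {T : Type*} [DecidableEq T] (τ : Fin n → T) {N j : ℕ} (hj : j < N) (t : T) :
    #{y | τ y = t} / N ≤ #{y | τ y = t ∧ #{z | z < y ∧ τ z = τ y} % N = j} ∧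
    #{y | τ y = t ∧ #{z | z < y ∧ τ z = τ y} % N = j} ≤ #{y | τ y = t} / N + 1 := by
  have e : #{y | τ y = t ∧ #{z | z < y ∧ τ z = τ y} % N = j} =
      #{x ∈ range #{y | τ y = t} | x % N = j} := by
    have hinj := rank_injOn {y | τ y = t} Fin.val Fin.val_injective.injOn
    rw [← image_rank {y | τ y = t} Fin.val Fin.val_injective.injOn, filter_image,
      card_image_of_injOn (hinj.mono (coe_subset.2 (filter_subset _ _))), filter_filter]
    congr 1
    ext y
    simp only [mem_filter, mem_univ, true_and]
    refine and_congr_right ?_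
    rintro rfl
    rw [filter_filter]
    simp only [Fin.lt_def, and_comm]
  rw [e]
  exact card_range_mod hj

theorem Stores.eval_adjE (h : Stores G c s) {x y : ℕ} {u v : Fin n} (hx : s.reg x = u)
    (hy : s.reg y = v) (hx9 : x ≠ 99) : (adjE x y).eval s = if G.Adj u v then 1 else 0 := by
  rw [FairCC.eval_adjE hx9, hx, hy, h.reg, min_eq_left u.2.le, h.adj]

theorem Stores.holds_sameE (h : Stores G c s) {p q : Fin n} (hp : s.reg 41 = p) (hq : s.reg 40 = q)
    {pc : Fin n → Fin n} (hpc : ∀ u : Fin n, s.arr 6 u = pc u)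
    (hrk : ∀ u : Fin n, s.arr 8 u = pieceRank pc u) :
    (sameE 41 40).Holds s ↔ SamePiece G c pc p q := by
  have hadj : ∀ u u' v v' : Fin n,
      (eqE (adjE 60 62) (adjE 61 63)).Holds
        ((((s.setReg 60 u).setReg 61 u').setReg 62 v).setReg 63 v') ↔
      (G.Adj u v ↔ G.Adj u' v') := by
    intro u u' v v'
    have hS : Stores G c ((((s.setReg 60 u).setReg 61 u').setReg 62 v).setReg 63 v') :=
      (((h.setReg (by decide)).setReg (by decide)).setReg (by decide)).setReg (by decide)
    rw [holds_eqE, hS.eval_adjE (u := u) (v := v) (by simp) (by simp) (by decide),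
      hS.eval_adjE (u := u') (v := v') (by simp) (by simp) (by decide)]
    by_cases h1 : G.Adj u v <;> by_cases h2 : G.Adj u' v' <;> simp [h1, h2]
  rw [sameE, holds_andE, holds_eqE, h.eval_pieceSizeE hp (by decide) hpc,
    h.eval_pieceSizeE hq (by decide) hpc, SamePiece]
  refine and_congr_right fun _ => ?_
  simp only [holds_allE, holds_impE, holds_andE, State.reg_setReg, OfNat.zero_ne_ofNat, if_false,
    h.reg, forall_lt_iff_fin, hadj]
  simp only [holds_eqE, eval_get, eval_var, State.reg_setReg, State.arr_setReg, Nat.reduceEqDiff,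
    if_false, if_true, eval_colE, h.col_eq_iff, hpc, hrk, hp, hq, ← Fin.ext_iff, and_imp]

open Classical in
theorem dealCmd_spec (h : Stores G c s) (hK : 0 < s.reg 32) {pc : Fin n → Fin n}
    (hpc : ∀ u : Fin n, s.arr 6 u = pc u) (u : Fin n) :
    (dealCmd.run s).arr 9 u = #{z | z < u ∧ SamePiece G c pc z u} % (n / s.reg 32 + 1) := by
  rw [dealCmd, run_seq, run_seq, run_seq, run_assign, run_assign]
  have hdiv : (divE 50 32 0).eval (s.setReg 50 ((var 0).eval s)) = n / s.reg 32 := by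
    rw [eval_divE (by decide) (by decide) (by decide) (by simpa using hK)]
    simp only [eval_var, State.reg_setReg, Nat.reduceEqDiff, if_false, if_true, h.reg,
      OfNat.zero_ne_ofNat]
    exact min_eq_left (Nat.div_le_self _ _)
  generalize hs₁ : (s.setReg 50 ((var 0).eval s)).setReg 12
    ((add (divE 50 32 0) (lit 1)).eval (s.setReg 50 ((var 0).eval s))) = s₁
  have r12 : s₁.reg 12 = n / s.reg 32 + 1 := by
    rw [← hs₁, State.reg_setReg, if_pos rfl, eval_add, eval_lit, hdiv]
  have hS₁ : Stores G c s₁ := by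
    rw [← hs₁]; exact (h.setReg (by decide)).setReg (by decide)
  have a6 : s₁.arr 6 = s.arr 6 := by rw [← hs₁]; rfl
  have h8 := run_fill (x := 40) (r := 0) (a := 8) (e := countE 41 0
    (andE (ltE (var 41) (var 40)) (eqE (get 6 (var 41)) (get 6 (var 40))))) (s := s₁)
    (fun j => #{v : Fin n | v < j ∧ s.arr 6 v = s.arr 6 j}) (by
      intro j hj s' hr hx ha
      rw [eval_countE, hr 0 (by decide), hS₁.reg, card_filter_range_eq]
      simp only [holds_andE, holds_ltE, eval_var, State.reg_setReg, holds_eqE, eval_get, if_true,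
        State.arr_setReg, ha 6 (by decide), a6, hx, Nat.reduceEqDiff, if_false])
  generalize hs₂ : (Cmd.loop 40 0 (store 8 (var 40) (countE 41 0
    (andE (ltE (var 41) (var 40)) (eqE (get 6 (var 41)) (get 6 (var 40))))))).run s₁ = s₂ at *
  have hS₂ : Stores G c s₂ := by rw [← hs₂]; exact hS₁.run (by decide) (by decide) (by decide)
  have b6 : s₂.arr 6 = s.arr 6 := by rw [← a6, ← hs₂]; exact run_arr _ _ _ (by decide)
  have b12 : s₂.reg 12 = n / s.reg 32 + 1 := by rw [← r12, ← hs₂]; exact run_reg _ _ _ (by decide)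
  have b8 : ∀ u : Fin n, s₂.arr 8 u = pieceRank pc u := by
    intro u
    rw [h8 u (by rw [hS₁.reg]; exact u.2), pieceRank]
    simp only [hpc, ← Fin.ext_iff, Fin.lt_def]
  have key := run_loop_frame (x := 40) (r := 0) (s := s₂)
    (c := (Cmd.seq (assign 50 (countE 41 0 (andE (ltE (var 41) (var 40)) (sameE 41 40))))
    (Cmd.seq (assign 51 (divE 50 12 0)) (store 9 (var 40) (sub (var 50) (mulE 51 12 0))))))
    (fun j s' => ∀ u : Fin n, u < j → s'.arr 9 u =
      #{z | z < u ∧ SamePiece G c pc z u} % (n / s.reg 32 + 1))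
    (fun u hu => absurd hu (Nat.not_lt_zero _)) ?_
  · rw [hS₂.reg] at key
    exact key u u.2
  · intro j hj s' hr ha hI u hu
    rw [hS₂.reg] at hj
    have hS : Stores G c (s'.setReg 40 j) :=
      (hS₂.congr (hr 0 (by decide)) (ha 0 (by decide)) (ha 1 (by decide))).setReg (by decide)
    have hcount : (countE 41 0 (andE (ltE (var 41) (var 40)) (sameE 41 40))).eval
        (s'.setReg 40 j) = #{z | z < ⟨j, hj⟩ ∧ SamePiece G c pc z ⟨j, hj⟩} := by
      rw [eval_countE, hS.reg, card_filter_range_eq]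
      congr 1
      ext z
      rw [mem_filter, mem_filter, holds_andE, (hS.setReg (by decide)).holds_sameE (p := z)
        (q := ⟨j, hj⟩) (pc := pc) (by simp) (by simp)
        (fun u => by simp only [State.arr_setReg]; rw [ha 6 (by decide), b6, hpc])
        (fun u => by simp only [State.arr_setReg]; rw [ha 8 (by decide), b8])]
      simp [Fin.lt_def]
    rw [run_seq, run_seq, run_assign, run_assign, hcount, run_store, State.arr_setArr, if_pos rfl]
    simp only [eval_var, State.reg_setReg, if_true, Nat.reduceEqDiff, if_false,
      Function.update_apply]
    by_cases huj : u.val = j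
    · obtain rfl : u = ⟨j, hj⟩ := Fin.ext huj
      rw [if_pos rfl, eval_divE (by decide) (by decide) (by decide)]
      · rw [eval_sub, eval_mulE (by decide) (by decide), eval_var]
        simp only [State.reg_setReg, if_true, Nat.reduceEqDiff, if_false, OfNat.zero_ne_ofNat,
          hr 12 (by decide), b12, hr 0 (by decide), hS₂.reg]
        have hle : #{z | z < (⟨j, hj⟩ : Fin n) ∧ SamePiece G c pc z ⟨j, hj⟩} ≤ n :=
          (card_le_univ _).trans (by simp)
        rw [min_eq_left (a := min _ _) (min_le_right _ _),
          min_eq_left ((Nat.div_le_self _ _).trans hle)]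
        have := Nat.div_add_mod #{z | z < (⟨j, hj⟩ : Fin n) ∧ SamePiece G c pc z ⟨j, hj⟩}
          (n / s.reg 32 + 1)
        rw [mul_comm] at this
        omega
      · simp only [State.reg_setReg, Nat.reduceEqDiff, if_false]
        rw [hr 12 (by decide), b12]; exact Nat.succ_pos _
    · rw [if_neg huj]
      simp only [State.arr_setReg]
      exact hI u (by omega)

end FairCC

/-! ### Exhaustive search in the chunks -/

namespace FairCC

open RAM RAM.Expr RAM.Cmd Finset

/-- Prescribed digits. -/
theorem exists_digits {B : ℕ} (p : ℕ → Prop) [DecidablePred p] (h : ℕ → ℕ) (hh : ∀ u, h u < B)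
    (m : ℕ) : ∃ x < B ^ Nat.count p m, ∀ u < m, p u → x / B ^ Nat.count p u % B = h u := by
  have hB : 0 < B := (Nat.zero_le _).trans_lt (hh 0)
  induction m with
  | zero => exact ⟨0, by simp, fun u hu => absurd hu (Nat.not_lt_zero u)⟩
  | succ m ih =>
    obtain ⟨x, hx, hxu⟩ := ih
    by_cases hp : p m
    · rw [Nat.count_succ, if_pos hp]
      refine ⟨x + B ^ Nat.count p m * h m, ?_, fun u hu hpu => ?_⟩
      · have := Nat.mul_le_mul_left (B ^ Nat.count p m) (hh m)
        rw [Nat.mul_succ] at this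
        rw [pow_succ]
        omega
      · rcases Nat.lt_succ_iff_lt_or_eq.1 hu with hu | rfl
        · have hlt : Nat.count p u < Nat.count p m := Nat.count_strict_mono hpu hu
          obtain ⟨r, hr⟩ := Nat.exists_eq_add_of_lt hlt
          rw [hr, pow_succ, pow_add, mul_assoc, mul_assoc, Nat.add_mul_div_left _ _
            (Nat.pow_pos hB), mul_left_comm, Nat.add_mul_mod_self_left]
          exact hxu u hu hpu
        · rw [Nat.add_mul_div_left _ _ (Nat.pow_pos hB), Nat.div_eq_of_lt hx, zero_add,
            Nat.mod_eq_of_lt (hh u)]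
    · rw [Nat.count_succ, if_neg hp]
      refine ⟨x, hx, fun u hu hpu => ?_⟩
      rcases Nat.lt_succ_iff_lt_or_eq.1 hu with hu | rfl
      · exact hxu u hu hpu
      · exact absurd hpu hp

/-- Vertex `u` lies in the current chunk. -/
def InChunk (s : State) (u : ℕ) : Prop := s.arr 9 (s.arr 6 u) = s.reg 64

instance (s : State) : DecidablePred (InChunk s) := fun u =>
  inferInstanceAs (Decidable (s.arr 9 (s.arr 6 u) = s.reg 64))

theorem holds_inChunkE {x : ℕ} {s : State} : (inChunkE x).Holds s ↔ InChunk s (s.reg x) := by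
  rw [inChunkE, holds_eqE]; rfl

theorem inChunk_congr {s s' : State} (h9 : s'.arr 9 = s.arr 9) (h6 : s'.arr 6 = s.arr 6)
    (h64 : s'.reg 64 = s.reg 64) (u : ℕ) : InChunk s' u ↔ InChunk s u := by
  rw [InChunk, InChunk, h9, h6, h64]

theorem inChunk_setReg {s : State} {x v : ℕ} (hx : x ≠ 64) (u : ℕ) :
    InChunk (s.setReg x v) u ↔ InChunk s u :=
  inChunk_congr (s := s) (s' := s.setReg x v) rfl rfl (by rw [State.reg_setReg, if_neg hx.symm]) u

/-- The labels encoded by the number `x`. -/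
def decoded (s : State) (x u : ℕ) : ℕ :=
  if InChunk s u then x / s.reg 35 ^ Nat.count (InChunk s) u % s.reg 35 else 0

variable {n k : ℕ} {G : SimpleGraph (Fin n)} [DecidableRel G.Adj] {c : Fin n → Fin k} {s : State}

/-- Each vertex of the chunk strips one digit off the code. Capping quotients at register 37 is
harmless, as the code does not exceed it. -/
theorem decodeCmd_spec (h0 : s.reg 0 = n) (hB : 0 < s.reg 35) (hx : s.reg 66 ≤ s.reg 37) {u : ℕ}
    (hun : u < n) (hu : InChunk s u) : (decodeCmd.run s).arr 10 u = decoded s (s.reg 66) u := by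
  have key := run_loop_frame (x := 68) (r := 0) (s := s.setReg 67 (s.reg 66))
    (c := (Cmd.ite (inChunkE 68)
    (Cmd.seq (assign 69 (divE 67 35 37)) (Cmd.seq (store 10 (var 68) (sub (var 67) (mulE 69 35 37)))
      (assign 67 (var 69)))) skip))
    (fun j s' => s'.reg 67 = s.reg 66 / s.reg 35 ^ Nat.count (InChunk s) j ∧
      ∀ u < j, InChunk s u → s'.arr 10 u = decoded s (s.reg 66) u)
    ⟨by simp, fun u hu => absurd hu (Nat.not_lt_zero _)⟩ ?_
  · simp only [State.reg_setReg, OfNat.zero_ne_ofNat, if_false, h0] at key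
    exact key.2 u hun hu
  · intro j hj s' hr ha hI
    have hin : InChunk (s'.setReg 68 j) j ↔ InChunk s j :=
      inChunk_congr (by simpa using ha 9 (by decide)) (by simpa using ha 6 (by decide))
        (by simpa using hr 64 (by decide)) j
    have hcond : (inChunkE 68).Holds (s'.setReg 68 j) ↔ InChunk s j := by
      rw [holds_inChunkE, State.reg_setReg, if_pos rfl, hin]
    rw [run_ite]
    have e35 : s'.reg 35 = s.reg 35 := by simpa using hr 35 (by decide)
    have e37 : s'.reg 37 = s.reg 37 := by simpa using hr 37 (by decide)
    by_cases hc : InChunk s j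
    · rw [if_pos (hcond.2 hc)]
      have hq : s'.reg 67 ≤ s.reg 37 := by rw [hI.1]; exact (Nat.div_le_self _ _).trans hx
      have hdiv : (divE 67 35 37).eval (s'.setReg 68 j) = s'.reg 67 / s.reg 35 := by
        rw [eval_divE (by decide) (by decide) (by decide)]
        · simp only [State.reg_setReg, Nat.reduceEqDiff, if_false, e35, e37]
          exact min_eq_left ((Nat.div_le_self _ _).trans hq)
        · simp only [State.reg_setReg, Nat.reduceEqDiff, if_false, e35]; exact hB
      simp only [run_seq, run_assign, run_store, hdiv, State.reg_setReg, State.reg_setArr, if_true,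
        eval_var, Nat.reduceEqDiff, if_false, eval_sub, State.arr_setReg, State.arr_setArr,
        eval_mulE (show 69 ≠ 99 by decide) (show 35 ≠ 99 by decide), e35, e37]
      rw [Nat.count_succ, if_pos hc, pow_succ, ← Nat.div_div_eq_div_mul, ← hI.1]
      refine ⟨rfl, fun u hu huc => ?_⟩
      rw [Function.update_apply]
      split_ifs with huj
      · subst huj
        rw [min_eq_left ((Nat.div_le_self _ _).trans hq), decoded, if_pos huc, ← hI.1]
        have := Nat.div_add_mod (s'.reg 67) (s.reg 35)
        rw [mul_comm] at this
        omega
      · exact hI.2 u (by omega) huc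
    · rw [if_neg fun h => hc (hcond.1 h), Nat.count_succ, if_neg hc, run_skip]
      refine ⟨by simpa using hI.1, fun u hu huc => ?_⟩
      rcases Nat.lt_succ_iff_lt_or_eq.1 hu with hu | rfl
      · exact hI.2 u hu huc
      · exact absurd huc hc

/-- Every nonzero label marks a fair set of minimal size. -/
def Valid (c : Fin n → Fin k) (cc : Fin n → ℕ) (f : Fin n → ℕ) : Prop :=
  ∀ u, f u ≠ 0 → Multiple c cc 1 (cls f (f u))

/-- The number of arcs inside the marked sets. -/
def labelArcs (G : SimpleGraph (Fin n)) [DecidableRel G.Adj] (f : Fin n → ℕ) : ℕ :=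
  #{p : Fin n × Fin n | G.Adj p.1 p.2 ∧ f p.1 = f p.2 ∧ f p.1 ≠ 0}

theorem Stores.holds_validE (h : Stores G c s) {f : Fin n → ℕ}
    (hf : ∀ u : Fin n, f u = if InChunk s u then s.arr 10 u else 0) :
    validE.Holds s ↔ Valid c (fun u : Fin n => s.arr 4 u) f := by
  simp only [validE, holds_allE, holds_impE, holds_andE, holds_eqE, eval_countE,
    holds_inChunkE, State.reg_setReg, OfNat.zero_ne_ofNat, if_false, h.reg, forall_lt_iff_fin,
    card_filter_range_eq, holds_get, eval_get, eval_var, eval_colE, State.arr_setReg, if_true,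
    Nat.reduceEqDiff, h.col_eq_iff, Valid, Multiple, one_mul]
  refine forall_congr' fun u => ?_
  have e1 : ∀ (x a y b z d : ℕ) (w : ℕ), x ≠ 64 → y ≠ 64 → z ≠ 64 →
      (InChunk (((s.setReg x a).setReg y b).setReg z d) w ↔ InChunk s w) := fun x a y b z d w h1 h2 h3 =>
    (inChunk_setReg h3 w).trans ((inChunk_setReg h2 w).trans (inChunk_setReg h1 w))
  have e2 : InChunk (s.setReg 60 u) u ↔ InChunk s u := inChunk_congr rfl rfl (by simp) _
  simp only [e1 _ _ _ _ _ _ _ (show 60 ≠ 64 by decide) (show 61 ≠ 64 by decide)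
    (show 62 ≠ 64 by decide), e2]
  have hm : (InChunk s u ∧ s.arr 10 u ≠ 0) ↔ f u ≠ 0 := by
    rw [hf]; split_ifs with h <;> simp [h]
  rw [hm]
  refine forall_congr' fun hu => forall_congr' fun v => ?_
  have : ({w | InChunk s w ∧ s.arr 10 w = s.arr 10 u ∧ c w = c v} : Finset (Fin n)) =
      {w ∈ cls f (f u) | c w = c v} := by
    have hu' : s.arr 10 u = f u := by rw [hf, if_pos (hm.2 hu).1]
    ext w
    simp only [mem_filter, mem_univ, true_and, mem_cls, hu']
    rw [← and_assoc]
    refine and_congr_left fun _ => ?_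
    rw [hf w]
    split_ifs with h
    · simp [h]
    · simp [h, hu.symm]
  rw [this]

theorem Stores.eval_valueE (h : Stores G c s) {f : Fin n → ℕ}
    (hf : ∀ u : Fin n, f u = if InChunk s u then s.arr 10 u else 0) :
    valueE.eval s = labelArcs G f := by
  have e1 : ∀ (x a y b : ℕ) (w : ℕ), x ≠ 64 → y ≠ 64 →
      (InChunk ((s.setReg x a).setReg y b) w ↔ InChunk s w) := fun x a y b w h1 h2 =>
    (inChunk_setReg h2 w).trans (inChunk_setReg h1 w)
  rw [labelArcs, valueE, eval_sum, h.reg,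
    ← Fin.sum_univ_eq_sum_range (fun j => (countE 61 0 _).eval (s.setReg 60 j)), card_filter,
    Fintype.sum_prod_type]
  refine sum_congr rfl fun u _ => ?_
  rw [← card_filter, eval_countE, State.reg_setReg, if_neg (by decide), h.reg,
    card_filter_range_eq]
  congr 1
  ext v
  have hA := ((h.setReg (x := 60) (v := u) (by decide)).setReg (x := 61) (v := v)
    (by decide)).holds_adjE (x := 60) (y := 61) (u := u) (v := v) (by simp) (by simp) (by decide)
  simp only [mem_filter, mem_univ, true_and, holds_andE, hA, holds_inChunkE, State.reg_setReg,
    if_true, Nat.reduceEqDiff, if_false, holds_get, holds_eqE, eval_get, eval_var,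
    State.arr_setReg, e1 _ _ _ _ _ (show 60 ≠ 64 by decide) (show 61 ≠ 64 by decide), hf]
  by_cases h1 : InChunk s u <;> by_cases h2 : InChunk s v <;> (simp [h1, h2]; try tauto)

theorem recordCmd_spec (h0 : s.reg 0 = n) (u : Fin n) : (recordCmd.run s).arr 7 u =
    if InChunk s u then (if s.arr 10 u ≠ 0 then s.reg 71 + s.arr 10 u else 0) else s.arr 7 u := by
  have key := run_loop_frame (x := 70) (r := 0) (s := s)
    (c := (Cmd.ite (inChunkE 70) (store 7 (var 70)
      (Expr.ite (get 10 (var 70)) (add (var 71) (get 10 (var 70))) (lit 0))) skip))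
    (fun j s' => ∀ u : ℕ, s'.arr 7 u = if u < j ∧ InChunk s u then
      (if s.arr 10 u ≠ 0 then s.reg 71 + s.arr 10 u else 0) else s.arr 7 u)
    (fun u => by simp) ?_
  · have := key u
    simp only [h0, u.2, true_and] at this
    exact this
  · intro j hj s' hr ha hI u
    have hin : InChunk (s'.setReg 70 j) j ↔ InChunk s j :=
      inChunk_congr (by simpa using ha 9 (by decide)) (by simpa using ha 6 (by decide))
        (by simpa using hr 64 (by decide)) j
    have hcond : (inChunkE 70).Holds (s'.setReg 70 j) ↔ InChunk s j := by
      rw [holds_inChunkE, State.reg_setReg, if_pos rfl, hin]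
    rw [run_ite]
    by_cases hc : InChunk s j
    · rw [if_pos (hcond.2 hc)]
      simp only [run_store, State.arr_setArr, if_true, eval_var, State.reg_setReg, State.arr_setReg,
        Function.update_apply, eval_ite, holds_get, eval_add, eval_get, eval_lit,
        Nat.reduceEqDiff, if_false, ha 10 (by decide), hr 71 (by decide), hI]
      by_cases huj : u = j
      · subst huj; simp [hc]
      · rw [if_neg huj]
        have : u < j + 1 ↔ u < j := by omega
        simp only [this]
    · rw [if_neg fun h => hc (hcond.1 h), run_skip, State.arr_setReg, hI]
      by_cases huj : u = j
      · subst huj; simp [hc]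
      · have : u < j + 1 ↔ u < j := by omega
        simp only [this]

/-- The best labeling of the current chunk is found. -/
theorem searchCmd_spec (h : Stores G c s) (hB : 0 < s.reg 35)
    (hL : s.reg 35 ^ #{u : Fin n | InChunk s u} ≤ s.reg 37)
    (h7 : ∀ u : Fin n, InChunk s u → s.arr 7 u = 0) :
    ∃ f : Fin n → ℕ, (∀ u, f u ≠ 0 → InChunk s u) ∧ (∀ u, f u < s.reg 35) ∧
      Valid c (fun u : Fin n => s.arr 4 u) f ∧
      (∀ u : Fin n, (searchCmd.run s).arr 7 u = if InChunk s u then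
        (if f u ≠ 0 then s.reg 71 + f u else 0) else s.arr 7 u) ∧
      ∀ f' : Fin n → ℕ, (∀ u, f' u ≠ 0 → InChunk s u) → (∀ u, f' u < s.reg 35) →
        Valid c (fun u : Fin n => s.arr 4 u) f' → labelArcs G f' ≤ labelArcs G f := by
  have hdec : ∀ x u, decoded s x u < s.reg 35 := by
    intro x u
    rw [decoded]; split_ifs
    · exact Nat.mod_lt _ hB
    · exact hB
  have key := run_loop_frame (x := 66) (r := 37) (s := s.setReg 65 0)
    (c := (Cmd.seq decodeCmd
      (Cmd.ite (andE validE (ltE (var 65) valueE)) (Cmd.seq (assign 65 valueE) recordCmd) skip)))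
    -- The recorded labeling is at least as good as every valid candidate below `x`. The search
    -- starts from the zero labeling, which is valid and has value 0.
    (fun x s' => ∃ f : Fin n → ℕ, (∀ u, f u ≠ 0 → InChunk s u) ∧ (∀ u, f u < s.reg 35) ∧
      Valid c (fun u : Fin n => s.arr 4 u) f ∧
      (∀ u : Fin n, s'.arr 7 u = if InChunk s u then
        (if f u ≠ 0 then s.reg 71 + f u else 0) else s.arr 7 u) ∧ s'.reg 65 = labelArcs G f ∧
      ∀ y < x, Valid c (fun u : Fin n => s.arr 4 u) (fun u => decoded s y u) →
        labelArcs G (fun u => decoded s y u) ≤ labelArcs G f) ?_ ?_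
  · simp only [State.reg_setReg, Nat.reduceEqDiff, if_false] at key
    obtain ⟨f, h1, h2, h3, h4, -, h6⟩ := key
    refine ⟨f, h1, h2, h3, h4, fun f' hs' hB' hv' => ?_⟩
    -- Every competing labeling has a code below base to the power of the chunk size, hence has been
    -- tried.
    obtain ⟨x, hx, hxu⟩ := exists_digits (InChunk s)
      (fun u => if hu : u < n then f' ⟨u, hu⟩ else 0) (B := s.reg 35)
      (fun u => by split_ifs; exacts [hB' _, hB]) n
    rw [Nat.count_eq_card_filter_range, card_filter_range_eq] at hx
    have e : (fun u : Fin n => decoded s x u) = f' := by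
      funext u
      rw [decoded]
      split_ifs with hu
      · rw [hxu u u.2 hu, dif_pos u.2]
      · by_contra hne
        exact hu (hs' u (Ne.symm hne))
    have := h6 x (hx.trans_le hL)
    rw [e] at this
    exact this hv'
  · refine ⟨fun _ => 0, fun u hu => absurd rfl hu, fun _ => hB, fun u hu => absurd rfl hu,
      fun u => ?_, ?_, fun y hy => absurd hy (Nat.not_lt_zero _)⟩
    · simpa using h7 u
    · simp [labelArcs]
  · intro x hx s' hr ha hI
    simp only [State.reg_setReg, Nat.reduceEqDiff, if_false] at hx
    have hS : Stores G c (s'.setReg 66 x) := (h.congr (by simpa using hr 0 (by decide))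
      (by simpa using ha 0 (by decide)) (by simpa using ha 1 (by decide))).setReg (by decide)
    have e35 : s'.reg 35 = s.reg 35 := by simpa using hr 35 (by decide)
    have e37 : s'.reg 37 = s.reg 37 := by simpa using hr 37 (by decide)
    have e71 : s'.reg 71 = s.reg 71 := by simpa using hr 71 (by decide)
    have e4 : s'.arr 4 = s.arr 4 := ha 4 (by decide)
    have hin : ∀ u, InChunk (s'.setReg 66 x) u ↔ InChunk s u := fun u =>
      inChunk_congr (ha 9 (by decide)) (ha 6 (by decide)) (by simpa using hr 64 (by decide)) u
    have hdecode : ∀ u : Fin n, InChunk s u →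
        (decodeCmd.run (s'.setReg 66 x)).arr 10 u = decoded s x u := by
      intro u hu
      rw [decodeCmd_spec hS.reg (by simpa [e35] using hB) (by simpa [e37] using hx.le) u.2
        ((hin u).2 hu)]
      have : InChunk (s'.setReg 66 x) = InChunk s := funext fun u => propext (hin u)
      simp only [decoded, this, State.reg_setReg, Nat.reduceEqDiff, if_false, if_true, e35]
    rw [run_seq]
    generalize hs₁ : decodeCmd.run (s'.setReg 66 x) = s₁ at *
    have hS₁ : Stores G c s₁ := by
      rw [← hs₁]; exact hS.run (by decide) (by decide) (by decide)
    have r64 : s₁.reg 64 = s'.reg 64 := by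
      rw [← hs₁, run_reg _ _ _ (by decide)]; simp
    have r65 : s₁.reg 65 = s'.reg 65 := by
      rw [← hs₁, run_reg _ _ _ (by decide)]; simp
    have r71 : s₁.reg 71 = s.reg 71 := by
      rw [← e71, ← hs₁, run_reg _ _ _ (by decide)]; simp
    have a4 : s₁.arr 4 = s.arr 4 := by
      rw [← e4, ← hs₁, run_arr _ _ _ (by decide)]; rfl
    have a6 : s₁.arr 6 = s'.arr 6 := by
      rw [← hs₁, run_arr _ _ _ (by decide)]; rfl
    have a7 : s₁.arr 7 = s'.arr 7 := by
      rw [← hs₁, run_arr _ _ _ (by decide)]; rfl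
    have a9 : s₁.arr 9 = s'.arr 9 := by
      rw [← hs₁, run_arr _ _ _ (by decide)]; rfl
    have hin₁ : ∀ u, InChunk s₁ u ↔ InChunk s u := fun u =>
      (inChunk_congr a9 a6 (by simpa using r64) u).trans (hin u)
    have hf : ∀ u : Fin n, decoded s x u = if InChunk s₁ u then s₁.arr 10 u else 0 := by
      intro u
      split_ifs with hu
      · exact (hdecode u ((hin₁ u).1 hu)).symm
      · rw [decoded, if_neg fun h => hu ((hin₁ u).2 h)]
    obtain ⟨f, h1, h2, h3, h4, h5, h6⟩ := hI
    have hcond : (andE validE (ltE (var 65) valueE)).Holds s₁ ↔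
        Valid c (fun u : Fin n => s.arr 4 u) (fun u => decoded s x u) ∧
          labelArcs G f < labelArcs G (fun u => decoded s x u) := by
      rw [holds_andE, hS₁.holds_validE hf, holds_ltE, hS₁.eval_valueE hf, eval_var, r65, h5, a4]
    rw [run_ite]
    split_ifs with hc
    · have hc' := hcond.1 hc
      refine ⟨fun u => decoded s x u, fun u hu => ?_, fun u => hdec x u, hc'.1, fun u => ?_, ?_,
        fun y hy hv => ?_⟩
      · by_contra hn
        exact hu (if_neg hn)
      · rw [run_seq, recordCmd_spec (by rw [run_assign]; simpa using hS₁.reg)]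
        rw [run_assign, hS₁.eval_valueE hf]
        have e : InChunk (s₁.setReg 65 (labelArcs G fun u => decoded s x u)) u ↔ InChunk s u :=
          (inChunk_congr rfl rfl (by simp) u).trans (hin₁ u)
        by_cases hu : InChunk s u
        · rw [if_pos (e.2 hu), if_pos hu]
          simp only [State.arr_setReg, State.reg_setReg, Nat.reduceEqDiff, if_false, r71, hf u,
            if_pos ((hin₁ u).2 hu)]
        · rw [if_neg fun h => hu (e.1 h), if_neg hu]
          simp only [State.arr_setReg, a7, h4, if_neg hu]
      · rw [run_seq, run_reg _ _ _ (by decide), run_assign, State.reg_setReg, if_pos rfl,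
          hS₁.eval_valueE hf]
      · rcases Nat.lt_succ_iff_lt_or_eq.1 hy with hy | rfl
        · exact (h6 y hy hv).trans hc'.2.le
        · exact le_rfl
    · refine ⟨f, h1, h2, h3, fun u => by rw [run_skip, a7, h4], by rw [run_skip, r65, h5],
        fun y hy hv => ?_⟩
      rcases Nat.lt_succ_iff_lt_or_eq.1 hy with hy | rfl
      · exact h6 y hy hv
      · by_contra hlt
        exact hc (hcond.2 ⟨hv, not_le.1 hlt⟩)

/-- Every chunk gets its best labeling, with labels of its own. -/
theorem chunksCmd_spec (h : Stores G c s) (hB : 0 < s.reg 35)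
    (hL : ∀ j < n, s.reg 35 ^ #{u : Fin n | s.arr 9 (s.arr 6 u) = j} ≤ s.reg 37)
    (h7 : ∀ u : Fin n, s.arr 7 u = 0) (hch : ∀ u : Fin n, s.arr 9 (s.arr 6 u) < n) :
    ∃ f : ℕ → Fin n → ℕ, (∀ j < n, ∀ u, f j u ≠ 0 → s.arr 9 (s.arr 6 u) = j) ∧
      (∀ j < n, ∀ u, f j u < s.reg 35) ∧
      (∀ j < n, Valid c (fun u : Fin n => s.arr 4 u) (f j)) ∧
      (∀ u : Fin n, (chunksCmd.run s).arr 7 u = if f (s.arr 9 (s.arr 6 u)) u ≠ 0 then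
        s.arr 9 (s.arr 6 u) * s.reg 35 + f (s.arr 9 (s.arr 6 u)) u else 0) ∧
      ∀ j < n, ∀ f' : Fin n → ℕ, (∀ u, f' u ≠ 0 → s.arr 9 (s.arr 6 u) = j) →
        (∀ u, f' u < s.reg 35) → Valid c (fun u : Fin n => s.arr 4 u) f' →
          labelArcs G f' ≤ labelArcs G (f j) := by
  have key := run_loop_frame (x := 64) (r := 0) (s := s.setReg 71 0)
    (c := (Cmd.seq searchCmd (assign 71 (add (var 71) (var 35)))))
    -- Chunk `m` writes its nonzero labels shifted by `m` times the base; as they are smaller than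
    -- the base, different chunks never share a label.
    (fun m s' => s'.reg 71 = m * s.reg 35 ∧ ∃ f : ℕ → Fin n → ℕ,
      (∀ j < m, ∀ u, f j u ≠ 0 → s.arr 9 (s.arr 6 u) = j) ∧
      (∀ j < m, ∀ u, f j u < s.reg 35) ∧
      (∀ j < m, Valid c (fun u : Fin n => s.arr 4 u) (f j)) ∧
      (∀ u : Fin n, s'.arr 7 u =
        if s.arr 9 (s.arr 6 u) < m ∧ f (s.arr 9 (s.arr 6 u)) u ≠ 0 then
        s.arr 9 (s.arr 6 u) * s.reg 35 + f (s.arr 9 (s.arr 6 u)) u else 0) ∧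
      ∀ j < m, ∀ f' : Fin n → ℕ, (∀ u, f' u ≠ 0 → s.arr 9 (s.arr 6 u) = j) →
        (∀ u, f' u < s.reg 35) → Valid c (fun u : Fin n => s.arr 4 u) f' →
          labelArcs G f' ≤ labelArcs G (f j)) ?_ ?_
  · simp only [State.reg_setReg, OfNat.zero_ne_ofNat, if_false, h.reg] at key
    obtain ⟨-, f, h1, h2, h3, h4, h5⟩ := key
    refine ⟨f, h1, h2, h3, fun u => ?_, h5⟩
    have := h4 u
    simp only [hch u, true_and] at this
    exact this
  · refine ⟨by simp, fun _ _ => 0, ?_, ?_, ?_, fun u => ?_, ?_⟩ <;>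
      first
      | exact fun j hj => absurd hj (Nat.not_lt_zero _)
      | simpa using h7 u
  · rintro m hm s' hr ha ⟨h71, f, h1, h2, h3, h4, h5⟩
    simp only [State.reg_setReg, OfNat.zero_ne_ofNat, if_false, h.reg] at hm
    have hS : Stores G c (s'.setReg 64 m) := (h.congr (by simpa using hr 0 (by decide))
      (by simpa using ha 0 (by decide)) (by simpa using ha 1 (by decide))).setReg (by decide)
    have e35 : (s'.setReg 64 m).reg 35 = s.reg 35 := by simpa using hr 35 (by decide)
    have e37 : (s'.setReg 64 m).reg 37 = s.reg 37 := by simpa using hr 37 (by decide)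
    have e4 : (s'.setReg 64 m).arr 4 = s.arr 4 := ha 4 (by decide)
    have hin : ∀ u, InChunk (s'.setReg 64 m) u ↔ s.arr 9 (s.arr 6 u) = m := fun u => by
      rw [InChunk, State.arr_setReg, ha 9 (by decide), ha 6 (by decide)]; simp
    have e71 : (s'.setReg 64 m).reg 71 = m * s.reg 35 := by simpa using h71
    obtain ⟨g, g1, g2, g3, g4, g5⟩ := searchCmd_spec hS (by rw [e35]; exact hB)
      (by simp only [e35, e37, hin]; exact hL m hm)
      (fun u hu => by
        rw [State.arr_setReg, h4, if_neg]
        rw [(hin u).1 hu]; simp)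
    simp only [hin, e35, e4, e71, State.arr_setReg] at g1 g2 g3 g4 g5
    refine ⟨?_, fun j => if j = m then g else f j, ?_, ?_, ?_, fun u => ?_, ?_⟩
    · rw [run_seq, run_assign, State.reg_setReg, if_pos rfl, eval_add, eval_var, eval_var,
        run_reg _ _ _ (by decide), run_reg _ _ _ (by decide), e71, e35]
      ring
    · intro j hj u hu
      by_cases hjm : j = m <;> simp only [hjm, if_true, if_false] at hu
      · exact (g1 u hu).trans hjm.symm
      · exact h1 j (by omega) u hu
    · intro j hj u
      by_cases hjm : j = m <;> simp only [hjm, if_true, if_false]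
      · exact g2 u
      · exact h2 j (by omega) u
    · intro j hj
      by_cases hjm : j = m <;> simp only [hjm, if_true, if_false]
      · exact g3
      · exact h3 j (by omega)
    · rw [run_seq, run_assign, State.arr_setReg, g4]
      by_cases hu : s.arr 9 (s.arr 6 u) = m
      · simp [hu]
      · have : s.arr 9 (s.arr 6 u) < m + 1 ↔ s.arr 9 (s.arr 6 u) < m := by omega
        simp only [hu, if_false, h4, this]
    · intro j hj
      by_cases hjm : j = m <;> simp only [hjm, if_true, if_false]
      · exact g5
      · exact h5 j (by omega)

end FairCC

/-! ### Completing the labels to a clustering -/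

namespace FairCC

open RAM RAM.Expr RAM.Cmd Finset

variable {n k : ℕ} {G : SimpleGraph (Fin n)} [DecidableRel G.Adj] {c : Fin n → Fin k} {s : State}

theorem completeCmd_spec (h : Stores G c s) (h4 : ∀ u : Fin n, 0 < s.arr 4 u) (u : Fin n) :
    (completeCmd.run s).arr 2 u = if s.arr 7 u ≠ 0 then s.arr 7 u else
      1 + n + n * s.reg 35 +
        #{v : Fin n | s.arr 7 v = 0 ∧ v < u ∧ c v = c u} / s.arr 4 u := by
  rw [completeCmd, run_seq, run_assign]
  -- This exceeds all labels in use, at most `n` from the matching or at most `n` times the base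
  -- from the chunks.
  have hbase : (add (lit 1) (add (var 0) (sum 40 0 (var 35)))).eval s =
      1 + n + n * s.reg 35 := by
    simp only [eval_add, eval_lit, eval_var, eval_sum, State.reg_setReg, Nat.reduceEqDiff, if_false,
      sum_const, card_range, smul_eq_mul, h.reg]
    ring
  rw [hbase]
  have key := run_loop_frame (x := 40) (r := 0) (s := s.setReg 13 (1 + n + n * s.reg 35))
    (c := (Cmd.seq (assign 50 (countE 41 0 (andE (notE (get 7 (var 41)))
        (andE (ltE (var 41) (var 40)) (eqE (colE 41) (colE 40))))))
      (Cmd.seq (assign 51 (get 4 (var 40)))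
        (store 2 (var 40) (Expr.ite (get 7 (var 40)) (get 7 (var 40))
          (add (var 13) (divE 50 51 0)))))))
    (fun j s' => ∀ u : Fin n, u < j → s'.arr 2 u = if s.arr 7 u ≠ 0 then s.arr 7 u else
      1 + n + n * s.reg 35 +
        #{v : Fin n | s.arr 7 v = 0 ∧ v < u ∧ c v = c u} / s.arr 4 u)
    (fun u hu => absurd hu (Nat.not_lt_zero _)) ?_
  · simp only [State.reg_setReg, OfNat.zero_ne_ofNat, if_false, h.reg] at key
    exact key u u.2
  · intro j hj s' hr ha hI u hu
    simp only [State.reg_setReg, OfNat.zero_ne_ofNat, if_false, h.reg] at hj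
    have hS : Stores G c (s'.setReg 40 j) := (h.congr (by simpa using hr 0 (by decide))
      (by simpa using ha 0 (by decide)) (by simpa using ha 1 (by decide))).setReg (by decide)
    have e4 : s'.arr 4 = s.arr 4 := ha 4 (by decide)
    have e7 : s'.arr 7 = s.arr 7 := ha 7 (by decide)
    have e13 : s'.reg 13 = 1 + n + n * s.reg 35 := by simpa using hr 13 (by decide)
    have e0 : s'.reg 0 = n := by simpa [h.reg] using hr 0 (by decide)
    have hcount : (countE 41 0 (andE (notE (get 7 (var 41)))
        (andE (ltE (var 41) (var 40)) (eqE (colE 41) (colE 40))))).eval (s'.setReg 40 j) =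
        #{v : Fin n | s.arr 7 v = 0 ∧ v < ⟨j, hj⟩ ∧ c v = c ⟨j, hj⟩} := by
      rw [eval_countE, hS.reg, card_filter_range_eq]
      congr 1
      ext v
      have := hS.col_eq_iff v ⟨j, hj⟩
      rw [State.arr_setReg] at this
      simp only [mem_filter, mem_univ, true_and, holds_andE, holds_notE, holds_get, eval_var,
        State.reg_setReg, if_true, State.arr_setReg, e7, holds_ltE, Nat.reduceEqDiff, if_false,
        holds_eqE, eval_colE, this, Fin.lt_def, not_not]
    simp only [run_seq, run_assign, run_store, hcount, State.arr_setArr, if_true, eval_var,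
      State.reg_setReg, Nat.reduceEqDiff, if_false, State.arr_setReg, Function.update_apply,
      eval_get, eval_ite, holds_get, eval_add, e7, e13, e4]
    by_cases huj : u.val = j
    · obtain rfl : u = ⟨j, hj⟩ := Fin.ext huj
      rw [if_pos rfl, eval_divE (by decide) (by decide) (by decide)]
      · simp only [State.reg_setReg, Nat.reduceEqDiff, if_false, if_true, OfNat.zero_ne_ofNat, e0]
        rw [min_eq_left]
        exact (Nat.div_le_self _ _).trans ((card_le_univ _).trans (by simp))
      · simp only [State.reg_setReg, if_true]
        exact h4 ⟨j, hj⟩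
    · rw [if_neg huj]
      exact hI u (by omega)

/-- The unmarked vertices can be cut into fair sets of minimal size. -/
theorem complete_labeling {cc f out : Fin n → ℕ} {g d base : ℕ} (hP : Palette c cc g d)
    (hf : ∀ u, f u ≠ 0 → ∃ j, Multiple c cc j (cls f (f u))) (hb : ∀ u, f u < base)
    (hout : ∀ u, out u = if f u ≠ 0 then f u else
      base + #{v : Fin n | f v = 0 ∧ v < u ∧ c v = c u} / cc u) :
    (∀ u, f u ≠ 0 → cls out (out u) = cls f (f u)) ∧
      ∀ u, f u = 0 → Multiple c cc 1 (cls out (out u)) := by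
  constructor
  · intro u hu
    ext v
    rw [mem_cls, mem_cls, hout, hout, if_pos hu]
    split_ifs with hv
    · rfl
    · have := hb u
      rw [not_not] at hv
      constructor
      · intro h
        have := Nat.le_add_right base (#{w | f w = 0 ∧ w < v ∧ c w = c v} / cc v)
        omega
      · intro h; exact absurd (h.symm.trans hv) hu
  · have hj : ∀ i, ∃ j, i ≠ 0 → Multiple c cc j (cls f i) := by
      intro i
      by_cases hi : ∃ u, f u = i ∧ i ≠ 0
      · obtain ⟨u, rfl, hu⟩ := hi
        obtain ⟨j, hj⟩ := hf u hu
        exact ⟨j, fun _ => hj⟩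
      · refine ⟨0, fun h0 u => ?_⟩
        rw [zero_mul, card_eq_zero, filter_eq_empty_iff]
        intro v hv
        exact absurd ⟨v, (mem_cls.1 hv), h0⟩ hi
    choose j hj using hj
    -- All vertices together have multiplicity `g`. Removing the marked sets, whose multiplicities
    -- add up, leaves a set that is a multiple again and can be cut into blocks.
    have hS : Multiple c cc (g - ∑ i ∈ (univ.image f).erase 0, j i) {u | f u = 0} := by
      intro u
      have e := card_eq_sum_card_fiberwise (f := f) (s := ({v | c v = c u} : Finset (Fin n)))
        (t := insert 0 ((univ.image f).erase 0)) (fun v _ => by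
          by_cases hv : f v = 0 <;> simp [hv])
      rw [sum_insert (notMem_erase _ _), hP.card_color u, filter_filter] at e
      have e2 : ∑ i ∈ (univ.image f).erase 0, #{v ∈ ({v | c v = c u} : Finset (Fin n)) | f v = i}
          = (∑ i ∈ (univ.image f).erase 0, j i) * cc u := by
        rw [sum_mul]
        refine sum_congr rfl fun i hi => ?_
        rw [← hj i (ne_of_mem_erase hi) u]
        congr 1
        ext v
        simp only [mem_filter, mem_univ, true_and, mem_cls, and_comm]
      rw [e2] at e
      rw [filter_filter, Nat.sub_mul, mul_comm g, e, Nat.add_sub_cancel]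
      congr 1
      ext v
      simp only [mem_filter, mem_univ, true_and, and_comm]
    intro u hu
    have hA : ∀ v, #{w : Fin n | f w = 0 ∧ w < v ∧ c w = c v} =
        #{w ∈ ({u | f u = 0} : Finset (Fin n)) | c w = c v ∧ w.val < v.val} := by
      intro v
      congr 1
      ext w
      simp only [mem_filter, mem_univ, true_and, Fin.lt_def, and_comm]
    have hlt := hP.rank_div_lt Fin.val hS (u := u) (by simp [hu])
    have := hP.multiple_one_of_multiple (A := fun v => #{w ∈ ({u | f u = 0} : Finset (Fin n)) |
      c w = c v ∧ w.val < v.val} / cc v) hlt Fin.val Fin.val_injective.injOn hS fun _ _ => rfl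
    have e : cls out (out u) = {v ∈ ({u | f u = 0} : Finset (Fin n)) | #{w ∈ ({u | f u = 0} :
        Finset (Fin n)) | c w = c v ∧ w.val < v.val} / cc v = #{w ∈ ({u | f u = 0} :
        Finset (Fin n)) | c w = c u ∧ w.val < u.val} / cc u} := by
      ext v
      rw [mem_cls, hout, hout, if_neg (not_not.2 hu), hA, hA, mem_filter]
      split_ifs with hv
      · have h1 := hb v
        have : v ∉ ({u | f u = 0} : Finset (Fin n)) := by simp [hv]
        constructor
        · intro h
          exact absurd h (h1.trans_le (Nat.le_add_right _ _)).ne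
        · intro h; exact absurd h.1 this
      · rw [Nat.add_left_cancel_iff, and_iff_right (by simpa using hv)]
    rw [e]
    exact this

end FairCC

/-! ### The constants and the running time -/

namespace FairCC

open RAM RAM.Expr RAM.Cmd Finset

/-- Iterated powers of two. -/
def tower (b : ℕ) : ℕ → ℕ
  | 0 => b + 8
  | i + 1 => 2 ^ tower b i

theorem powCmd_exec {x y : ℕ} (hx : x < 90) (hy : y < 90) (hxy : x ≠ y) (s : State) :
    Exec ((powCmd y x).comp 100) s ((powCmd y x).size * (s.reg x + 1) ^ (powCmd y x).depth)
      (fun s' => (∀ z < 90, s'.reg z = if z = y then 2 ^ s.reg x else s.reg z) ∧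
        s'.arr = s.arr) := by
  have hb : (powCmd y x).bnds = [x] := rfl
  have hm : ∀ z ∈ (powCmd y x).mods, z = y ∨ 90 ≤ z := by
    intro z hz
    simp only [powCmd, Cmd.mods, Expr.mods] at hz
    simp at hz
    omega
  refine (Cmd.exec_comp (M := s.reg x) _ 100 s ?_ ?_ ?_).mono le_rfl ?_
  · exact ⟨⟨by omega, trivial⟩, by omega, by omega, by omega, by show y < 100; omega,
      by show y < 100; omega⟩
  · intro r hr
    rw [hb, List.mem_singleton] at hr
    subst hr
    intro h
    have := hm r h
    omega
  · intro r hr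
    rw [hb, List.mem_singleton] at hr
    exact hr ▸ le_rfl
  · rintro s' ⟨h1, h2⟩
    refine ⟨fun z hz => ?_, ?_⟩
    · rw [h1 z (by omega)]
      split_ifs with hzy
      · subst hzy
        have key := run_loop_frame (x := 90) (r := x) (s := s.setReg z 1)
          (c := assign z (add (var z) (var z))) (fun j s' => s'.reg z = 2 ^ j) (by simp) ?_
        · rw [State.reg_setReg, if_neg hxy] at key
          exact key
        · intro j hj s' hr ha hI
          have : z ≠ 90 := by omega
          simp only [run_assign, State.reg_setReg, if_true, eval_add, eval_var, if_neg this, hI,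
            pow_succ]
          ring
      · exact run_reg _ _ _ fun h => (hm z (writes_subset_mods _ h)).elim hzy (by omega)
    · rw [h2]
      funext a
      exact run_arr _ _ _ (by simp [powCmd, Cmd.stores])

/-- The stages are compiled one by one, since each computes the loop bound of the next, which is
excluded within one command. All bounds, and so the time, depend on `b` only. -/
theorem towerProg_exec (b : ℕ) : ∀ m, m < 60 → ∃ T, ∀ s : State, s.reg 3 = b →
    Exec (towerProg m) s T (fun s' => (∀ y < 20, s'.reg y = s.reg y) ∧ s'.arr = s.arr ∧
      ∀ i ≤ m, s'.reg (20 + i) = tower b i) := by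
  intro m
  induction m with
  | zero =>
    refine fun _ => ⟨(assign 20 (add (var 3) (lit 8))).size * (0 + 1) ^
      (assign 20 (add (var 3) (lit 8))).depth, fun s hs => ?_⟩
    refine (Cmd.exec_comp (M := 0) (assign 20 (add (var 3) (lit 8))) 100 s (by decide) (by decide)
      (fun r hr => ?_)).mono le_rfl ?_
    · exact absurd hr (List.not_mem_nil)
    · rintro s' ⟨h1, h2⟩
      refine ⟨fun y hy => ?_, h2, fun i hi => ?_⟩
      · rw [h1 y (by omega), run_assign, State.reg_setReg, if_neg (by omega)]
      · obtain rfl : i = 0 := by omega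
        rw [h1 20 (by decide), run_assign, State.reg_setReg, if_pos rfl, eval_add, eval_var, hs]
        rfl
  | succ m ih =>
    intro hm
    obtain ⟨T, hT⟩ := ih (by omega)
    refine ⟨T + (powCmd (21 + m) (20 + m)).size *
      (tower b m + 1) ^ (powCmd (21 + m) (20 + m)).depth, fun s hs => ?_⟩
    refine (hT s hs).seq ?_
    rintro s' ⟨h1, h2, h3⟩
    have := powCmd_exec (x := 20 + m) (y := 21 + m) (by omega) (by omega) (by omega) s'
    rw [h3 m le_rfl] at this
    refine this.mono le_rfl ?_
    rintro s'' ⟨h4, h5⟩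
    refine ⟨fun y hy => ?_, h5.trans h2, fun i hi => ?_⟩
    · rw [h4 y (by omega), if_neg (by omega), h1 y hy]
    · rw [h4 (20 + i) (by omega)]
      rcases Nat.le_succ_iff.1 hi with hi | rfl
      · rw [if_neg (by omega), h3 i hi]
      · rw [if_pos (by omega)]; rfl

theorem tower_pos (b : ℕ) : ∀ i, 0 < tower b i
  | 0 => Nat.succ_pos _
  | _ + 1 => Nat.pow_pos (by decide)

/-- Running time of the scheme. -/
theorem schemeProg_exec : ∃ D, ∀ b, ∃ C, ∀ s : State, s.reg 3 = b → 0 < s.reg 0 →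
    Exec schemeProg s (C * s.reg 0 ^ D) (fun s' => ∃ s₁ : State,
      (∀ y < 20, s₁.reg y = s.reg y) ∧ s₁.arr = s.arr ∧
      (∀ i ≤ 17, s₁.reg (20 + i) = tower b i) ∧ s'.arr = (mainCmd.run s₁).arr) := by
  refine ⟨mainCmd.depth, fun b => ?_⟩
  obtain ⟨T, hT⟩ := towerProg_exec b 17 (by decide)
  refine ⟨T + mainCmd.size * (tower b 17 + 1) ^ mainCmd.depth, fun s hs hn => ?_⟩
  refine Exec.mono ((hT s hs).seq (T' := mainCmd.size * (s.reg 0 * tower b 17 + 1) ^ mainCmd.depth)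
    (R := fun s' => ∃ s₁ : State, (∀ y < 20, s₁.reg y = s.reg y) ∧ s₁.arr = s.arr ∧
      (∀ i ≤ 17, s₁.reg (20 + i) = tower b i) ∧ s'.arr = (mainCmd.run s₁).arr) ?_) ?_
    fun _ h => h
  · rintro s₁ ⟨h1, h2, h3⟩
    refine (Cmd.exec_comp (M := s.reg 0 * tower b 17) mainCmd 100 s₁ mainCmd_below mainCmd_bnds
      fun r hr => ?_).mono le_rfl fun s' h => ⟨s₁, h1, h2, h3, h.2⟩
    -- Both bounds, `n` and `tower b 17`, are at most their product.
    rcases mainCmd_bnds_eq r hr with rfl | rfl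
    · rw [h1 0 (by decide)]
      exact Nat.le_mul_of_pos_right _ (tower_pos b 17)
    · rw [h3 17 le_rfl]
      exact Nat.le_mul_of_pos_left _ hn
  · have h1 : s.reg 0 * tower b 17 + 1 ≤ (tower b 17 + 1) * s.reg 0 := by nlinarith
    have h2 : 1 ≤ s.reg 0 ^ mainCmd.depth := Nat.one_le_pow _ _ hn
    have h3 := Nat.pow_le_pow_left h1 mainCmd.depth
    rw [mul_pow] at h3
    rw [Nat.add_mul]
    refine Nat.add_le_add (Nat.le_mul_of_pos_right _ h2) ?_
    rw [mul_assoc]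
    exact Nat.mul_le_mul_left _ h3

/-! ### Growth -/

theorem lt_tower_succ (b i : ℕ) : tower b i < tower b (i + 1) := Nat.lt_two_pow_self

theorem tower_mono (b : ℕ) : Monotone (tower b) :=
  monotone_nat_of_le_succ fun i => (lt_tower_succ b i).le

theorem le_tower (b i : ℕ) : b + 8 ≤ tower b i := tower_mono b (Nat.zero_le i)

theorem sq_le_two_pow {x : ℕ} (hx : 4 ≤ x) : x * x ≤ 2 ^ x := by
  induction x, hx using Nat.le_induction with
  | base => decide
  | succ x hx ih => rw [pow_succ]; nlinarith

/-- One level of the tower absorbs a product, a sum or a power of two, and two levels absorb a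
general power. All later estimates are made this way; they are generous, but affect only the
constant. -/
theorem mul_le_tower {b i x y : ℕ} (hx : x ≤ tower b i) (hy : y ≤ tower b i) :
    x * y ≤ tower b (i + 1) :=
  (Nat.mul_le_mul hx hy).trans (sq_le_two_pow (by have := le_tower b i; omega))

theorem add_le_tower {b i x y : ℕ} (hx : x ≤ tower b i) (hy : y ≤ tower b i) :
    x + y ≤ tower b (i + 1) := by
  have h := le_tower b i
  have := mul_le_tower (b := b) (i := i) (x := tower b i) (y := tower b i) le_rfl le_rfl
  nlinarith

theorem two_pow_le_tower {b i x : ℕ} (hx : x ≤ tower b i) : 2 ^ x ≤ tower b (i + 1) :=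
  Nat.pow_le_pow_right (by decide) hx

theorem pow_le_tower {b i x y : ℕ} (hx : x ≤ tower b i) (hy : y ≤ tower b i) :
    x ^ y ≤ tower b (i + 2) :=
  calc x ^ y ≤ (2 ^ x) ^ y := Nat.pow_le_pow_left Nat.lt_two_pow_self.le _
    _ = 2 ^ (x * y) := (pow_mul _ _ _).symm
    _ ≤ _ := two_pow_le_tower (mul_le_tower hx hy)

end FairCC

namespace FairCC

open RAM RAM.Expr RAM.Cmd Finset

/-! ### Clusterings and labelings -/

section Labelings

variable {n k : ℕ} {c : Fin n → Fin k} {cc : Fin n → ℕ} {g d : ℕ}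

/-- Clearing denominators turns fairness into the hypothesis of `Palette.exists_multiple`; the
multiplicity is positive since clusters are nonempty. -/
theorem fairLabeling_of_fairPartition (h : Palette c cc g d)
    {Q : Finpartition (univ : Finset (Fin n))} (hQ : FairPartition c Q) :
    FairLabeling c cc Q.part := by
  intro S hS
  obtain ⟨u, -, rfl⟩ := mem_image.1 hS
  have hn : 0 < n := u.pos
  have hcls : cls Q.part (Q.part u) = Q.part u := by
    ext v
    rw [mem_cls]
    constructor
    · intro h; rw [← h]; exact Q.mem_part (mem_univ v)
    · intro h; exact Q.part_eq_of_mem (Q.part_mem.2 (mem_univ u)) h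
  rw [hcls]
  have hpos : 0 < #(Q.part u) := card_pos.2 ⟨u, Q.mem_part (mem_univ u)⟩
  obtain ⟨j, hj⟩ := h.exists_multiple (Q.part u) fun v => by
    have h1 := hQ (Q.part u) (Q.part_mem.2 (mem_univ u)) (c v)
    rw [div_eq_div_iff (by exact_mod_cast hpos.ne') (by simpa using hn.ne')] at h1
    have e : Q.part u ∩ univ.filter (fun w => c w = c v) = {w ∈ Q.part u | c w = c v} := by
      ext w; simp
    rw [e] at h1
    exact_mod_cast h1
  refine ⟨j, ?_, hj⟩
  have := h.card_eq_of_multiple hj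
  by_contra h0
  rw [Nat.eq_zero_of_not_pos h0, zero_mul] at this
  omega

theorem exists_fairPartition (h : Palette c cc g d) {ι : Type*} [DecidableEq ι] {f : Fin n → ι}
    (hf : FairLabeling c cc f) : ∃ P : Finpartition (univ : Finset (Fin n)),
      FairPartition c P ∧ ∀ u v, P.part u = P.part v ↔ f u = f v := by
  let S : Setoid (Fin n) := Setoid.ker f
  have : DecidableRel S.r := fun u v => inferInstanceAs (Decidable (f u = f v))
  have hpart : ∀ u v, v ∈ (Finpartition.ofSetoid S).part u ↔ f u = f v := fun u v =>
    Finpartition.mem_part_ofSetoid_iff_rel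
  refine ⟨Finpartition.ofSetoid S, ?_, fun u v => ?_⟩
  · intro T hT i
    obtain ⟨u, hu⟩ := Finpartition.nonempty_of_mem_parts _ hT
    have hn : 0 < n := u.pos
    have hTu : T = cls f (f u) := by
      rw [← Finpartition.part_eq_of_mem _ hT hu]
      ext v
      rw [hpart, mem_cls, eq_comm]
    obtain ⟨j, hj, hmul⟩ := hf (f u) (mem_image_of_mem f (mem_univ u))
    rw [← hTu] at hmul
    have hpos : 0 < #T := card_pos.2 ⟨u, hu⟩
    rw [div_eq_div_iff (by exact_mod_cast hpos.ne') (by simpa using hn.ne')]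
    have e : T ∩ univ.filter (fun w => c w = i) = {w ∈ T | c w = i} := by
      ext w; simp
    rw [e]
    by_cases hi : ∃ v, c v = i
    · obtain ⟨v, rfl⟩ := hi
      rw [hmul v, h.card_color v, h.card_eq_of_multiple hmul, h.card_univ]
      push_cast
      ring
    -- A colour without vertices has proportion 0 on both sides.
    · push Not at hi
      rw [filter_false_of_mem (fun v _ => hi v), filter_false_of_mem (fun v _ => hi v)]
      simp
  · rw [← hpart]
    constructor
    · intro h; rw [h]; exact Finpartition.mem_part _ (mem_univ v)
    · intro h
      exact (Finpartition.part_eq_of_mem _ (Finpartition.part_mem _ |>.2 (mem_univ u)) h).symm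

end Labelings

/-! ### Quality of the labelings -/

section Quality

variable {n k : ℕ} {G : SimpleGraph (Fin n)} [DecidableRel G.Adj] {c : Fin n → Fin k}
  {cc : Fin n → ℕ} {g d b : ℕ}

/-- The cost of `out` is at most `1 + 1 / b` times the cost of `f`. -/
def Approximates (G : SimpleGraph (Fin n)) [DecidableRel G.Adj] (b : ℕ) {ι : Type*}
    [DecidableEq ι] (out : Fin n → ℕ) (f : Fin n → ι) : Prop :=
  b * (samePairs out + arcs G univ) + (b + 1) * (2 * sameArcs G f) ≤
    (b + 1) * (samePairs f + arcs G univ) + b * (2 * sameArcs G out)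

/-- The extra factor costs nothing because the cost of `f` is nonnegative: `sameArcs` is at most
`arcs` and at most `samePairs`. -/
theorem Approximates.of_optimal {ι : Type*} [DecidableEq ι] {out : Fin n → ℕ} {f : Fin n → ι}
    (h : samePairs out + 2 * sameArcs G f ≤ samePairs f + 2 * sameArcs G out) :
    Approximates G b out f := by
  have h1 : sameArcs G f ≤ arcs G univ := sameArcs_le_arcs_univ f
  have h2 : sameArcs G f ≤ samePairs f := by
    refine card_le_card fun p hp => ?_
    simp only [mem_filter, mem_univ, true_and] at hp ⊢
    exact ⟨hp.1.ne, hp.2⟩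
  have h3 := Nat.mul_le_mul_left b h
  rw [Approximates]
  nlinarith

theorem FairLabeling.of_cls {out : Fin n → ℕ}
    (h : ∀ u, ∃ j, 0 < j ∧ Multiple c cc j (cls out (out u))) : FairLabeling c cc out := by
  intro i hi
  obtain ⟨u, -, rfl⟩ := mem_image.1 hi
  exact h u

theorem card_le_sameArcs_of_matchInv {ok : Fin n → Fin n → Prop} {dead : Fin n → Prop}
    {h out : Fin n → ℕ} (hI : MatchInv G ok dead h)
    (hout : ∀ u, h u ≠ 0 → cls out (out u) = cls h (h u)) :
    #{u | h u ≠ 0} ≤ sameArcs G out := by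
  choose p hp using fun u (hu : h u ≠ 0) => hI.exists_partner hu
  refine card_le_card_of_injOn (fun u => if hu : h u ≠ 0 then (u, p u hu) else (u, u))
    (fun u hu => ?_) fun u _ v _ he => ?_
  · have hu' : h u ≠ 0 := by simpa using hu
    simp only [dif_pos hu', mem_coe, mem_filter, mem_univ, true_and]
    refine ⟨(hp u hu').2.1, ?_⟩
    have : p u hu' ∈ cls out (out u) := by
      rw [hout u hu', mem_cls]; exact ((hp u hu').2.2.2 _).2 (.inr rfl)
    exact (mem_cls.1 this).symm
  · have := congrArg Prod.fst he
    simp only at this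
    split_ifs at this <;> exact this

/-- Matched pairs and singletons are optimal for one colour. -/
theorem approximates_of_one (hP : Palette c cc g 1) (hG : Degenerate G) {h out : Fin n → ℕ}
    (hI : MatchInv G (Matchable c 1) (fun _ => True) h)
    (h1 : ∀ u, h u ≠ 0 → cls out (out u) = cls h (h u))
    (h2 : ∀ u, h u = 0 → Multiple c cc 1 (cls out (out u))) {ι : Type*} [DecidableEq ι]
    (f : Fin n → ι) : Approximates G b out f := by
  have e1 := card_le_sameArcs_of_matchInv hI h1
  have e2 := hI.two_mul_card_covering_le
  have e3 := two_mul_sameArcs_le_of_cover hG f (C := {u | Covering h u}) fun u v huv => by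
    simpa using hI.cover u v huv (.inl rfl) trivial
  have e4 : samePairs out ≤ #{u | h u ≠ 0} := by
    have hne : ∀ u v, u ≠ v → out u = out v → h u ≠ 0 := by
      intro u v huv ho hu
      have hc := hP.card_eq_of_multiple (h2 u hu)
      rw [one_mul, card_eq_one] at hc
      obtain ⟨x, hx⟩ := hc
      have hux : u ∈ cls out (out u) := by simp
      have hvx : v ∈ cls out (out u) := by simp [ho]
      rw [hx, mem_singleton] at hux hvx
      exact huv (hux.trans hvx.symm)
    refine card_le_card_of_injOn Prod.fst (fun p hp => ?_) fun p hp q hq hpq => ?_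
    · simp only [mem_coe, mem_filter, mem_univ, true_and] at hp ⊢
      exact hne p.1 p.2 hp.1 hp.2
    · simp only [mem_coe, mem_filter, mem_univ, true_and] at hp hq
      obtain ⟨v, -, -, -, hv⟩ := hI.exists_partner (hne p.1 p.2 hp.1 hp.2)
      have key : ∀ w, out p.1 = out w → w = p.1 ∨ w = v := fun w hw => by
        rw [← hv w, ← mem_cls, ← h1 _ (hne p.1 p.2 hp.1 hp.2), mem_cls]; exact hw.symm
      have hp2 := (key p.2 hp.2).resolve_left hp.1.symm
      have hq2 := (key q.2 (by rw [hpq]; exact hq.2)).resolve_left (by rw [hpq]; exact hq.1.symm)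
      exact Prod.ext hpq (hp2.trans hq2.symm)
  -- With `M` matched vertices and the cover `C`: `2 * sameArcs f - samePairs f ≤ 2 * #C ≤ M ≤ 2 *
  -- sameArcs out - samePairs out`.
  refine Approximates.of_optimal ?_
  omega

/-- The classes of `u` and `v` have `(cc u + cc v) * g ≤ 2 * g` vertices, so both `cc` are 1 and
there is no third colour. -/
theorem multiple_one_pair (hP : Palette c cc g 2) {u v : Fin n} (huv : c u ≠ c v) :
    Multiple c cc 1 {u, v} := by
  have hn := hP.card_univ
  have hg := hP.pos
  have hcu := hP.cc_pos u
  have hcv := hP.cc_pos v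
  have hdisj : Disjoint ({w | c w = c u} : Finset (Fin n)) ({w | c w = c v} : Finset (Fin n)) := by
    rw [disjoint_filter]
    exact fun w _ h1 h2 => huv (h1.symm.trans h2)
  have hcard := card_le_univ (univ.filter (fun w => c w = c u) ∪ univ.filter (fun w => c w = c v))
  have hun := card_union_of_disjoint hdisj
  rw [hP.card_color u, hP.card_color v] at hun
  rw [hun, hn] at hcard
  have h1 : cc u = 1 := by nlinarith
  have h2 : cc v = 1 := by nlinarith
  have huniv : univ.filter (fun w => c w = c u) ∪ univ.filter (fun w => c w = c v) = univ := by
    rw [← card_eq_iff_eq_univ, hun, hn, h1, h2]; ring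
  have hne : u ≠ v := fun h => huv (congrArg c h)
  have key : ∀ x y : Fin n, c x = c y → cc y = 1 → ∀ z, c z ≠ c y →
      #{w ∈ ({y, z} : Finset (Fin n)) | c w = c x} = 1 * cc x := by
    intro x y hxy hy z hz
    rw [one_mul, hP.cc_congr hxy, hy, card_eq_one]
    refine ⟨y, ?_⟩
    ext w
    simp only [mem_filter, mem_insert, mem_singleton, hxy]
    constructor
    · rintro ⟨rfl | rfl, h⟩
      · rfl
      · exact absurd h hz
    · rintro rfl; exact ⟨.inl rfl, rfl⟩
  intro x
  have hx : x ∈ univ.filter (fun w => c w = c u) ∪ univ.filter (fun w => c w = c v) := by rw [huniv]; simp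
  rw [mem_union, mem_filter, mem_filter] at hx
  rcases hx with ⟨-, hx⟩ | ⟨-, hx⟩
  · exact key x u hx h1 v huv.symm
  · rw [pair_comm]; exact key x v hx h2 u huv

theorem cls_of_matchInv {ok : Fin n → Fin n → Prop} {dead : Fin n → Prop} {h : Fin n → ℕ}
    (hI : MatchInv G ok dead h) (hok : ∀ u v, ok u v → ok v u) {u : Fin n} (hu : h u ≠ 0) :
    ∃ v, v ≠ u ∧ ok u v ∧ cls h (h u) = {u, v} := by
  obtain ⟨v, h1, -, h3, h4⟩ := hI.exists_partner hu
  refine ⟨v, h1, h3.elim id (hok v u), ?_⟩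
  ext w
  rw [mem_cls, h4]; simp

theorem approximates_of_two (hP : Palette c cc g 2) (hG : Degenerate G) {h out : Fin n → ℕ}
    (hI : MatchInv G (Matchable c 2) (fun _ => True) h)
    (h1 : ∀ u, h u ≠ 0 → cls out (out u) = cls h (h u))
    (hout : MinimalLabeling c cc out) {ι : Type*} [DecidableEq ι]
    {f : Fin n → ι} (hf : FairLabeling c cc f) : Approximates G b out f := by
  have e1 := card_le_sameArcs_of_matchInv hI h1
  have e2 := hI.two_mul_card_covering_le
  have e3 := two_mul_sameArcs_add_card_le_of_cover hP hG hf (C := {u | Covering h u})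
    fun u v huv hc => by simpa using hI.cover u v huv (.inr hc) trivial
  have e4 := samePairs_of_minimal hP hout
  -- Here `samePairs out = n`, and four times the cover is at most twice the number of matched
  -- vertices, hence at most `2 * sameArcs out`.
  refine Approximates.of_optimal ?_
  omega

/-- If fair sets are large, then every clustering into minimal fair sets is good. -/
theorem approximates_of_large (hP : Palette c cc g d) (hG : Degenerate G) (hd : 4 * b + 3 ≤ d)
    {out : Fin n → ℕ} (hout : MinimalLabeling c cc out) {ι : Type*} [DecidableEq ι]
    {f : Fin n → ι} (hf : FairLabeling c cc f) : Approximates G b out f := by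
  have e1 := samePairs_of_minimal hP hout
  have e2 := le_samePairs_of_fair hP hf
  have e3 : sameArcs G f ≤ arcs G univ := sameArcs_le_arcs_univ f
  have e4 := hG.arcs_le' univ
  rw [Finset.card_univ] at e4
  rw [Fintype.card_fin] at e1 e2 e4
  -- It suffices that `(2 * b + 1) * arcs ≤ n * (d - 1)`. As `arcs ≤ 2 * n`, this explains the
  -- threshold `4 * b + 3`.
  have e5 : n * (4 * b + 2) ≤ n * (d - 1) := Nat.mul_le_mul_left n (by omega)
  rw [Approximates, e1]
  have e6 := Nat.mul_le_mul_left (2 * b + 1) e4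
  have e7 := Nat.mul_le_mul_left (b + 1) e2
  have e8 := Nat.mul_le_mul_left (2 * (b + 1)) e3
  nlinarith

/-- After the reduction to minimal clusters only `sameArcs` differs. A deficit of `n / (3 * b)`
there raises the doubled cost by `2 * n / (3 * b)`, while the doubled cost of `f'` is at least `2 *
n / 3`. -/
theorem approximates_of_sameArcs_le (hP : Palette c cc g d) (hG : Degenerate G) (hd : 3 ≤ d)
    {out : Fin n → ℕ} (hout : MinimalLabeling c cc out) {ι : Type*} [DecidableEq ι]
    {f : Fin n → ι} (hf : FairLabeling c cc f)
    (hle : ∀ f' : Fin n → ι × ℕ, MinimalLabeling c cc f' →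
      3 * b * sameArcs G f' ≤ 3 * b * sameArcs G out + n) : Approximates G b out f := by
  obtain ⟨f', hf', hcost⟩ := exists_minimal_labeling hP hd hG hf
  have e1 := samePairs_of_minimal hP hout
  have e2 := hle f' hf'
  have e3 : sameArcs G f' ≤ arcs G univ := sameArcs_le_arcs_univ f'
  have e4 : d * sameArcs G f' + 2 * n ≤ 2 * (d * n) := by
    have h1 : ∀ i ∈ univ.image f', d * arcs G (cls f' i) + 2 * #(cls f' i) ≤
        2 * (d * #(cls f' i)) := by
      intro i hi
      have := hG.arcs_le _ (cls_nonempty hi)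
      rw [hP.card_eq_of_multiple (hf' i hi), one_mul] at this ⊢
      nlinarith
    have h2 := card_eq_sum_cls f'
    rw [Fintype.card_fin] at h2
    have h3 := sum_le_sum h1
    rw [sum_add_distrib, ← mul_sum, ← mul_sum, ← mul_sum, ← mul_sum, ← sameArcs_eq_sum, ← h2] at h3
    exact h3
  rw [Fintype.card_fin] at e1 hcost
  obtain ⟨m, rfl⟩ : ∃ m, d = m + 3 := ⟨d - 3, by omega⟩
  have hm : m + 3 - 1 = m + 2 := rfl
  rw [hm] at e1 hcost
  -- Trees on `d` vertices give `sameArcs f' ≤ 2 * n - 2 * n / d`, so `n * (d - 1) - sameArcs f'` is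
  -- at least `n * (d - 3 + 2 / d)`, which is smallest at `d = 3`.
  have e5 : 2 * n + 3 * sameArcs G f' ≤ 3 * (n * (m + 2)) := by
    have : (m + 3) * (2 * n + 3 * sameArcs G f') ≤ (m + 3) * (3 * (n * (m + 2))) := by
      nlinarith [Nat.zero_le (m * m * n), Nat.zero_le (m * n)]
    exact Nat.le_of_mul_le_mul_left this (Nat.succ_pos _)
  rw [Approximates, e1]
  have e6 := Nat.mul_le_mul_left (b + 1) hcost
  have e7 := Nat.mul_le_mul_left 2 e2
  nlinarith

end Quality

end FairCC

namespace FairCC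

open RAM RAM.Expr RAM.Cmd Finset

/-! ### Bounds for the parameters -/

/-- Every occurring colour appears in a minimal fair set, so at most `d` colours occur. Thus the
bound depends on `b` and not on `k`. -/
theorem card_pieceType_le {n k b d w : ℕ} {c : Fin n → Fin k} {cc : Fin n → ℕ} {g : ℕ}
    (hP : Palette c cc g d) (hd : d ≤ 4 * b + 2) (hw : w ≤ tower b 2) :
    Fintype.card (PieceType c w) ≤ tower b 5 := by
  have hk : #(univ.image c) ≤ tower b 2 := by
    have h1 : #(univ.image c) * g ≤ d * g := by
      rw [← hP.card_univ, ← Finset.card_univ, card_eq_sum_card_image c, ← smul_eq_mul]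
      refine card_nsmul_le_sum _ _ _ fun i hi => ?_
      obtain ⟨u, -, rfl⟩ := mem_image.1 hi
      have := hP.card_color u
      rw [this]
      exact Nat.le_mul_of_pos_left g (hP.cc_pos u)
    have h2 := Nat.le_of_mul_le_mul_right h1 hP.pos
    have h3 := mul_le_tower (b := b) (i := 0) (x := 4) (y := b + 8) (by simp [tower]) le_rfl
    have h4 : tower b 1 < tower b 2 := lt_tower_succ b 1
    rw [zero_add] at h3
    omega
  rw [Fintype.card_prod, Fintype.card_finset, Fintype.card_finset, Fintype.card_prod,
    Fintype.card_prod, Fintype.card_fin, Fintype.card_coe]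
  exact mul_le_tower (two_pow_le_tower (mul_le_tower hw hk)) (two_pow_le_tower (mul_le_tower hw hw))

/-- This fixes `K = tower b 12`: the rounding loss of `exists_chunk_labeling`, summed up, stays
below `n / (6 * b)`. -/
theorem card_config_le {T : Type*} [Fintype T] [DecidableEq T] {b d w : ℕ} (hd : d ≤ 4 * b + 2)
    (hw : w ≤ tower b 2) (hT : Fintype.card T ≤ tower b 5) :
    6 * b * (Fintype.card (Config T w d) * (d * d)) ≤ tower b 12 := by
  have h8 := le_tower b 0
  have hm : ∀ {i j x : ℕ}, i ≤ j → x ≤ tower b i → x ≤ tower b j := fun hij hx =>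
    hx.trans (tower_mono b hij)
  have hd1 : d + 1 ≤ tower b 1 :=
    le_trans (by omega) (mul_le_tower (b := b) (i := 0) (x := 4) (y := b + 8) (by omega) h8)
  have h6b : 6 * b ≤ tower b 1 := mul_le_tower (i := 0) (by omega) (by omega)
  have hdd : d * d ≤ tower b 2 := mul_le_tower (by omega) (by omega)
  have hdd1 : d * d + 1 ≤ tower b 3 := by have : tower b 2 < tower b 3 := lt_tower_succ b 2; omega
  have h2w : 2 ^ w ≤ tower b 3 := two_pow_le_tower hw
  have h22w : 2 ^ 2 ^ w ≤ tower b 4 := two_pow_le_tower h2w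
  have he : Fintype.card T * 2 ^ 2 ^ w * 2 ^ w ≤ tower b 7 :=
    mul_le_tower (mul_le_tower hT (hm (by decide) h22w)) (hm (by decide) h2w)
  have hp : (d + 1) ^ (Fintype.card T * 2 ^ 2 ^ w * 2 ^ w) ≤ tower b 9 :=
    pow_le_tower (hm (by decide) hd1) he
  rw [Fintype.card_prod, Fintype.card_fun, Fintype.card_prod, Fintype.card_prod,
    Fintype.card_finset, Fintype.card_finset, Fintype.card_fin, Fintype.card_fin, Fintype.card_fin]
  exact mul_le_tower (hm (by decide) h6b)
    (mul_le_tower (mul_le_tower hp (hm (by decide) hdd1)) (hm (by decide) hdd))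

/-- This fixes the piece threshold `2 ^ (b + 8)`, so that cutting into pieces loses at most `n / (6
* b)` arcs. -/
theorem mul_le_tower_one {b d : ℕ} (hd : d ≤ 4 * b + 2) : 12 * b * (d - 1) ≤ tower b 1 := by
  have h1 : 12 * b * (d - 1) ≤ 12 * b * (4 * b + 1) := Nat.mul_le_mul_left _ (by omega)
  have h2 : tower b 1 = 2 ^ b * 256 := by rw [tower, tower, pow_add]; norm_num
  rw [h2]
  rcases Nat.lt_or_ge b 4 with hb | hb
  · interval_cases b <;> omega
  · have := sq_le_two_pow hb
    nlinarith

section Middle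

variable {n k : ℕ} {G : SimpleGraph (Fin n)} [DecidableRel G.Adj] {c : Fin n → Fin k} {s : State}
  {cc : Fin n → ℕ} {g d b : ℕ}

/-- Labelings of the chunks are combined. -/
theorem combine_labelings {a : Fin n → ℕ} {f : ℕ → Fin n → ℕ} {B m : ℕ} {h : Fin n → ℕ}
    (hh : ∀ u, h u = if f (a u) u ≠ 0 then a u * B + f (a u) u else 0)
    (hs : ∀ j < m, ∀ u, f j u ≠ 0 → a u = j) (hB : ∀ j < m, ∀ u, f j u < B)
    (ha : ∀ u, a u < m) :
    (∀ u, h u ≠ 0 → f (a u) u ≠ 0 ∧ cls h (h u) = cls (f (a u)) (f (a u) u)) ∧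
      ∑ j ∈ range m, labelArcs G (f j) ≤ labelArcs G h ∧ ∀ u, h u ≤ m * B := by
  have h0 : ∀ u, h u ≠ 0 → f (a u) u ≠ 0 := fun u hu hf => hu (by rw [hh, if_neg (not_not.2 hf)])
  have h1 : ∀ u, f (a u) u ≠ 0 → h u = a u * B + f (a u) u := fun u hu => by rw [hh, if_pos hu]
  have hiff : ∀ u v, f (a u) u ≠ 0 → (h v = h u ↔ f (a u) v = f (a u) u) := by
    intro u v hu
    constructor
    · intro he
      have hv : f (a v) v ≠ 0 := h0 v (by rw [he, h1 u hu]; omega)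
      rw [h1 u hu, h1 v hv] at he
      have hBu := hB _ (ha u) u
      have hBv := hB _ (ha v) v
      have hB0 : 0 < B := by omega
      -- Local labels are smaller than `B`, so division by `B` recovers the chunk.
      have hdiv : a v = a u := by
        have := congrArg (· / B) he
        simpa only [Nat.mul_comm _ B, Nat.mul_add_div hB0, Nat.div_eq_of_lt hBu,
          Nat.div_eq_of_lt hBv, add_zero] using this
      rw [hdiv] at he
      omega
    · intro he
      have hv : a v = a u := hs _ (ha u) v (by rw [he]; exact hu)
      rw [h1 u hu, h1 v (by rw [hv, he]; exact hu), hv, he]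
  refine ⟨fun u hu => ⟨h0 u hu, ?_⟩, ?_, fun u => ?_⟩
  · ext v
    rw [mem_cls, mem_cls, hiff u v (h0 u hu)]
  · rw [labelArcs, card_eq_sum_card_fiberwise (f := fun p => a p.1) (t := range m)
      (fun p _ => mem_coe.2 (mem_range.2 (ha p.1)))]
    refine sum_le_sum fun j hj => card_le_card fun p hp => ?_
    simp only [mem_filter, mem_univ, true_and] at hp ⊢
    obtain ⟨hadj, heq, hne⟩ := hp
    obtain rfl := hs j (mem_range.1 hj) p.1 hne
    exact ⟨⟨hadj, ((hiff p.1 p.2 hne).2 heq.symm).symm, by rw [h1 _ hne]; omega⟩, rfl⟩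
  · rw [hh]
    split_ifs
    · have h2 := Nat.mul_le_mul_right B (Nat.succ_le_of_lt (ha u))
      have h3 := hB _ (ha u) u
      rw [Nat.succ_mul] at h2
      omega
    · exact Nat.zero_le _

/-- A chunk receives of each type its share rounded down and at most one more. The shares add up to
at most `K`, because `n < K * (n / K + 1)`, and each piece has fewer than `w` vertices. -/
theorem card_chunk_le {T : Type*} [Fintype T] [DecidableEq T] {τ : Fin n → T} {pc : Fin n → Fin n}
    {ch : Fin n → ℕ} {w K : ℕ} (hK : 0 < K) (hw : ∀ y, #{u | pc u = y} < w)
    (hch : ∀ y, ch y = #{z | z < y ∧ τ z = τ y} % (n / K + 1)) (j : ℕ) :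
    #{u | ch (pc u) = j} ≤ (K + Fintype.card T) * w := by
  have h1 : #{y | ch y = j} ≤ K + Fintype.card T := by
    rcases Nat.lt_or_ge j (n / K + 1) with hj | hj
    · rw [card_eq_sum_card_fiberwise (f := τ) (t := univ) (fun _ _ => mem_coe.2 (mem_univ _))]
      have h2 : ∀ t ∈ (univ : Finset T), #{y ∈ ({y | ch y = j} : Finset (Fin n)) | τ y = t} ≤
          #{y | τ y = t} / (n / K + 1) + 1 := by
        intro t _
        refine le_trans (card_le_card fun y hy => ?_) (card_deal τ hj t).2
        simp only [mem_filter, mem_univ, true_and, hch] at hy ⊢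
        exact hy.symm
      refine (sum_le_sum h2).trans ?_
      rw [sum_add_distrib, sum_const, smul_eq_mul, mul_one, Finset.card_univ]
      refine Nat.add_le_add_right ((sum_div_le_div _ _ (Nat.succ_pos _)).trans ?_) _
      have h3 := card_eq_sum_card_fiberwise (f := τ) (s := (univ : Finset (Fin n))) (t := univ)
        (fun _ _ => mem_coe.2 (mem_univ _))
      rw [← h3, Finset.card_univ, Fintype.card_fin]
      refine Nat.div_le_of_le_mul ?_
      have := (Nat.lt_mul_div_succ n hK).le
      rwa [mul_comm] at this
    · rw [card_eq_zero.2]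
      · exact Nat.zero_le _
      · refine filter_eq_empty_iff.2 fun y _ hy => ?_
        have : #{z | z < y ∧ τ z = τ y} % (n / K + 1) < n / K + 1 := Nat.mod_lt _ (Nat.succ_pos _)
        rw [hch] at hy
        omega
  rw [card_eq_sum_card_fiberwise (f := pc) (t := {y | ch y = j}) (fun u hu => by simpa using hu)]
  refine le_trans (sum_le_card_nsmul _ _ w fun y _ => ?_) ?_
  · exact (card_le_card (filter_subset_filter _ (subset_univ _))).trans (hw y).le
  · rw [smul_eq_mul]
    exact Nat.mul_le_mul_right w h1

/-- The marked sets found by the search are nearly as good as any minimal labeling. -/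
theorem search_spec (h : Stores G c s) (hP : Palette c (fun u : Fin n => s.arr 4 u) g d)
    (hd3 : 3 ≤ d) (hd : d ≤ 4 * b + 2) (ht : ∀ i ≤ 17, s.reg (20 + i) = tower b i) (hn : 0 < n)
    (h7 : ∀ u : Fin n, s.arr 7 u = 0) {pc : Fin n → Fin n} (hpc : ∀ u : Fin n, s.arr 6 u = pc u)
    (hI : PieceInv G (tower b 1) (fun _ => True) pc) :
    Valid c (fun u : Fin n => s.arr 4 u)
      (fun u : Fin n => (chunksCmd.run (dealCmd.run s)).arr 7 u) ∧
    (∀ u : Fin n, (chunksCmd.run (dealCmd.run s)).arr 7 u ≤ n * s.reg 35) ∧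
    ∀ (ι : Type*) [DecidableEq ι] (Q : Fin n → ι), MinimalLabeling c (fun u : Fin n => s.arr 4 u) Q →
      3 * b * sameArcs G Q ≤ 3 * b * labelArcs G
        (fun u : Fin n => (chunksCmd.run (dealCmd.run s)).arr 7 u) + n := by
  classical
  have r32 : s.reg 32 = tower b 12 := ht 12 (by decide)
  have r35 : s.reg 35 = tower b 15 := ht 15 (by decide)
  have r37 : s.reg 37 = tower b 17 := ht 17 (by decide)
  have hK : 0 < tower b 12 := tower_pos b 12
  have hcard := hI.card_lt
  let τ := pieceType G c pc (2 * tower b 1)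
  have hw2 : 2 * tower b 1 ≤ tower b 2 :=
    mul_le_tower (by have := le_tower b 1; omega) le_rfl
  have hT := card_pieceType_le hP hd hw2
  have hR := card_config_le hd hw2 hT
  have hdeal := dealCmd_spec h (by rw [r32]; exact hK) hpc
  rw [r32] at hdeal
  generalize hs₁ : dealCmd.run s = s₁ at *
  have hS₁ : Stores G c s₁ := by rw [← hs₁]; exact h.run (by decide) (by decide) (by decide)
  have a4 : s₁.arr 4 = s.arr 4 := by rw [← hs₁]; exact run_arr _ _ _ (by decide)
  have a6 : s₁.arr 6 = s.arr 6 := by rw [← hs₁]; exact run_arr _ _ _ (by decide)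
  have a7 : s₁.arr 7 = s.arr 7 := by rw [← hs₁]; exact run_arr _ _ _ (by decide)
  have b35 : s₁.reg 35 = tower b 15 := by
    rw [← r35, ← hs₁]; exact run_reg _ _ _ (by decide)
  have b37 : s₁.reg 37 = tower b 17 := by
    rw [← r37, ← hs₁]; exact run_reg _ _ _ (by decide)
  have hch : ∀ y : Fin n, s₁.arr 9 y = #{z | z < y ∧ τ z = τ y} % (n / tower b 12 + 1) := by
    intro y
    rw [hdeal]
    simp only [samePiece_iff hcard, τ]
  -- With at most `tower b 14` vertices per chunk, labels below `tower b 15` suffice and the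
  -- candidates number at most `tower b 17`.
  have hq : ∀ j, #{u : Fin n | s₁.arr 9 (s₁.arr 6 u) = j} ≤ tower b 14 := by
    intro j
    simp only [a6, hpc]
    refine (card_chunk_le (ch := fun y => s₁.arr 9 y) hK hcard hch j).trans ?_
    exact mul_le_tower (add_le_tower le_rfl (hT.trans (tower_mono b (by decide))))
      (hw2.trans (tower_mono b (by decide)))
  -- So the loop over all numbers below `n` visits every chunk; surplus chunks are empty.
  have hN : n / tower b 12 + 1 ≤ n := by
    have h1 := le_tower b 12
    exact Nat.div_lt_self hn (by omega)
  have hchlt : ∀ y : Fin n, s₁.arr 9 y < n / tower b 12 + 1 := fun y => by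
    rw [hch]; exact Nat.mod_lt _ (Nat.succ_pos _)
  obtain ⟨f, f1, f2, f3, f4, f5⟩ := chunksCmd_spec hS₁ (by rw [b35]; exact tower_pos b 15)
    (fun j _ => by
      rw [b35, b37]
      exact pow_le_tower le_rfl ((hq j).trans (tower_mono b (by decide))))
    (fun u => by rw [a7, h7]) (fun u => by rw [a6, hpc]; exact (hchlt _).trans_le hN)
  obtain ⟨c1, c2, c3⟩ := combine_labelings (G := G) (a := fun u : Fin n => s₁.arr 9 (s₁.arr 6 u))
    (h := fun u : Fin n => (chunksCmd.run s₁).arr 7 u) f4 f1 f2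
    (fun u => by rw [a6, hpc]; exact (hchlt _).trans_le hN)
  rw [a4] at f3 f5
  refine ⟨fun u hu => ?_, fun u => ?_, fun ι _ Q hQ => ?_⟩
  · obtain ⟨h1, h2⟩ := c1 u hu
    rw [h2]
    exact f3 _ (by rw [a6, hpc]; exact (hchlt _).trans_le hN) u h1
  · rw [r35, ← b35]; exact c3 u
  · have hQd : ∀ i ∈ univ.image Q, #(cls Q i) = d := fun i hi => by
      rw [hP.card_eq_of_multiple (hQ i hi), one_mul]
    have e1 := hI.sameArcs_le (fun _ => trivial) hQd
    set J := #{p : Fin n × Fin n | G.Adj p.1 p.2 ∧ Q p.1 = Q p.2 ∧ pc p.1 = pc p.2}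
    set R := Fintype.card (Config (PieceType c (2 * tower b 1)) (2 * tower b 1) d) * (d * d)
    set N := n / tower b 12 + 1 with hNdef
    have e2 : ∀ j ∈ range N, J ≤ N * labelArcs G (f j) + (N - 1) * R := by
      intro j hj
      have hj := mem_range.1 hj
      obtain ⟨l, l1, l2, l3, l4⟩ := exists_chunk_labeling (G := G) (pc := pc) (rk := pieceRank pc)
        (τ := τ) (w := 2 * tower b 1) (ch := fun y : Fin n => s₁.arr 9 y) (N := N) (j := j)
        (Nat.succ_pos _) hQ hQd (fun u v => pieceRank_inj) (pieceRank_lt hcard)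
        (fun u y => exists_of_pieceType_eq hcard)
        (fun u v u' v' h1 h2 h3 h4 h5 h6 => adj_of_pieceType_eq hcard h1 h2 h3 h4 h5 h6)
        (fun t => by
          refine ((card_deal τ hj t).1).trans (le_of_eq ?_)
          simp only [hch])
      refine l4.trans (Nat.add_le_add_right (Nat.mul_le_mul_left N ?_) _)
      refine f5 j (hj.trans_le hN) l (fun u hu => by rw [a6, hpc]; exact l1 u hu) (fun u => ?_) l2
      rw [b35]
      have h1 := hq j
      simp only [a6, hpc] at h1
      exact ((l3 u).trans h1).trans_lt (lt_tower_succ b 14)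
    -- Averaging over the `N` chunks, each of which keeps its share of `J`.
    have e3 : J ≤ ∑ j ∈ range N, labelArcs G (f j) + (N - 1) * R := by
      have h1 := sum_le_sum e2
      rw [sum_const, card_range, smul_eq_mul, sum_add_distrib, ← mul_sum, sum_const, card_range,
        smul_eq_mul, ← Nat.mul_add] at h1
      exact Nat.le_of_mul_le_mul_left h1 (Nat.succ_pos _)
    have e4 : ∑ j ∈ range N, labelArcs G (f j) ≤ ∑ j ∈ range n, labelArcs G (f j) :=
      sum_le_sum_of_subset (range_subset_range.2 hN)
    -- The dealing loses at most `n / (6 * b)` arcs, and by `e6` the cutting loses as much; together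
    -- this is the allowed `n / (3 * b)`.
    have e5 : 6 * b * ((N - 1) * R) ≤ n := by
      rw [hNdef, Nat.add_sub_cancel]
      calc 6 * b * (n / tower b 12 * R) = n / tower b 12 * (6 * b * R) := by ring
        _ ≤ n / tower b 12 * tower b 12 := Nat.mul_le_mul_left _ hR
        _ ≤ n := Nat.div_mul_le_self _ _
    have e6 : 6 * b * sameArcs G Q ≤ 6 * b * J + n := by
      refine le_of_mul_le_mul_left ?_ (tower_pos b 1)
      have h1 := Nat.mul_le_mul_left (6 * b) e1
      have h2 := Nat.mul_le_mul_right n (mul_le_tower_one hd)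
      calc tower b 1 * (6 * b * sameArcs G Q) = 6 * b * (tower b 1 * sameArcs G Q) := by ring
        _ ≤ 6 * b * (tower b 1 * J + 2 * (d - 1) * n) := h1
        _ = tower b 1 * (6 * b * J) + 12 * b * (d - 1) * n := by ring
        _ ≤ tower b 1 * (6 * b * J) + tower b 1 * n := Nat.add_le_add_left h2 _
        _ = _ := by ring
    have e7 := Nat.mul_le_mul_left (6 * b) (e3.trans (Nat.add_le_add_right (e4.trans c2) _))
    rw [Nat.mul_add] at e7
    generalize labelArcs G (fun u : Fin n => (chunksCmd.run s₁).arr 7 u) = X at *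
    have e8 : 6 * b * sameArcs G Q = 2 * (3 * b * sameArcs G Q) := by ring
    have e9 : 6 * b * X = 2 * (3 * b * X) := by ring
    omega

end Middle

end FairCC

/-! ### Correctness of the whole program -/

namespace FairCC

open RAM RAM.Expr RAM.Cmd Finset

variable {n k : ℕ} {G : SimpleGraph (Fin n)} [DecidableRel G.Adj] {c : Fin n → Fin k} {s : State}

theorem holds_middleE : middleE.Holds s ↔ 3 ≤ s.reg 11 ∧ s.reg 11 ≤ 4 * s.reg 3 + 2 := by
  simp only [middleE, holds_andE, holds_ltE, eval_lit, eval_var, eval_add]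
  omega

/-- The labels in array 7 are completed to a labeling of the vertices. -/
theorem complete_spec (h : Stores G c s) {g d : ℕ}
    (hP : Palette c (fun u : Fin n => s.arr 4 u) g d)
    (hf : ∀ u : Fin n, s.arr 7 u ≠ 0 → ∃ j, 0 < j ∧
      Multiple c (fun u : Fin n => s.arr 4 u) j (cls (fun u : Fin n => s.arr 7 u) (s.arr 7 u)))
    (hb : ∀ u : Fin n, s.arr 7 u ≤ n + n * s.reg 35) :
    FairLabeling c (fun u : Fin n => s.arr 4 u) (fun u : Fin n => (completeCmd.run s).arr 2 u) ∧
    (∀ u : Fin n, s.arr 7 u ≠ 0 →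
      cls (fun u : Fin n => (completeCmd.run s).arr 2 u) ((completeCmd.run s).arr 2 u) =
        cls (fun u : Fin n => s.arr 7 u) (s.arr 7 u)) ∧
    ∀ u : Fin n, s.arr 7 u = 0 → Multiple c (fun u : Fin n => s.arr 4 u) 1
      (cls (fun u : Fin n => (completeCmd.run s).arr 2 u) ((completeCmd.run s).arr 2 u)) := by
  obtain ⟨h1, h2⟩ := complete_labeling (f := fun u : Fin n => s.arr 7 u)
    (out := fun u : Fin n => (completeCmd.run s).arr 2 u) (base := 1 + n + n * s.reg 35) hP
    (fun u hu => (hf u hu).imp fun _ h => h.2) (fun u => by have := hb u; omega)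
    (fun u => completeCmd_spec h (fun v => hP.cc_pos v) u)
  refine ⟨FairLabeling.of_cls fun u => ?_, h1, h2⟩
  by_cases hu : s.arr 7 u = 0
  · exact ⟨1, Nat.one_pos, h2 u hu⟩
  · obtain ⟨j, hj, hm⟩ := hf u hu
    refine ⟨j, hj, ?_⟩
    have := h1 u hu
    rw [this]
    exact hm

theorem minimalLabeling_of_valid {cc h out : Fin n → ℕ} (hv : Valid c cc h)
    (h1 : ∀ u, h u ≠ 0 → cls out (out u) = cls h (h u))
    (h2 : ∀ u, h u = 0 → Multiple c cc 1 (cls out (out u))) : MinimalLabeling c cc out := by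
  intro i hi
  obtain ⟨u, -, rfl⟩ := mem_image.1 hi
  by_cases hu : h u = 0
  · exact h2 u hu
  · rw [h1 u hu]; exact hv u hu

theorem labelArcs_le_sameArcs {h out : Fin n → ℕ}
    (h1 : ∀ u, h u ≠ 0 → cls out (out u) = cls h (h u)) : labelArcs G h ≤ sameArcs G out := by
  refine card_le_card fun p hp => ?_
  simp only [mem_filter, mem_univ, true_and] at hp ⊢
  refine ⟨hp.1, ?_⟩
  have : p.2 ∈ cls out (out p.1) := by rw [h1 _ hp.2.2, mem_cls]; exact hp.2.1.symm
  exact (mem_cls.1 this).symm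

/-- The case distinction on `d`: search in the middle range, matchings for `d ≤ 2`, and no marks at
all for large `d`, where completion alone suffices. -/
theorem mainCmd_spec (h : Stores G c s) (hG : Degenerate G) (hn : 0 < n)
    (ht : ∀ i ≤ 17, s.reg (20 + i) = tower (s.reg 3) i)
    (h5 : ∀ u : Fin n, s.arr 5 u = 0) (h7 : ∀ u : Fin n, s.arr 7 u = 0) :
    ∃ cc g d, Palette c cc g d ∧
      FairLabeling c cc (fun u : Fin n => (mainCmd.run s).arr 2 u) ∧
      ∀ (ι : Type*) [DecidableEq ι] (f : Fin n → ι), FairLabeling c cc f →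
        Approximates G (s.reg 3) (fun u : Fin n => (mainCmd.run s).arr 2 u) f := by
  obtain ⟨g1, g2, g3⟩ := gcdCmd_spec h hn
  rw [mainCmd, run_seq, run_seq, run_seq, run_seq]
  have hS₁ : Stores G c (gcdCmd.run s) := h.run (by decide) (by decide) (by decide)
  have hP := paletteCmd_spec hS₁ g1 g2 g3
  generalize hs₂ : paletteCmd.run (gcdCmd.run s) = s₂ at *
  have hS₂ : Stores G c s₂ := by rw [← hs₂]; exact hS₁.run (by decide) (by decide) (by decide)
  have t2 : ∀ i ≤ 17, s₂.reg (20 + i) = tower (s.reg 3) i := by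
    intro i hi
    rw [← ht i hi, ← hs₂, run_reg _ _ _ (by interval_cases i <;> decide),
      run_reg _ _ _ (by interval_cases i <;> decide)]
  have b3 : s₂.reg 3 = s.reg 3 := by
    rw [← hs₂, run_reg _ _ _ (by decide), run_reg _ _ _ (by decide)]
  have a5 : s₂.arr 5 = s.arr 5 := by
    rw [← hs₂, run_arr _ _ _ (by decide), run_arr _ _ _ (by decide)]
  have a7 : s₂.arr 7 = s.arr 7 := by
    rw [← hs₂, run_arr _ _ _ (by decide), run_arr _ _ _ (by decide)]
  obtain ⟨⟨pc, hpc, hpI⟩, hmatch, hzero⟩ := eliminateCmd_spec hS₂ hG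
    (fun u => by rw [a5, h5]) (fun u => by rw [a7, h7]) (by rw [t2 1 (by decide)]; exact tower_pos _ 1)
  have hS₃ : Stores G c (eliminateCmd.run s₂) := hS₂.run (by decide) (by decide) (by decide)
  have t3 : ∀ i ≤ 17, (eliminateCmd.run s₂).reg (20 + i) = tower (s.reg 3) i := by
    intro i hi
    rw [← t2 i hi, run_reg _ _ _ (by interval_cases i <;> decide)]
  have c3 : (eliminateCmd.run s₂).reg 3 = s.reg 3 := by rw [← b3, run_reg _ _ _ (by decide)]
  have c11 : (eliminateCmd.run s₂).reg 11 = s₂.reg 11 := run_reg _ _ _ (by decide)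
  have a4 : (eliminateCmd.run s₂).arr 4 = s₂.arr 4 := run_arr _ _ _ (by decide)
  rw [t2 1 (by decide)] at hpI
  generalize eliminateCmd.run s₂ = s₃ at *
  generalize s₂.reg 11 = d at *
  rw [← a4] at hP
  generalize s.reg 3 = b at *
  refine ⟨fun u : Fin n => s₃.arr 4 u, (gcdCmd.run s).reg 10, d, hP, ?_⟩
  have hd0 : 0 < d := by
    have := hP.card_univ
    rw [Fintype.card_fin] at this
    exact Nat.pos_of_mul_pos_right (this ▸ hn)
  by_cases hmid : 3 ≤ d ∧ d ≤ 4 * b + 2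
  · rw [run_ite, if_pos (holds_middleE.2 (by rw [c11, c3]; exact hmid)), run_seq]
    obtain ⟨k1, k2, k3⟩ := search_spec hS₃ hP hmid.1 hmid.2 t3 hn (hzero hmid.1) hpc hpI
    have hS₄ : Stores G c (chunksCmd.run (dealCmd.run s₃)) :=
      (hS₃.run (by decide) (by decide) (by decide)).run (by decide) (by decide) (by decide)
    have d4 : (chunksCmd.run (dealCmd.run s₃)).arr 4 = s₃.arr 4 := by
      rw [run_arr _ _ _ (by decide), run_arr _ _ _ (by decide)]
    have d35 : (chunksCmd.run (dealCmd.run s₃)).reg 35 = s₃.reg 35 := by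
      rw [run_reg _ _ _ (by decide), run_reg _ _ _ (by decide)]
    generalize chunksCmd.run (dealCmd.run s₃) = s₄ at *
    rw [← d4] at hP k1 k3 ⊢
    obtain ⟨m1, m2, m3⟩ := complete_spec hS₄ hP (fun u hu => ⟨1, Nat.one_pos, k1 u hu⟩)
      (fun u => by rw [d35]; exact (k2 u).trans (Nat.le_add_left _ _))
    refine ⟨m1, fun ι _ f hf => ?_⟩
    refine approximates_of_sameArcs_le hP hG hmid.1 (minimalLabeling_of_valid k1 m2 m3) hf
      fun f' hf' => (k3 _ f' hf').trans ?_
    exact Nat.add_le_add_right (Nat.mul_le_mul_left _ (labelArcs_le_sameArcs m2)) _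
  · rw [run_ite, if_neg fun hc => hmid (by rw [holds_middleE, c11, c3] at hc; exact hc), run_skip]
    rcases Nat.lt_or_ge d 3 with hd | hd
    · have hM := hmatch hd
      have hbound : ∀ u : Fin n, s₃.arr 7 u ≤ n + n * s₃.reg 35 := fun u =>
        (hM.le_of_ne_zero u).trans (Nat.le_add_right _ _)
      have hpair := fun (u : Fin n) (hu : s₃.arr 7 u ≠ 0) =>
        cls_of_matchInv hM (fun _ _ => Matchable.symm) (u := u) hu
      obtain rfl | rfl : d = 1 ∨ d = 2 := by omega
      -- For `d = 1` a matched pair is not minimal: its multiplicity is 2. This is why completion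
      -- admits marked sets of any positive multiplicity.
      · obtain ⟨m1, m2, m3⟩ := complete_spec hS₃ hP (fun u hu => by
          obtain ⟨v, h1, -, h3⟩ := hpair u hu
          obtain ⟨j, hj⟩ := hP.exists_multiple (cls (fun u : Fin n => s₃.arr 7 u) (s₃.arr 7 u))
            (hP.multiple_of_one _)
          refine ⟨j, ?_, hj⟩
          have := hP.card_eq_of_multiple hj
          rw [h3, card_pair h1.symm] at this
          omega) hbound
        exact ⟨m1, fun ι _ f hf => approximates_of_one hP hG hM m2 m3 f⟩
      · have hv : Valid c (fun u : Fin n => s₃.arr 4 u) (fun u : Fin n => s₃.arr 7 u) := by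
          intro u hu
          obtain ⟨v, -, h2, h3⟩ := hpair u hu
          rw [h3]
          exact multiple_one_pair hP (h2.resolve_left (by decide))
        obtain ⟨m1, m2, m3⟩ := complete_spec hS₃ hP (fun u hu => ⟨1, Nat.one_pos, hv u hu⟩) hbound
        exact ⟨m1, fun ι _ f hf =>
          approximates_of_two hP hG hM m2 (minimalLabeling_of_valid hv m2 m3) hf⟩
    · have h0 := hzero hd
      have hv : Valid c (fun u : Fin n => s₃.arr 4 u) (fun u : Fin n => s₃.arr 7 u) :=
        fun u hu => absurd (h0 u) hu
      obtain ⟨m1, m2, m3⟩ := complete_spec hS₃ hP (fun u hu => ⟨1, Nat.one_pos, hv u hu⟩)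
        (fun u => by rw [h0]; exact Nat.zero_le _)
      exact ⟨m1, fun ι _ f hf => approximates_of_large hP hG (by omega)
        (minimalLabeling_of_valid hv m2 m3) hf⟩

theorem stores_inputState (ε : ℚ) : Stores G c (inputState G c ε) where
  reg := rfl
  col u := by simp [inputState]
  adj u v := by
    have hn := u.pos
    have e : (∃ u' v' : Fin n, u.val * n + v.val = u'.val * n + v'.val ∧ G.Adj u' v') ↔
        G.Adj u v := by
      constructor
      · rintro ⟨u', v', he, hadj⟩
        have h1 : u = u' := Fin.ext (by
          have := congrArg (· / n) he
          simpa only [Nat.mul_comm _ n, Nat.mul_add_div hn, Nat.div_eq_of_lt v.2,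
            Nat.div_eq_of_lt v'.2, add_zero] using this)
        subst h1
        have h2 : v = v' := Fin.ext (by omega)
        rw [h2]; exact hadj
      · exact fun hadj => ⟨u, v, rfl, hadj⟩
    simp only [inputState, one_ne_zero, if_false, if_true, e]

/-- The numerator of `ε` is at least 1, so `1 / ε.den ≤ ε`, and accuracy `1 / b` with `b = ε.den` is
enough. -/
theorem approx_of_nat_le {ε : ℚ} (hε : 0 < ε) {x y : ℕ} (h : ε.den * x ≤ (ε.den + 1) * y) :
    (x : ℝ) ≤ (1 + (ε : ℝ)) * y := by
  have hden : (0 : ℝ) < ε.den := by exact_mod_cast ε.den_pos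
  have h1 : (ε.den : ℝ) * x ≤ (ε.den + 1) * y := by exact_mod_cast h
  have h2 : (1 : ℝ) ≤ ε.den * (ε : ℝ) := by
    have h3 : ((ε.den * ε : ℚ) : ℝ) = (ε.num : ℝ) := by
      rw [mul_comm, Rat.mul_den_eq_num]; simp
    push_cast at h3
    rw [h3]
    exact_mod_cast Rat.num_pos.2 hε
  have hy : (0 : ℝ) ≤ y := Nat.cast_nonneg y
  refine le_of_mul_le_mul_left ?_ hden
  nlinarith

end FairCC

theorem mainTheorem7 :
    ∃ (A : RAM.Prog) (p : Polynomial ℕ),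
      FairCC.IsForestApproxScheme A (fun ε : ℚ => Polynomial.aeval (1 / (ε : ℝ)) p) := by
  classical
  obtain ⟨D, hD⟩ := FairCC.schemeProg_exec
  -- A constant polynomial suffices: the exponent is the loop depth of the program, and `ε`
  -- influences only `C`.
  refine ⟨FairCC.schemeProg, Polynomial.C D, fun ε hε => ?_⟩
  obtain ⟨C, hC⟩ := hD ε.den
  refine ⟨C, fun n k G c hn hG => ?_⟩
  obtain ⟨t, s', hrun, ht, s₁, hr, ha, htow, hout⟩ := hC (FairCC.inputState G c ε) rfl hn
  have hS : FairCC.Stores G c s₁ :=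
    (FairCC.stores_inputState ε).congr (hr 0 (by decide)) (by rw [ha]) (by rw [ha])
  have hb : s₁.reg 3 = ε.den := hr 3 (by decide)
  have hdeg := FairCC.Degenerate.of_isAcyclic hG
  obtain ⟨cc, g, d, hP, hfair, happ⟩ := FairCC.mainCmd_spec hS hdeg hn
    (by rw [hb]; exact htow) (fun u => by rw [ha]; rfl) (fun u => by rw [ha]; rfl)
  rw [hb] at happ
  obtain ⟨P, hPfair, hPpart⟩ := FairCC.exists_fairPartition hP hfair
  refine ⟨t, s', P, hrun, ?_, fun u v => by rw [hPpart, hout], hPfair, fun Q hQ => ?_⟩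
  · have ht : t ≤ C * n ^ D := ht
    beta_reduce
    rw [Polynomial.aeval_C, eq_natCast, Real.rpow_natCast]
    exact_mod_cast ht
  · refine FairCC.approx_of_nat_le hε ?_
    have h1 := happ _ Q.part (FairCC.fairLabeling_of_fairPartition hP hQ)
    have h2 := FairCC.two_mul_ccCost G P _ hPpart
    have h3 := FairCC.two_mul_ccCost G Q Q.part fun _ _ => Iff.rfl
    rw [FairCC.Approximates] at h1
    have h4 := congrArg (ε.den * ·) h2
    have h5 := congrArg ((ε.den + 1) * ·) h3
    nlinarith
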